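/- There are an algorithm and an absolute constant $C$ with the following property. Let $n\ge 1$, let $L\subset\mathbb R^n$ be an integral lattice of rank $n$ (that is, $(x,y)\in\mathbb Z$ for all $x,y\in L$, where $(\cdot,\cdot)$ is the standard inner product and $\|x\|=\sqrt{(x,x)}$), and let $B\in\mathbb R$ be such that the finite set $S=\{v_1,\dots,v_s\}=\{v\in L\setminus\{0\} : \|v\|\le B\}$, with $|S|=s$, generates $L$ as a group. Given $n$, $s$, $B$ and the coordinates of the vectors of $S$, listed in any order, the algorithm computes an orthogonal decomposition $L=L_1\oplus\dots\oplus L_r$ into indecomposable sublattices, each $L_i$ being given by a basis, and it uses at most $$C\,\bigl(n^6\log^2(nB)+s\,n^2\bigr)$$ arithmetic operations. Here a lattice $M\ne 0$ is called indecomposable if it is not the sum $M=M'+M''$ of two proper sublattices $M',M''\subsetneq M$ with $(M',M'')=0$. An algorithm is one fixed program, independent of the input, for a random access machine with exact real arithmetic; the operations $+,-,\cdot,/$, $\lfloor\cdot\rfloor$, the use of integer constants, comparisons, assignments and (indexed) memory accesses are all counted with unit cost. -/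

import Mathlib

namespace OrthDecomp

/-! ### Lattices and their orthogonal decompositions -/

/-- The `n`-dimensional Euclidean space of (column) vectors. -/
abbrev E (n : ℕ) : Type := EuclideanSpace ℝ (Fin n)

/-- `L` is integral: all inner products of vectors of `L` are integers. -/
def IsIntegral {n : ℕ} (L : Submodule ℤ (E n)) : Prop :=
  ∀ x ∈ L, ∀ y ∈ L, ∃ z : ℤ, inner ℝ x y = (z : ℝ)

/-- All vectors of `M` are orthogonal to all vectors of `N`. -/
def Orthogonal {n : ℕ} (M N : Submodule ℤ (E n)) : Prop :=
  ∀ x ∈ M, ∀ y ∈ N, inner ℝ x y = (0 : ℝ)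

/-- A nontrivial lattice is decomposable if it is the sum of two proper sublattices which
are orthogonal to each other. -/
def IsDecomposable {n : ℕ} (L : Submodule ℤ (E n)) : Prop :=
  L ≠ ⊥ ∧ ∃ M N : Submodule ℤ (E n), M < L ∧ N < L ∧ L = M ⊔ N ∧ Orthogonal M N

/-- A nontrivial lattice is indecomposable if it is not decomposable. -/
def IsIndecomposable {n : ℕ} (L : Submodule ℤ (E n)) : Prop :=
  L ≠ ⊥ ∧ ¬ IsDecomposable L

/-- `L = M 0 ⊕ ⋯ ⊕ M (r - 1)` is an (inner, direct) orthogonal decomposition of `L` into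
indecomposable sublattices. -/
structure IsIndecomposableDecomposition {n r : ℕ} (L : Submodule ℤ (E n))
    (M : Fin r → Submodule ℤ (E n)) : Prop where
  indecomposable : ∀ i, IsIndecomposable (M i)
  orthogonal : ∀ i j, i ≠ j → Orthogonal (M i) (M j)
  direct : iSupIndep M
  sum_eq : L = ⨆ i, M i

/-! ### A random access machine with exact real arithmetic

A program is a fixed finite text, independent of the input. It works on real variables and on
two-dimensional real arrays, and computes with integer constants, the four arithmetic
operations, the floor function, comparisons and indexed memory access. Every single one of these
costs one unit of time, so that the running time bounds the number of arithmetic operations. -/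

/-- The memory: real variables `x₀, x₁, …` and real arrays `A₀[·,·], A₁[·,·], …`. -/
structure State where
  var : ℕ → ℝ
  arr : ℕ → ℕ → ℕ → ℝ

/-- Arithmetic expressions; `get a i j` reads the entry `(i, j)` of the array `a`. -/
inductive Expr : Type
  | const (z : ℤ) : Expr
  | var (x : ℕ) : Expr
  | get (a : ℕ) (i j : Expr) : Expr
  | add (e f : Expr) : Expr
  | sub (e f : Expr) : Expr
  | mul (e f : Expr) : Expr
  | div (e f : Expr) : Expr
  | floor (e : Expr) : Expr

/-- The value of an expression. An array index is rounded down to a natural number, and a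
quotient with denominator `0` is `0`. -/
noncomputable def Expr.eval (σ : State) : Expr → ℝ
  | .const z => (z : ℝ)
  | .var x => σ.var x
  | .get a i j => σ.arr a ⌊i.eval σ⌋₊ ⌊j.eval σ⌋₊
  | .add e f => e.eval σ + f.eval σ
  | .sub e f => e.eval σ - f.eval σ
  | .mul e f => e.eval σ * f.eval σ
  | .div e f => e.eval σ / f.eval σ
  | .floor e => ((⌊e.eval σ⌋ : ℤ) : ℝ)

/-- The cost of evaluating an expression: one unit for every constant, memory access and
operation in it. -/
def Expr.cost : Expr → ℕ
  | .const _ => 1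
  | .var _ => 1
  | .get _ i j => i.cost + j.cost + 1
  | .add e f => e.cost + f.cost + 1
  | .sub e f => e.cost + f.cost + 1
  | .mul e f => e.cost + f.cost + 1
  | .div e f => e.cost + f.cost + 1
  | .floor e => e.cost + 1

/-- Programs. The test of `ite e f c d` and of `loop e f c` is the comparison `e < f`. -/
inductive Program : Type
  | skip : Program
  | assign (x : ℕ) (e : Expr) : Program
  | store (a : ℕ) (i j e : Expr) : Program
  | seq (c d : Program) : Program
  | ite (e f : Expr) (c d : Program) : Program
  | loop (e f : Expr) (c : Program) : Program

/-- Assignment to a variable. -/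
def State.setVar (σ : State) (x : ℕ) (v : ℝ) : State :=
  { σ with var := Function.update σ.var x v }

/-- Assignment to an array entry. -/
def State.setArr (σ : State) (a i j : ℕ) (v : ℝ) : State :=
  { σ with arr := fun a' i' j' => if a' = a ∧ i' = i ∧ j' = j then v else σ.arr a' i' j' }

/-- `Exec c σ t τ`: the program `c`, started in the memory state `σ`, halts after exactly `t`
units of time in the memory state `τ`. -/
inductive Exec : Program → State → ℕ → State → Prop
  | skip (σ : State) : Exec .skip σ 1 σ
  | assign (σ : State) (x : ℕ) (e : Expr) :
      Exec (.assign x e) σ (e.cost + 1) (σ.setVar x (e.eval σ))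
  | store (σ : State) (a : ℕ) (i j e : Expr) :
      Exec (.store a i j e) σ (i.cost + j.cost + e.cost + 1)
        (σ.setArr a ⌊i.eval σ⌋₊ ⌊j.eval σ⌋₊ (e.eval σ))
  | seq {c d : Program} {σ ρ τ : State} {t u : ℕ} (hc : Exec c σ t ρ) (hd : Exec d ρ u τ) :
      Exec (.seq c d) σ (t + u) τ
  | iteTrue {e f : Expr} {c d : Program} {σ τ : State} {t : ℕ} (h : e.eval σ < f.eval σ)
      (hc : Exec c σ t τ) : Exec (.ite e f c d) σ (e.cost + f.cost + 1 + t) τ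
  | iteFalse {e f : Expr} {c d : Program} {σ τ : State} {t : ℕ} (h : ¬ e.eval σ < f.eval σ)
      (hd : Exec d σ t τ) : Exec (.ite e f c d) σ (e.cost + f.cost + 1 + t) τ
  | loopTrue {e f : Expr} {c : Program} {σ ρ τ : State} {t u : ℕ} (h : e.eval σ < f.eval σ)
      (hc : Exec c σ t ρ) (hl : Exec (.loop e f c) ρ u τ) :
      Exec (.loop e f c) σ (e.cost + f.cost + 1 + t + u) τ
  | loopFalse {e f : Expr} {c : Program} {σ : State} (h : ¬ e.eval σ < f.eval σ) :
      Exec (.loop e f c) σ (e.cost + f.cost + 1) σ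

/-! ### Input and output -/

/-- The input: `x₀ = n`, `x₁ = s`, `x₂ = B`, and the row `i < s` of `A₀` holds the coordinates of
the `i`-th vector. The rest of the memory is `0`. -/
noncomputable def inputState (n s : ℕ) (B : ℝ) (v : Fin s → E n) : State where
  var := fun x => if x = 0 then (n : ℝ) else if x = 1 then (s : ℝ) else if x = 2 then B else 0
  arr := fun a i j => if h : a = 0 ∧ i < s ∧ j < n then v ⟨i, h.2.1⟩ ⟨j, h.2.2⟩ else 0

/-- The vector in the row `i` of the output array `A₁`. -/
noncomputable def outputVector (n : ℕ) (τ : State) (i : Fin n) : E n :=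
  WithLp.toLp 2 fun j : Fin n => τ.arr 1 i j

/-- The memory `τ` holds an orthogonal decomposition of `L` into indecomposable sublattices:
`x₀` is the number `r` of the sublattices, the rows `0, …, n - 1` of `A₁` hold linearly independent
vectors, and `A₂[0, i] ∈ {0, …, r - 1}` is the number of the sublattice to which the row `i` of `A₁`
belongs; the `k`-th sublattice is the one whose basis is formed by the rows belonging to `k`. -/
def OutputsDecomposition {n : ℕ} (L : Submodule ℤ (E n)) (τ : State) : Prop :=
  ∃ (r : ℕ) (c : Fin n → Fin r),
    τ.var 0 = (r : ℝ) ∧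
    (∀ i : Fin n, τ.arr 2 0 i = ((c i : ℕ) : ℝ)) ∧
    LinearIndependent ℝ (outputVector n τ) ∧
    IsIndecomposableDecomposition L
      (fun k : Fin r => Submodule.span ℤ (outputVector n τ '' {i | c i = k}))

end OrthDecomp

/-! If `L = M + N` is an orthogonal splitting and `x = m + k` with nonzero `m ∈ M`, `k ∈ N`, then
`m` and `k` are strictly shorter than `x`. Hence a vector that is shortest with respect to a
property inherited by `m` or by `k` cannot be split. This argument is used twice.

A greedy exchange yields a basis `b` of the space, with dual basis `d`, such that each `b i` is
shortest among the short vectors `y` with `(y, d i) ≠ 0`. So each `b i` lies on one side of every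
splitting (`mem_or_mem_of_minimal`). Labels are put on the indices in such a way that equal labels
force the same side in every splitting (`Unsplit`). Labels of non-orthogonal basis vectors may be
merged (`Unsplit.merge`); afterwards the space is the orthogonal sum of the spans of the labels, and
every `x` is the sum of its projections (`part`). The obstacle is that these parts may lie outside
`L`. If `x` is a shortest short vector with such a bad part, all labels of its bad parts may be
merged (`IsDual.unsplit_merge`). There are at least two of them, so fewer than `n` such merges
occur. Once no bad part is left, `L` is the sum of the pieces cut out by the labels, and `Unsplit`
makes these indecomposable (`IsDual.isIndecomposableDecomposition`).

Membership of a part in `L` is tested by one memory access per part. A part of a short vector has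
norm at most `B`, and its inner products with the `b i` are integers of size at most `B ^ 2`. Used
as digits, they form one integer which determines the part, and the array cell addressed by it tells
whether the part is zero or one of the input vectors (`Setting.dictionary`). A pass over the input
then costs `O(s n)`, and `n` passes cost `O(s n ^ 2)` plus `O(n ^ 2)`.

For bases of the pieces, the coordinate vectors of the input with respect to `b` are inserted one by
one into a triangular matrix, which is the unit matrix at first, by Euclidean algorithms acting
within the labels. With nearest integer quotients, a run of `p` steps lowers the binary logarithm of
a diagonal entry by at least `p - 2` (`Runs.euclid`). By Cramer's rule for the Gram matrix of `b`
the coordinates have a common denominator `D ≤ (n B ^ 2) ^ n`, so no diagonal entry drops below `1 /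
D` in absolute value. Over all input vectors there are thus at most `2 n s + n log₂ D` steps, each
of cost `O(n)`. Altogether the cost is `O(s n ^ 2 + n ^ 3 + n ^ 3 log (n B))`, which is within the
bound. -/

namespace OrthDecomp

/-! ### A program logic with running times -/

/-- The program `c`, started in `σ`, halts after a time `t` in a state `τ` with `Q t τ`. -/
def Runs (c : Program) (σ : State) (Q : ℕ → State → Prop) : Prop :=
  ∃ t τ, Exec c σ t τ ∧ Q t τ

theorem Runs.mono {c : Program} {σ : State} {Q Q' : ℕ → State → Prop} (h : Runs c σ Q)
    (hQ : ∀ t τ, Q t τ → Q' t τ) : Runs c σ Q' := by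
  obtain ⟨t, τ, h1, h2⟩ := h
  exact ⟨t, τ, h1, hQ t τ h2⟩

theorem Runs.skip {σ : State} {Q : ℕ → State → Prop} (h : Q 1 σ) : Runs .skip σ Q :=
  ⟨_, _, .skip σ, h⟩

theorem Runs.assign {σ : State} {x : ℕ} {e : Expr} {Q : ℕ → State → Prop}
    (h : Q (e.cost + 1) (σ.setVar x (e.eval σ))) : Runs (.assign x e) σ Q :=
  ⟨_, _, .assign σ x e, h⟩

theorem Runs.store {σ : State} {a : ℕ} {i j e : Expr} {Q : ℕ → State → Prop}
    (h : Q (i.cost + j.cost + e.cost + 1) (σ.setArr a ⌊i.eval σ⌋₊ ⌊j.eval σ⌋₊ (e.eval σ))) :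
    Runs (.store a i j e) σ Q :=
  ⟨_, _, .store σ a i j e, h⟩

theorem Runs.seq {c d : Program} {σ : State} {Q : ℕ → State → Prop}
    (h : Runs c σ fun t τ => Runs d τ fun u ρ => Q (t + u) ρ) : Runs (.seq c d) σ Q := by
  obtain ⟨t, τ, h1, u, ρ, h2, h3⟩ := h
  exact ⟨_, _, .seq h1 h2, h3⟩

theorem Runs.ite {e f : Expr} {c d : Program} {σ : State} {Q : ℕ → State → Prop}
    (h1 : e.eval σ < f.eval σ → Runs c σ fun t τ => Q (e.cost + f.cost + 1 + t) τ)
    (h2 : ¬ e.eval σ < f.eval σ → Runs d σ fun t τ => Q (e.cost + f.cost + 1 + t) τ) :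
    Runs (.ite e f c d) σ Q := by
  by_cases h : e.eval σ < f.eval σ
  · obtain ⟨t, τ, h3, h4⟩ := h1 h
    exact ⟨_, _, .iteTrue h h3, h4⟩
  · obtain ⟨t, τ, h3, h4⟩ := h2 h
    exact ⟨_, _, .iteFalse h h3, h4⟩

theorem Runs.loop_false {e f : Expr} {c : Program} {σ : State} {Q : ℕ → State → Prop}
    (h : ¬ e.eval σ < f.eval σ) (hQ : Q (e.cost + f.cost + 1) σ) : Runs (.loop e f c) σ Q :=
  ⟨_, _, .loopFalse h, hQ⟩

theorem Runs.loop_true {e f : Expr} {c : Program} {σ : State} {Q : ℕ → State → Prop}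
    (h : e.eval σ < f.eval σ)
    (hQ : Runs c σ fun t τ => Runs (.loop e f c) τ fun u ρ => Q (e.cost + f.cost + 1 + t + u) ρ) :
    Runs (.loop e f c) σ Q := by
  obtain ⟨t, τ, h1, u, ρ, h2, h3⟩ := hQ
  exact ⟨_, _, .loopTrue h h1 h2, h3⟩

/-- The variables to which a program assigns. -/
def Program.vars : Program → List ℕ
  | .skip => []
  | .assign x _ => [x]
  | .store _ _ _ _ => []
  | .seq c d => c.vars ++ d.vars
  | .ite _ _ c d => c.vars ++ d.vars
  | .loop _ _ c => c.vars

/-- The arrays in which a program stores. -/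
def Program.arrs : Program → List ℕ
  | .skip => []
  | .assign _ _ => []
  | .store a _ _ _ => [a]
  | .seq c d => c.arrs ++ d.arrs
  | .ite _ _ c d => c.arrs ++ d.arrs
  | .loop _ _ c => c.arrs

/-- Two memories agree outside the part to which `c` writes. -/
structure Frame (c : Program) (σ τ : State) : Prop where
  var : ∀ x, x ∉ c.vars → τ.var x = σ.var x
  arr : ∀ a, a ∉ c.arrs → τ.arr a = σ.arr a

@[simp] theorem State.setVar_var (σ : State) (x : ℕ) (r : ℝ) (y : ℕ) :
    (σ.setVar x r).var y = if y = x then r else σ.var y := by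
  simp [State.setVar, Function.update_apply]

@[simp] theorem State.setVar_arr (σ : State) (x : ℕ) (r : ℝ) : (σ.setVar x r).arr = σ.arr := rfl

@[simp] theorem State.setArr_var (σ : State) (a i j : ℕ) (r : ℝ) :
    (σ.setArr a i j r).var = σ.var := rfl

theorem State.setArr_arr (σ : State) (a i j : ℕ) (r : ℝ) (a' i' j' : ℕ) :
    (σ.setArr a i j r).arr a' i' j' =
      if a' = a ∧ i' = i ∧ j' = j then r else σ.arr a' i' j' := rfl

theorem State.setArr_arr_of_ne (σ : State) {a a' : ℕ} (i j : ℕ) (r : ℝ) (h : a' ≠ a) :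
    (σ.setArr a i j r).arr a' = σ.arr a' := by
  funext i' j'
  simp [State.setArr_arr, h]

/-- The written variables and arrays are lists computed from the text of the program, so for
concrete programs the side conditions of a frame are decidable. Invariants need to mention only what
a loop changes. -/
theorem Exec.frame {c : Program} {σ τ : State} {t : ℕ} (h : Exec c σ t τ) : Frame c σ τ := by
  induction h with
  | skip σ => exact ⟨fun _ _ => rfl, fun _ _ => rfl⟩
  | assign σ x e =>
    refine ⟨fun y hy => ?_, fun _ _ => rfl⟩
    simp only [Program.vars, List.mem_singleton] at hy
    simp [hy]
  | store σ a i j e =>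
    refine ⟨fun y hy => rfl, fun a' ha => ?_⟩
    simp only [Program.arrs, List.mem_singleton] at ha
    exact State.setArr_arr_of_ne _ _ _ _ ha
  | seq _ _ h1 h2 =>
    refine ⟨fun y hy => ?_, fun a ha => ?_⟩
    · simp only [Program.vars, List.mem_append, not_or] at hy
      rw [h2.var _ hy.2, h1.var _ hy.1]
    · simp only [Program.arrs, List.mem_append, not_or] at ha
      rw [h2.arr _ ha.2, h1.arr _ ha.1]
  | iteTrue _ _ h1 =>
    refine ⟨fun y hy => ?_, fun a ha => ?_⟩
    · simp only [Program.vars, List.mem_append, not_or] at hy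
      exact h1.var _ hy.1
    · simp only [Program.arrs, List.mem_append, not_or] at ha
      exact h1.arr _ ha.1
  | iteFalse _ _ h1 =>
    refine ⟨fun y hy => ?_, fun a ha => ?_⟩
    · simp only [Program.vars, List.mem_append, not_or] at hy
      exact h1.var _ hy.2
    · simp only [Program.arrs, List.mem_append, not_or] at ha
      exact h1.arr _ ha.2
  | loopTrue _ _ _ h1 h2 =>
    exact ⟨fun y hy => by rw [h2.var _ hy, h1.var _ hy],
      fun a ha => by rw [h2.arr _ ha, h1.arr _ ha]⟩
  | loopFalse _ => exact ⟨fun _ _ => rfl, fun _ _ => rfl⟩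

theorem Runs.frame {c : Program} {σ : State} {Q : ℕ → State → Prop} (h : Runs c σ Q) :
    Runs c σ fun t τ => Q t τ ∧ Frame c σ τ := by
  obtain ⟨t, τ, h1, h2⟩ := h
  exact ⟨t, τ, h1, h2, h1.frame⟩

/-- `for x = 0, …, y - 1 do c`, where `x` and `y` are variables. -/
def Program.for (x y : ℕ) (c : Program) : Program :=
  .seq (.assign x (.const 0))
    (.loop (.var x) (.var y) (.seq c (.assign x (.add (.var x) (.const 1)))))

/-- The rule for counting loops, with an invariant that may depend on the elapsed time. -/
theorem Runs.for_time {x y : ℕ} {c : Program} {σ : State} {N : ℕ} (I : ℕ → ℕ → State → Prop)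
    (hxy : y ≠ x) (hx : x ∉ c.vars) (hy : y ∉ c.vars) (hN : σ.var y = N)
    (h0 : I 0 5 (σ.setVar x 0))
    (hs : ∀ k < N, ∀ t, ∀ τ : State, τ.var x = (k : ℝ) → τ.var y = (N : ℝ) →
      Frame (.for x y c) σ τ → I k t τ →
      Runs c τ fun u ρ => I (k + 1) (t + u + 7) (ρ.setVar x ((k + 1 : ℕ) : ℝ))) :
    Runs (.for x y c) σ fun t τ => I N t τ ∧ τ.var x = N ∧ Frame (.for x y c) σ τ := by
  -- The time in `I` includes in advance the 3 units of the final failing test. Hence the initial 5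
  -- (2 for the assignment, 3 for that test) and the `- 3` here. A round costs 7 more than its body:
  -- 3 for the test and 4 for the increment.
  have key : ∀ m k t, ∀ τ : State, k + m = N → τ.var x = (k : ℝ) → τ.var y = (N : ℝ) →
      Frame (.for x y c) σ τ →
      I k t τ →
      Runs (.loop (.var x) (.var y) (.seq c (.assign x (.add (.var x) (.const 1))))) τ
        fun u ρ => I N (t + u - 3) ρ ∧ ρ.var x = N := by
    intro m
    induction m with
    | zero =>
      intro k t τ hk h1 h2 h3 h4
      obtain rfl : k = N := by omega
      apply Runs.loop_false
      · simp [Expr.eval, h1, h2]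
      · simpa [Expr.cost] using ⟨h4, h1⟩
    | succ m ih =>
      intro k t τ hk h1 h2 h3 h4
      apply Runs.loop_true
      · simp only [Expr.eval, h1, h2]
        exact_mod_cast (by omega : k < N)
      · apply Runs.seq
        refine (hs k (by omega) t τ h1 h2 h3 h4).frame.mono ?_
        rintro u ρ ⟨h5, h6⟩
        apply Runs.assign
        have e1 : ρ.var x = k := by rw [h6.var _ hx, h1]
        have e2 : ρ.setVar x ((Expr.add (.var x) (.const 1)).eval ρ)
            = ρ.setVar x ((k + 1 : ℕ) : ℝ) := by
          simp [Expr.eval, e1]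
        rw [e2]
        refine (ih (k + 1) _ _ (by omega) (by simp) ?_ ?_ h5).mono ?_
        · simp [hxy, h6.var _ hy, h2]
        · constructor
          · intro z hz
            have hz' : z ≠ x ∧ z ∉ c.vars := by
              simp only [Program.for, Program.vars, List.mem_append, List.mem_singleton] at hz
              tauto
            simp [hz'.1, h6.var _ hz'.2, h3.var _ hz]
          · intro a ha
            have ha' : a ∉ c.arrs := by
              simp only [Program.for, Program.arrs, List.mem_append] at ha
              tauto
            simp [h6.arr _ ha', h3.arr _ ha]
        · rintro u' ρ' h7
          simp only [Expr.cost]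
          refine ⟨?_, h7.2⟩
          have := h7.1
          convert this using 1
          omega
  have : Runs (.for x y c) σ fun t τ => I N t τ ∧ τ.var x = N := by
    apply Runs.seq
    apply Runs.assign
    have e2 : σ.setVar x ((Expr.const 0).eval σ) = σ.setVar x 0 := by
      simp [Expr.eval]
    rw [e2]
    refine (key N 0 5 _ (by omega) (by simp) (by simp [hxy, hN]) ?_ h0).mono ?_
    · constructor
      · intro z hz
        have hz' : z ≠ x := by
          simp only [Program.for, Program.vars, List.mem_append, List.mem_singleton] at hz
          tauto
        simp [hz']
      · intro a _
        simp
    · intro u ρ h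
      simp only [Expr.cost]
      refine ⟨?_, h.2⟩
      have := h.1
      convert this using 1
      omega
  exact this.frame.mono fun t τ h => ⟨h.1.1, h.1.2, h.2⟩

/-- The rule for counting loops, with a uniform bound for the running time of the body. -/
theorem Runs.for {x y : ℕ} {c : Program} {σ : State} {N : ℕ} (T T' : ℕ) (I : ℕ → State → Prop)
    (hxy : y ≠ x) (hx : x ∉ c.vars) (hy : y ∉ c.vars) (hN : σ.var y = N)
    (hT : 5 + N * (T + 7) ≤ T') (h0 : I 0 (σ.setVar x 0))
    (hs : ∀ k < N, ∀ τ : State, τ.var x = (k : ℝ) → τ.var y = (N : ℝ) → Frame (.for x y c) σ τ → I k τ →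
      Runs c τ fun u ρ => u ≤ T ∧ I (k + 1) (ρ.setVar x ((k + 1 : ℕ) : ℝ))) :
    Runs (.for x y c) σ fun t τ =>
      t ≤ T' ∧ I N τ ∧ τ.var x = N ∧ Frame (.for x y c) σ τ := by
  refine (Runs.for_time (fun k t τ => t ≤ 5 + k * (T + 7) ∧ I k τ) hxy hx hy hN ⟨by simp, h0⟩
    ?_).mono ?_
  · intro k hk t τ h1 h2 h3 h4
    refine (hs k hk τ h1 h2 h3 h4.2).mono ?_
    rintro u ρ ⟨h5, h6⟩
    refine ⟨?_, h6⟩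
    have := h4.1
    rw [Nat.succ_mul]
    omega
  · rintro t τ ⟨⟨h1, h2⟩, h3⟩
    exact ⟨h1.trans hT, h2, h3⟩

/-- `x := ∑ e`, the summation being over the values `0, …, y - 1` of `j`. -/
def Program.sum (x j y : ℕ) (e : Expr) : Program :=
  .seq (.assign x (.const 0)) (.for j y (.assign x (.add (.var x) e)))

/-- The hypothesis `he` leaves the value of the accumulator `x` open, so the summand must not depend
on it. -/
theorem Runs.sum {x j y : ℕ} {e : Expr} {σ : State} {N : ℕ} (T : ℕ) (f : ℕ → ℝ)
    (hjy : y ≠ j) (hjx : j ≠ x) (hyx : y ≠ x) (hN : σ.var y = N)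
    (hT : 7 + N * (e.cost + 10) ≤ T)
    (he : ∀ k < N, ∀ τ : State, τ.var j = k → (∀ z, z ≠ x → z ≠ j → τ.var z = σ.var z) →
      τ.arr = σ.arr → e.eval τ = f k) :
    Runs (.sum x j y e) σ fun t τ => t ≤ T ∧ τ.var x = ∑ k ∈ Finset.range N, f k ∧
      (∀ z, z ≠ x → z ≠ j → τ.var z = σ.var z) ∧ τ.arr = σ.arr := by
  apply Runs.seq
  apply Runs.assign
  refine (Runs.for (e.cost + 3) (5 + N * (e.cost + 3 + 7))
    (fun k τ => τ.var x = ∑ k ∈ Finset.range k, f k) hjy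
    (by simpa [Program.vars] using hjx) (by simpa [Program.vars] using hyx)
    (by simp [hyx, hN]) le_rfl (by simp [hjx.symm, Expr.eval]) ?_).mono ?_
  · intro k hk τ h1 h2 h3 h4
    apply Runs.assign
    refine ⟨by simp [Expr.cost]; omega, ?_⟩
    rw [Finset.sum_range_succ, ← h4, ← he k hk τ h1 ?_ ?_]
    · simp [hjx.symm, Expr.eval]
    · intro z hz1 hz2
      rw [h3.var]
      · simp [hz1]
      · simp [Program.for, Program.vars, hz1, hz2]
    · funext a
      rw [h3.arr]
      · rfl
      · simp [Program.for, Program.arrs]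
  · rintro t τ ⟨h1, h2, h3, h4⟩
    refine ⟨?_, h2, ?_, ?_⟩
    · simp only [Expr.cost]
      have : e.cost + 3 + 7 = e.cost + 10 := by omega
      rw [this] at h1
      omega
    · intro z hz1 hz2
      rw [h4.var]
      · simp [hz1]
      · simp [Program.for, Program.vars, hz1, hz2]
    · funext a
      rw [h4.arr]
      · rfl
      · simp [Program.for, Program.arrs]

/-- `A_a[i, j] := e` for `j = 0, …, y - 1`. -/
def Program.fill (a : ℕ) (i : Expr) (j y : ℕ) (e : Expr) : Program :=
  .for j y (.store a i (.var j) e)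

/-- In `he` only the first `k` entries of the row `r` may have changed, so a row can be updated in
place from its own old entries. -/
theorem Runs.fill {a j y : ℕ} {i e : Expr} {σ : State} {N : ℕ} (T : ℕ) (f : ℕ → ℝ) (r : ℕ)
    (hjy : y ≠ j) (hN : σ.var y = N) (hT : 5 + N * (i.cost + e.cost + 9) ≤ T)
    (he : ∀ k < N, ∀ τ : State, τ.var j = k → (∀ z, z ≠ j → τ.var z = σ.var z) →
      (∀ a', a' ≠ a → τ.arr a' = σ.arr a') →
      (∀ i' j', ¬ (i' = r ∧ j' < k) → τ.arr a i' j' = σ.arr a i' j') →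
      ⌊i.eval τ⌋₊ = r ∧ e.eval τ = f k) :
    Runs (.fill a i j y e) σ fun t τ => t ≤ T ∧
      (∀ i' j', τ.arr a i' j' = if i' = r ∧ j' < N then f j' else σ.arr a i' j') ∧
      (∀ z, z ≠ j → τ.var z = σ.var z) ∧ (∀ a', a' ≠ a → τ.arr a' = σ.arr a') := by
  refine (Runs.for (i.cost + e.cost + 2) (5 + N * (i.cost + e.cost + 2 + 7))
    (fun k τ => ∀ i' j', τ.arr a i' j' = if i' = r ∧ j' < k then f j' else σ.arr a i' j') hjy
    (by simp [Program.vars]) (by simp [Program.vars]) hN le_rfl (by simp) ?_).mono ?_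
  · intro k hk τ h1 h2 h3 h4
    apply Runs.store
    have := he k hk τ h1 ?_ ?_ ?_
    · refine ⟨by simp [Expr.cost]; omega, ?_⟩
      intro i' j'
      rw [this.1, this.2]
      have e3 : (Expr.var j).eval τ = (k : ℝ) := h1
      rw [e3, Nat.floor_natCast]
      simp only [State.setVar_arr, State.setArr_arr, true_and, h4]
      by_cases hi : i' = r
      · by_cases hj : j' = k
        · simp [hi, hj]
        · have : j' < k + 1 ↔ j' < k := by omega
          simp [hi, hj, this]
      · simp [hi]
    · intro z hz
      rw [h3.var]
      simp [Program.for, Program.vars, hz]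
    · intro a' ha
      rw [h3.arr]
      simp [Program.for, Program.arrs, ha]
    · intro i' j' hij
      rw [h4, if_neg hij]
  · rintro t τ ⟨h1, h2, h3, h4⟩
    refine ⟨h1.trans (by simpa [add_assoc] using hT), h2, ?_, ?_⟩
    · intro z hz
      rw [h4.var]
      simp [Program.for, Program.vars, hz]
    · intro a' ha
      rw [h4.arr]
      simp [Program.for, Program.arrs, ha]


/-! ### Lattice vectors of bounded norm, dual bases -/

/-- The nonzero vectors of `L` of norm at most `B`. -/
def shortVectors {n : ℕ} (L : Submodule ℤ (E n)) (B : ℝ) : Set (E n) :=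
  {x | x ∈ L ∧ x ≠ 0 ∧ ‖x‖ ≤ B}

/-- The families `b` and `d` are dual to each other. -/
def IsDual {n : ℕ} (b d : Fin n → E n) : Prop :=
  ∀ i j, inner ℝ (b i) (d j) = if i = j then (1 : ℝ) else 0

/-- The linear combination of the vectors `b i` with coefficients `c i`. -/
noncomputable def comb {n : ℕ} (b : Fin n → E n) (c : Fin n → ℝ) : E n := ∑ i, c i • b i

section Comb
variable {n : ℕ} (b : Fin n → E n)

theorem comb_add (c c' : Fin n → ℝ) : comb b (c + c') = comb b c + comb b c' := by
  simp [comb, add_smul, Finset.sum_add_distrib]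

theorem comb_smul (r : ℝ) (c : Fin n → ℝ) : comb b (r • c) = r • comb b c := by
  simp [comb, Finset.smul_sum, mul_smul]

theorem comb_zero : comb b 0 = 0 := by simp [comb]

theorem comb_sum {ι : Type*} (s : Finset ι) (c : ι → Fin n → ℝ) :
    comb b (∑ k ∈ s, c k) = ∑ k ∈ s, comb b (c k) := by
  classical
  induction s using Finset.induction_on with
  | empty => simp [comb_zero]
  | insert a s ha ih => rw [Finset.sum_insert ha, Finset.sum_insert ha, comb_add, ih]

end Comb

namespace IsDual
variable {n : ℕ} {b d : Fin n → E n}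

theorem inner_comb (h : IsDual b d) (c : Fin n → ℝ) (j : Fin n) :
    inner ℝ (comb b c) (d j) = c j := by
  simp [comb, sum_inner, inner_smul_left, h _ _]

theorem linearIndependent (h : IsDual b d) : LinearIndependent ℝ b := by
  rw [Fintype.linearIndependent_iff]
  intro c hc j
  have := h.inner_comb c j
  rw [comb, hc, inner_zero_left] at this
  exact this.symm

theorem comb_inner (h : IsDual b d) (x : E n) : comb b (fun i => inner ℝ x (d i)) = x := by
  have hspan := h.linearIndependent.span_eq_top_of_card_eq_finrank' (by simp)
  have hx : x ∈ Submodule.span ℝ (Set.range b) := by rw [hspan]; trivial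
  obtain ⟨c, rfl⟩ := (Submodule.mem_span_range_iff_exists_fun ℝ).1 hx
  change comb b (fun i => inner ℝ (comb b c) (d i)) = comb b c
  simp only [h.inner_comb]

theorem ext (h : IsDual b d) {x y : E n} (hxy : ∀ i, inner ℝ x (b i) = inner ℝ y (b i)) :
    x = y := by
  refine ext_inner_right ℝ fun z => ?_
  rw [← h.comb_inner z]
  simp [comb, inner_sum, inner_smul_right, hxy]

/-- Replacing one vector of a pair of dual bases. -/
theorem exchange (h : IsDual b d) (x : E n) (m : Fin n) (hm : inner ℝ x (d m) ≠ 0) :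
    IsDual (Function.update b m x) (fun i => if i = m then (inner ℝ x (d m))⁻¹ • d m else
      d i - (inner ℝ x (d i) * (inner ℝ x (d m))⁻¹) • d m) := by
  intro i j
  by_cases hi : i = m
  · subst hi
    by_cases hj : j = i
    · subst hj
      simp [inner_smul_right, hm]
    · simp [hj, Ne.symm hj, inner_sub_right, inner_smul_right, hm]
  · by_cases hj : j = m
    · subst hj
      simp [hi, inner_smul_right, h i j]
    · simp [hi, hj, inner_sub_right, inner_smul_right, h i j, h i m]

end IsDual

/-! ### Splittings of a lattice -/

/-- Pythagoras. This strict inequality is behind both minimality arguments. -/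
theorem Orthogonal.norm_lt {n : ℕ} {M N : Submodule ℤ (E n)} (h : Orthogonal M N) {x y : E n}
    (hx : x ∈ M) (hy : y ∈ N) (hy0 : y ≠ 0) : ‖x‖ < ‖x + y‖ := by
  have h1 := norm_add_sq_real x y
  rw [h x hx y hy] at h1
  have h2 : 0 < ‖y‖ := norm_pos_iff.2 hy0
  nlinarith [norm_nonneg x, norm_nonneg (x + y)]

theorem Orthogonal.symm {n : ℕ} {M N : Submodule ℤ (E n)} (h : Orthogonal M N) :
    Orthogonal N M := fun x hx y hy => by rw [real_inner_comm]; exact h y hy x hx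

/-- A short vector which is minimal for some functional belongs to one side of a splitting. -/
theorem mem_or_mem_of_minimal {n : ℕ} {L M N : Submodule ℤ (E n)} {B : ℝ} (hL : L = M ⊔ N)
    (hMN : Orthogonal M N) {x d : E n} (hx : x ∈ shortVectors L B) (hd : inner ℝ x d ≠ (0 : ℝ))
    (hmin : ∀ y ∈ shortVectors L B, inner ℝ y d ≠ (0 : ℝ) → ‖x‖ ≤ ‖y‖) : x ∈ M ∨ x ∈ N := by
  obtain ⟨hxL, hx0, hxB⟩ := hx
  rw [hL] at hxL
  obtain ⟨m, hm, k, hk, rfl⟩ := Submodule.mem_sup.1 hxL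
  by_cases hm0 : m = 0
  · right; simpa [hm0] using hk
  by_cases hk0 : k = 0
  · left; simpa [hk0] using hm
  exfalso
  -- Both components are strictly shorter than `x`, hence short vectors of `L`. Minimality makes
  -- both orthogonal to `d`, and then so is their sum `x`.
  have h1 := hMN.norm_lt hm hk hk0
  have h2 := hMN.symm.norm_lt hk hm hm0
  rw [add_comm k m] at h2
  have h3 : inner ℝ m d = (0 : ℝ) := by
    by_contra hne
    exact absurd (hmin m ⟨by rw [hL]; exact Submodule.mem_sup_left hm, hm0, h1.le.trans hxB⟩ hne)
      (not_le.2 h1)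
  have h4 : inner ℝ k d = (0 : ℝ) := by
    by_contra hne
    exact absurd (hmin k ⟨by rw [hL]; exact Submodule.mem_sup_right hk, hk0, h2.le.trans hxB⟩ hne)
      (not_le.2 h2)
  exact hd (by rw [inner_add_left, h3, h4, add_zero])

/-- Indices with the same label lie on the same side of every orthogonal splitting of `L`. -/
def Unsplit {n : ℕ} (L : Submodule ℤ (E n)) (b : Fin n → E n) (g : Fin n → ℕ) : Prop :=
  ∀ M N : Submodule ℤ (E n), L = M ⊔ N → Orthogonal M N → ∀ i j, g i = g j →
    (b i ∈ M ∧ b j ∈ M) ∨ (b i ∈ N ∧ b j ∈ N)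

/-- The coefficients with label `a`. -/
def mask {n : ℕ} (g : Fin n → ℕ) (a : ℕ) (c : Fin n → ℝ) : Fin n → ℝ :=
  fun i => if g i = a then c i else 0

/-- The part of `x` spanned by the vectors `b i` with label `a`; here `d` is dual to `b`. -/
noncomputable def part {n : ℕ} (b d : Fin n → E n) (g : Fin n → ℕ) (a : ℕ) (x : E n) : E n :=
  comb b (mask g a fun i => inner ℝ x (d i))

section Part
variable {n : ℕ} {b d : Fin n → E n} {g : Fin n → ℕ}

theorem sum_mask {A : Finset ℕ} (hA : ∀ i, g i ∈ A) (c : Fin n → ℝ) :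
    ∑ a ∈ A, mask g a c = c := by
  funext i
  simp [mask, Finset.sum_apply, hA i]

theorem IsDual.sum_part (h : IsDual b d) {A : Finset ℕ} (hA : ∀ i, g i ∈ A) (x : E n) :
    ∑ a ∈ A, part b d g a x = x := by
  simp only [part]
  rw [← comb_sum, sum_mask hA, h.comb_inner]

theorem part_add (a : ℕ) (x y : E n) :
    part b d g a (x + y) = part b d g a x + part b d g a y := by
  rw [part, part, part, ← comb_add]
  congr 1
  funext i
  by_cases hi : g i = a <;> simp [mask, hi, inner_add_left]

/-- Only terms with the label of `j` contribute to the inner product with `b j`, and the mask keeps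
all or none of these. -/
theorem inner_comb_mask (hg : ∀ i j, inner ℝ (b i) (b j) ≠ (0 : ℝ) → g i = g j)
    (c : Fin n → ℝ) (a : ℕ) (j : Fin n) :
    inner ℝ (comb b (mask g a c)) (b j) = if g j = a then inner ℝ (comb b c) (b j) else 0 := by
  simp only [comb, sum_inner, inner_smul_left, mask]
  split_ifs with h
  · refine Finset.sum_congr rfl fun i _ => ?_
    by_cases h1 : inner ℝ (b i) (b j) = (0 : ℝ)
    · simp [h1]
    · simp [hg i j h1, h]
  · refine Finset.sum_eq_zero fun i _ => ?_
    by_cases h1 : inner ℝ (b i) (b j) = (0 : ℝ)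
    · simp [h1]
    · simp [hg i j h1, h]

theorem IsDual.inner_part (h : IsDual b d)
    (hg : ∀ i j, inner ℝ (b i) (b j) ≠ (0 : ℝ) → g i = g j) (a : ℕ) (x : E n) (j : Fin n) :
    inner ℝ (part b d g a x) (b j) = if g j = a then inner ℝ x (b j) else 0 := by
  rw [part, inner_comb_mask hg, h.comb_inner]

/-- Taking the part is an orthogonal projection. Consequently a part of a short vector that lies in
`L` is itself short or zero. -/
theorem IsDual.norm_part_le (h : IsDual b d)
    (hg : ∀ i j, inner ℝ (b i) (b j) ≠ (0 : ℝ) → g i = g j) (a : ℕ) (x : E n) :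
    ‖part b d g a x‖ ≤ ‖x‖ := by
  have h1 : inner ℝ (x - part b d g a x) (part b d g a x) = (0 : ℝ) := by
    conv_lhs => rw [part]; rw [comb]
    rw [inner_sum]
    refine Finset.sum_eq_zero fun i _ => ?_
    rw [inner_smul_right, inner_sub_left]
    change _ * (_ - inner ℝ (part b d g a x) (b i)) = (0 : ℝ)
    rw [h.inner_part hg]
    by_cases hi : g i = a <;> simp [mask, hi]
  have h2 := norm_add_sq_real (x - part b d g a x) (part b d g a x)
  rw [h1, sub_add_cancel] at h2
  have h3 : ‖part b d g a x‖ ^ 2 ≤ ‖x‖ ^ 2 := by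
    rw [h2]; nlinarith [sq_nonneg ‖x - part b d g a x‖]
  exact (sq_le_sq₀ (norm_nonneg _) (norm_nonneg _)).1 h3

theorem IsDual.part_eq_zero (h : IsDual b d)
    (hg : ∀ i j, inner ℝ (b i) (b j) ≠ (0 : ℝ) → g i = g j) {a : ℕ} {x : E n}
    (hx : ∀ j, g j = a → inner ℝ x (b j) = (0 : ℝ)) : part b d g a x = 0 := by
  refine h.ext fun i => ?_
  rw [h.inner_part hg, inner_zero_left]
  split_ifs with hi
  · exact hx i hi
  · rfl

/-- If `x` is a shortest vector with a part outside `L`, then all labels of parts of `x` outside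
`L` may be identified. -/
theorem IsDual.unsplit_merge {L : Submodule ℤ (E n)} {B : ℝ} (h : IsDual b d)
    (hg : ∀ i j, inner ℝ (b i) (b j) ≠ (0 : ℝ) → g i = g j) (hu : Unsplit L b g) {x : E n}
    (hx : x ∈ shortVectors L B)
    (hmin : ∀ y ∈ shortVectors L B, (∃ i, part b d g (g i) y ∉ L) → ‖x‖ ≤ ‖y‖)
    {g' : Fin n → ℕ}
    (hg' : ∀ i j, g' i = g' j → g i = g j ∨ (part b d g (g i) x ∉ L ∧ part b d g (g j) x ∉ L)) :
    Unsplit L b g' := by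
  intro M N hL hMN
  -- The case of opposite sides, in a form that can be applied with `M` and `N` exchanged.
  have key : ∀ M N : Submodule ℤ (E n), L = M ⊔ N → Orthogonal M N → ∀ i j, b i ∈ M → b j ∈ N →
      part b d g (g i) x ∉ L → part b d g (g j) x ∉ L →
      (b i ∈ M ∧ b j ∈ M) ∨ (b i ∈ N ∧ b j ∈ N) := by
    intro M N hL hMN i j hi hj h1 h2
    by_contra hcon
    obtain ⟨hxL, hx0, hxB⟩ := hx
    have hxL' := hxL
    rw [hL] at hxL'
    obtain ⟨m, hm, k, hk, rfl⟩ := Submodule.mem_sup.1 hxL'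
    -- Since `b i` and `b j` are not on a common side, the whole label of `i` lies in `M` and that
    -- of `j` in `N`. So the bad part at `i` comes from `m` alone and the one at `j` from `k` alone.
    -- Both are therefore nonzero, and `m` is a shorter vector with a bad part.
    have e1 : part b d g (g i) k = 0 := by
      refine h.part_eq_zero hg fun l hl => ?_
      rcases hu M N hL hMN l i hl with h3 | h3
      · exact hMN.symm k hk _ h3.1
      · exact absurd (Or.inr ⟨h3.2, hj⟩) hcon
    have e2 : part b d g (g j) m = 0 := by
      refine h.part_eq_zero hg fun l hl => ?_
      rcases hu M N hL hMN l j hl with h3 | h3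
      · exact absurd (Or.inl ⟨hi, h3.2⟩) hcon
      · exact hMN m hm _ h3.1
    rw [part_add, e1, add_zero] at h1
    rw [part_add, e2, zero_add] at h2
    have z : ∀ a, part b d g a 0 = 0 := fun a => h.part_eq_zero hg (by simp)
    have hm0 : m ≠ 0 := by
      rintro rfl
      exact h1 (by rw [z]; exact L.zero_mem)
    have hk0 : k ≠ 0 := by
      rintro rfl
      exact h2 (by rw [z]; exact L.zero_mem)
    have h3 := hMN.norm_lt hm hk hk0
    exact absurd (hmin m ⟨by rw [hL]; exact Submodule.mem_sup_left hm, hm0, h3.le.trans hxB⟩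
      ⟨i, h1⟩) (not_le.2 h3)
  intro i j hij
  rcases hg' i j hij with h1 | ⟨h1, h2⟩
  · exact hu M N hL hMN i j h1
  rcases hu M N hL hMN i i rfl with h3 | h3 <;> rcases hu M N hL hMN j j rfl with h4 | h4
  · exact Or.inl ⟨h3.1, h4.1⟩
  · exact key M N hL hMN i j h3.1 h4.1 h1 h2
  · exact (key N M (by rw [hL, sup_comm]) hMN.symm i j h3.1 h4.1 h1 h2).symm
  · exact Or.inr ⟨h3.1, h4.1⟩

/-- A vector of `L` which has a part outside `L` has at least two. -/
theorem IsDual.exists_part_notMem {L : Submodule ℤ (E n)} (h : IsDual b d) {x : E n} (hx : x ∈ L)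
    {i : Fin n} (hi : part b d g (g i) x ∉ L) : ∃ j, g j ≠ g i ∧ part b d g (g j) x ∉ L := by
  by_contra! hcon
  apply hi
  have h1 := h.sum_part (A := Finset.univ.image g) (g := g) (fun i => by simp) x
  rw [← Finset.add_sum_erase _ _ (by simp : g i ∈ Finset.univ.image g)] at h1
  rw [eq_sub_of_add_eq h1]
  refine L.sub_mem hx (L.sum_mem fun a ha => ?_)
  obtain ⟨h2, h3⟩ := Finset.mem_erase.1 ha
  obtain ⟨j, -, rfl⟩ := Finset.mem_image.1 h3
  exact hcon j h2

/-- Vectors of nonzero inner product may get the same label. -/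
theorem Unsplit.merge {L : Submodule ℤ (E n)} (hu : Unsplit L b g) {p q : Fin n}
    (hpq : inner ℝ (b p) (b q) ≠ (0 : ℝ)) {g' : Fin n → ℕ}
    (hg' : ∀ i j, g' i = g' j → g i = g j ∨ (g i = g p ∧ g j = g q) ∨ (g i = g q ∧ g j = g p)) :
    Unsplit L b g' := by
  intro M N hL hMN
  have key : (b p ∈ M ∧ b q ∈ M) ∨ (b p ∈ N ∧ b q ∈ N) := by
    rcases hu M N hL hMN p p rfl with h3 | h3 <;> rcases hu M N hL hMN q q rfl with h4 | h4
    · exact Or.inl ⟨h3.1, h4.1⟩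
    · exact absurd (hMN _ h3.1 _ h4.1) hpq
    · exact absurd (hMN.symm _ h3.1 _ h4.1) hpq
    · exact Or.inr ⟨h3.1, h4.1⟩
  -- The two sides meet in zero only, so the nonzero `b p` and `b q` determine their side. This
  -- excludes the mixed cases below.
  have h0 : ∀ x, x ∈ M → x ∈ N → x = 0 := fun x hx hx' => inner_self_eq_zero.1 (hMN x hx x hx')
  have hp : b p ≠ 0 := by rintro h; exact hpq (by rw [h, inner_zero_left])
  have hq : b q ≠ 0 := by rintro h; exact hpq (by rw [h, inner_zero_right])
  intro i j hij
  rcases hg' i j hij with h1 | ⟨h1, h2⟩ | ⟨h1, h2⟩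
  · exact hu M N hL hMN i j h1
  · rcases key with hk | hk <;> rcases hu M N hL hMN i p h1 with h3 | h3 <;>
      rcases hu M N hL hMN j q h2 with h4 | h4
    · exact Or.inl ⟨h3.1, h4.1⟩
    · exact absurd (h0 _ hk.2 h4.2) hq
    · exact absurd (h0 _ hk.1 h3.2) hp
    · exact absurd (h0 _ hk.1 h3.2) hp
    · exact absurd (h0 _ h3.2 hk.1) hp
    · exact absurd (h0 _ h3.2 hk.1) hp
    · exact absurd (h0 _ h4.2 hk.2) hq
    · exact Or.inr ⟨h3.1, h4.1⟩
  · rcases key with hk | hk <;> rcases hu M N hL hMN i q h1 with h3 | h3 <;>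
      rcases hu M N hL hMN j p h2 with h4 | h4
    · exact Or.inl ⟨h3.1, h4.1⟩
    · exact absurd (h0 _ hk.1 h4.2) hp
    · exact absurd (h0 _ hk.2 h3.2) hq
    · exact absurd (h0 _ hk.2 h3.2) hq
    · exact absurd (h0 _ h3.2 hk.2) hq
    · exact absurd (h0 _ h3.2 hk.2) hq
    · exact absurd (h0 _ h4.2 hk.1) hp
    · exact Or.inr ⟨h3.1, h4.1⟩

end Part


/-! ### From a final grouping to the decomposition, and denominators of coordinates -/

section Decomposition
variable {n : ℕ} {b d : Fin n → E n} {g : Fin n → ℕ}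

theorem Orthogonal.span {s t : Set (E n)} (h : ∀ x ∈ s, ∀ y ∈ t, inner ℝ x y = (0 : ℝ)) :
    Orthogonal (Submodule.span ℤ s) (Submodule.span ℤ t) := by
  intro x hx y hy
  induction hx using Submodule.span_induction with
  | mem x hx =>
    induction hy using Submodule.span_induction with
    | mem y hy => exact h x hx y hy
    | zero => simp
    | add y z _ _ h1 h2 => rw [inner_add_right, h1, h2, add_zero]
    | smul a y _ h1 => rw [← Int.cast_smul_eq_zsmul ℝ, inner_smul_right, h1, mul_zero]
  | zero => simp
  | add y z _ _ h1 h2 => rw [inner_add_left, h1, h2, add_zero]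
  | smul a y _ h1 => rw [← Int.cast_smul_eq_zsmul ℝ, inner_smul_left, h1, mul_zero]

theorem span_image_iSup {ι κ : Type*} (f : ι → E n) (c : ι → κ) :
    Submodule.span ℤ (Set.range f) = ⨆ k, Submodule.span ℤ (f '' {i | c i = k}) := by
  rw [← Submodule.span_iUnion]
  congr 1
  ext x
  simp

/-- The decomposition obtained from a grouping `g` that cannot be refined and a basis `comb b (H k)`
of `L` adapted to it. -/
theorem IsDual.isIndecomposableDecomposition {L : Submodule ℤ (E n)} (h : IsDual b d)
    (hg : ∀ i j, inner ℝ (b i) (b j) ≠ (0 : ℝ) → g i = g j) (hu : Unsplit L b g)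
    {H : Fin n → Fin n → ℝ} (hH : ∀ k j, g j ≠ g k → H k j = 0) (hd : ∀ k, H k k ≠ 0)
    (hHL : ∀ k, comb b (H k) ∈ L)
    (hspan : L ≤ Submodule.span ℤ (Set.range fun k => comb b (H k)))
    {r : ℕ} {c : Fin n → Fin r} (hc : ∀ i j, c i = c j ↔ g i = g j)
    (hcs : Function.Surjective c) :
    IsIndecomposableDecomposition L
      (fun k => Submodule.span ℤ ((fun k => comb b (H k)) '' {i | c i = k})) := by
  set f : Fin n → E n := fun k => comb b (H k) with hf
  have hL : L = Submodule.span ℤ (Set.range f) :=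
    le_antisymm hspan (Submodule.span_le.2 (by rintro _ ⟨k, rfl⟩; exact hHL k))
  have horth : ∀ s t : Set (Fin r), Disjoint s t →
      Orthogonal (Submodule.span ℤ (f '' {i | c i ∈ s})) (Submodule.span ℤ (f '' {i | c i ∈ t})) := by
    intro s t hst
    refine Orthogonal.span ?_
    rintro _ ⟨i, hi, rfl⟩ _ ⟨j, hj, rfl⟩
    have hij : g i ≠ g j := by
      intro e
      have : c i = c j := (hc i j).2 e
      exact Set.disjoint_left.1 hst hi (this ▸ hj)
    simp only [hf, comb, sum_inner, inner_sum, inner_smul_left, inner_smul_right]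
    refine Finset.sum_eq_zero fun p _ => ?_
    by_cases h2 : g p = g j
    · refine mul_eq_zero_of_right _ (Finset.sum_eq_zero fun q _ => ?_)
      by_cases h1 : g q = g i
      · have : inner ℝ (b q) (b p) = (0 : ℝ) := by
          by_contra hne
          exact hij (by rw [← h1, hg q p hne, h2])
        simp [this]
      · simp [hH i q h1]
    · simp [hH j p h2]
  have hsing : ∀ i j, i ≠ j →
      Orthogonal (Submodule.span ℤ (f '' {l | c l = i})) (Submodule.span ℤ (f '' {l | c l = j})) := by
    intro i j hij
    simpa using horth {i} {j} (by simpa using hij)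
  have hcompl : ∀ i : Fin r, L = Submodule.span ℤ (f '' {l | c l = i}) ⊔
      Submodule.span ℤ (f '' {l | c l ∈ ({i}ᶜ : Set (Fin r))}) := by
    intro i
    rw [← Submodule.span_union, ← Set.image_union, hL]
    congr 1
    ext x
    simp [Classical.em]
  have hoc : ∀ i : Fin r, Orthogonal (Submodule.span ℤ (f '' {l | c l = i}))
      (Submodule.span ℤ (f '' {l | c l ∈ ({i}ᶜ : Set (Fin r))})) := by
    intro i
    simpa using horth {i} {i}ᶜ disjoint_compl_right
  refine ⟨?_, hsing, ?_, ?_⟩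
  · intro a
    obtain ⟨i, rfl⟩ := hcs a
    refine ⟨?_, ?_⟩
    · rw [Submodule.ne_bot_iff]
      refine ⟨f i, Submodule.subset_span ⟨i, rfl, rfl⟩, ?_⟩
      intro h0
      have := h.inner_comb (H i) i
      change inner ℝ (f i) (d i) = _ at this
      rw [h0, inner_zero_left] at this
      exact hd i this.symm
    · rintro ⟨-, M, N, hM, hN, hMN, ho⟩
      -- The component lies in the real span of the `b j` with the label of `i`, and all other `b j`
      -- are orthogonal to that span. So a vector of the component is determined by its products
      -- with the `b j` of this label.
      have hzero : ∀ x ∈ Submodule.span ℤ (f '' {l | c l = c i}),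
          (∀ j, g j = g i → inner ℝ x (b j) = (0 : ℝ)) → x = 0 := by
        intro x hx h0
        refine h.ext fun j => ?_
        rw [inner_zero_left]
        by_cases hj : g j = g i
        · exact h0 j hj
        · have hspx : x ∈ (Submodule.span ℝ (b '' {j | g j = g i})).restrictScalars ℤ := by
            refine Submodule.span_le.2 ?_ hx
            rintro _ ⟨l, hl, rfl⟩
            refine Submodule.sum_mem _ fun q _ => ?_
            by_cases hq : g q = g l
            · exact Submodule.smul_mem (Submodule.span ℝ (b '' {j | g j = g i})) _
                (Submodule.subset_span ⟨q, by simp [hq, (hc l i).1 hl], rfl⟩)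
            · rw [hH l q hq, zero_smul]
              exact Submodule.zero_mem _
          have : ∀ y ∈ Submodule.span ℝ (b '' {j | g j = g i}), inner ℝ y (b j) = (0 : ℝ) := by
            intro y hy
            induction hy using Submodule.span_induction with
            | mem y hy =>
              obtain ⟨l, hl, rfl⟩ := hy
              by_contra hne
              exact hj ((hg l j hne).symm.trans hl)
            | zero => simp
            | add y z _ _ h1 h2 => rw [inner_add_left, h1, h2, add_zero]
            | smul a y _ h1 => rw [inner_smul_left, h1, mul_zero]
          exact this x hspx
      -- A splitting of one component extends to a splitting of `L` when the other components are
      -- added to `N`. Only to the latter does `Unsplit` apply.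
      have ho' : Orthogonal M (N ⊔ Submodule.span ℤ (f '' {l | c l ∈ ({c i}ᶜ : Set (Fin r))})) := by
        intro x hx y hy
        obtain ⟨y1, hy1, y2, hy2, rfl⟩ := Submodule.mem_sup.1 hy
        rw [inner_add_right, ho x hx y1 hy1, hoc (c i) x (hM.le hx) y2 hy2, add_zero]
      have hL' : L = M ⊔ (N ⊔ Submodule.span ℤ (f '' {l | c l ∈ ({c i}ᶜ : Set (Fin r))})) := by
        rw [← sup_assoc, ← hMN, ← hcompl]
      rcases hu _ _ hL' ho' i i rfl with hi | hi
      -- All `b j` of the label follow `b i` into `M`. As `N` is orthogonal to them it vanishes, and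
      -- `M` is not proper.
      · have hN0 : N = ⊥ := by
          rw [eq_bot_iff]
          intro x hx
          refine hzero x (hN.le hx) fun j hj => ?_
          rcases hu _ _ hL' ho' j i hj with hji | hji
          · rw [real_inner_comm]; exact ho _ hji.1 x hx
          · exact absurd (inner_self_eq_zero.1 (ho' _ hi.1 _ hji.2)) (h.linearIndependent.ne_zero i)
        rw [hN0, sup_bot_eq] at hMN
        exact hM.ne hMN.symm
      · have hM0 : M = ⊥ := by
          rw [eq_bot_iff]
          intro x hx
          refine hzero x (hM.le hx) fun j hj => ?_
          rcases hu _ _ hL' ho' j i hj with hji | hji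
          · exact absurd (inner_self_eq_zero.1 (ho' _ hji.2 _ hi.1)) (h.linearIndependent.ne_zero i)
          · exact ho' x hx _ hji.1
        rw [hM0, bot_sup_eq] at hMN
        exact hN.ne hMN.symm
  · intro i
    rw [Submodule.disjoint_def]
    intro x hx hx'
    have hle : (⨆ j, ⨆ (_ : j ≠ i), Submodule.span ℤ (f '' {l | c l = j})) ≤
        Submodule.span ℤ (f '' {l | c l ∈ ({i}ᶜ : Set (Fin r))}) := by
      refine iSup₂_le fun j hj => Submodule.span_mono (Set.image_mono ?_)
      intro l hl
      have hl' : c l = j := hl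
      simp [hl', hj]
    exact inner_self_eq_zero.1 (hoc i x hx x (hle hx'))
  · rw [hL]
    exact span_image_iSup f c

/-- Pairing a relation with `d` gives a relation between the rows of `H`, a triangular matrix with
nonzero diagonal. -/
theorem IsDual.linearIndependent_comb (h : IsDual b d) {H : Fin n → Fin n → ℝ}
    (ht : ∀ k j, k < j → H k j = 0) (hd : ∀ k, H k k ≠ 0) :
    LinearIndependent ℝ fun k => comb b (H k) := by
  rw [Fintype.linearIndependent_iff]
  intro a ha
  have hdet : (Matrix.of H).det ≠ 0 := by
    rw [Matrix.det_of_isLowerTriangular]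
    · exact Finset.prod_ne_zero_iff.2 fun k _ => hd k
    · intro i j hij
      exact ht i j hij
  have : Matrix.vecMul a (Matrix.of H) = 0 := by
    funext j
    have h1 : inner ℝ (∑ k, a k • comb b (H k)) (d j) = (0 : ℝ) := by rw [ha, inner_zero_left]
    simp only [sum_inner, inner_smul_left, h.inner_comb] at h1
    simpa [Matrix.vecMul, dotProduct] using h1
  have := Matrix.eq_zero_of_vecMul_eq_zero hdet this
  exact fun i => congrFun this i

/-- The coordinates of the vectors of an integral lattice with respect to vectors of the lattice
have a common denominator. -/
theorem IsDual.exists_denominator {L : Submodule ℤ (E n)} (hL : IsIntegral L) (h : IsDual b d)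
    (hb : ∀ i, b i ∈ L) {B : ℝ} (hB : ∀ i, ‖b i‖ ≤ B) (hn : 0 < n) :
    ∃ D : ℕ, 0 < D ∧ (D : ℝ) ≤ (n * B ^ 2) ^ n ∧
      ∀ x ∈ L, ∀ i, ∃ z : ℤ, (D : ℝ) * inner ℝ x (d i) = z := by
  choose G hG using fun i j => hL (b i) (hb i) (b j) (hb j)
  -- The denominator is the absolute value of the Gram determinant. The coordinate row `c` of `x`
  -- satisfies `c A = ((x, b j))_j`, which is integral, so multiplying by the adjugate shows that
  -- `det A • c` is integral.
  set A : Matrix (Fin n) (Fin n) ℤ := Matrix.of G with hA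
  have hAR : A.map (Int.cast : ℤ → ℝ) = Matrix.of fun i j => (inner ℝ (b i) (b j) : ℝ) := by
    ext i j
    simp [hA, hG]
  have hmul : ∀ c : Fin n → ℝ, Matrix.vecMul c (A.map (Int.cast : ℤ → ℝ)) =
      fun j => inner ℝ (comb b c) (b j) := by
    intro c
    rw [hAR]
    funext j
    simp [Matrix.vecMul, dotProduct, comb, sum_inner, inner_smul_left]
  have hdetR : (A.map (Int.cast : ℤ → ℝ)).det = ((A.det : ℤ) : ℝ) := by
    exact ((Int.castRingHom ℝ).map_det A).symm
  have hdet : A.det ≠ 0 := by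
    intro h0
    rw [h0, Int.cast_zero] at hdetR
    obtain ⟨c, hc0, hc⟩ := Matrix.exists_vecMul_eq_zero_iff.2 hdetR
    apply hc0
    rw [hmul] at hc
    have h1 : comb b c = 0 := h.ext fun j => by
      rw [inner_zero_left]; exact congrFun hc j
    funext j
    have := h.inner_comb c j
    rw [h1, inner_zero_left] at this
    exact this.symm
  refine ⟨A.det.natAbs, Int.natAbs_pos.2 hdet, ?_, ?_⟩
  · have hB0 : 0 ≤ B := (norm_nonneg _).trans (hB ⟨0, hn⟩)
    -- The Leibniz formula, with entries bounded by Cauchy–Schwarz. The claimed bound follows from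
    -- `n! ≤ n ^ n`.
    have h1 : |(A.map (Int.cast : ℤ → ℝ)).det| ≤ (n.factorial : ℝ) * (B ^ 2) ^ n := by
      have := Matrix.det_le (A := A.map (Int.cast : ℤ → ℝ)) (abv := AbsoluteValue.abs) (x := B ^ 2)
        (fun i j => by
          rw [hAR]
          simp only [Matrix.of_apply, AbsoluteValue.abs_apply]
          calc |inner ℝ (b i) (b j)| ≤ ‖b i‖ * ‖b j‖ := abs_real_inner_le_norm _ _
            _ ≤ B * B := mul_le_mul (hB i) (hB j) (norm_nonneg _) hB0
            _ = B ^ 2 := by ring)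
      simpa [nsmul_eq_mul] using this
    rw [hdetR] at h1
    have h2 : ((A.det.natAbs : ℕ) : ℝ) = |((A.det : ℤ) : ℝ)| := by
      rw [Nat.cast_natAbs, Int.cast_abs]
    rw [h2]
    refine h1.trans ?_
    rw [mul_pow]
    gcongr
    exact_mod_cast Nat.factorial_le_pow n
  · intro x hx i
    choose y hy using fun j => hL x hx (b j) (hb j)
    have h1 := hmul fun i => inner ℝ x (d i)
    rw [h.comb_inner] at h1
    have h2 : (A.det : ℝ) * inner ℝ x (d i) =
        ((Matrix.vecMul y A.adjugate i : ℤ) : ℝ) := by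
      have h3 := congrArg (fun w => Matrix.vecMul w (A.map (Int.cast : ℤ → ℝ)).adjugate i) h1
      simp only [Matrix.vecMul_vecMul, Matrix.mul_adjugate, hdetR, Matrix.vecMul_smul,
        Matrix.vecMul_one, Pi.smul_apply, smul_eq_mul] at h3
      rw [h3]
      have h4 : (A.map (Int.cast : ℤ → ℝ)).adjugate = A.adjugate.map (Int.cast : ℤ → ℝ) :=
        ((Int.castRingHom ℝ).map_adjugate A).symm
      rw [h4]
      simp [Matrix.vecMul, dotProduct, hy]
    rcases Int.natAbs_eq A.det with h3 | h3
    · refine ⟨_, Eq.trans ?_ h2⟩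
      congr 1
      rw [h3]
      simp
    · refine ⟨-(Matrix.vecMul y A.adjugate i), ?_⟩
      push_cast
      rw [← h2, h3]
      simp

end Decomposition

/-- Small integers are determined by the number of which they are the digits. -/
theorem eq_zero_of_sum_mul_pow (R : ℤ) (n : ℕ) (z : ℕ → ℤ) (hz : ∀ i < n, |z i| < R)
    (h : ∑ i ∈ Finset.range n, z i * R ^ i = 0) : ∀ i < n, z i = 0 := by
  induction n generalizing z with
  | zero => intro i hi; omega
  | succ n ih =>
    rw [Finset.sum_range_succ'] at h
    have h1 : ∑ i ∈ Finset.range n, z (i + 1) * R ^ (i + 1) =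
        R * ∑ i ∈ Finset.range n, z (i + 1) * R ^ i := by
      rw [Finset.mul_sum]
      refine Finset.sum_congr rfl fun i _ => by ring
    rw [h1, pow_zero, mul_one] at h
    -- The lowest digit is divisible by `R` and smaller than `R` in absolute value.
    have h2 : z 0 = 0 := by
      refine Int.eq_zero_of_abs_lt_dvd ?_ (hz 0 (by omega))
      exact ⟨-∑ i ∈ Finset.range n, z (i + 1) * R ^ i, by linarith⟩
    have hR : R ≠ 0 := by
      have := hz 0 (by omega)
      have := abs_nonneg (z 0)
      omega
    rw [h2, add_zero] at h
    have h3 := ih (fun i => z (i + 1)) (fun i hi => hz (i + 1) (by omega))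
      ((mul_eq_zero.1 h).resolve_left hR)
    intro i hi
    rcases i with _ | i
    · exact h2
    · exact h3 i (by omega)


/-! ### Rows of arrays as vectors -/

/-- The row `i` of an array as a vector. -/
noncomputable def row (n : ℕ) (A : ℕ → ℕ → ℝ) (i : ℕ) : E n := WithLp.toLp 2 fun j : Fin n => A i j

/-- The first `n` rows of an array. -/
noncomputable def rows (n : ℕ) (A : ℕ → ℕ → ℝ) (i : Fin n) : E n := row n A i

theorem sum_mul_eq_inner (n : ℕ) (A A' : ℕ → ℕ → ℝ) (i i' : ℕ) :
    ∑ j ∈ Finset.range n, A i j * A' i' j = inner ℝ (row n A i) (row n A' i') := by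
  rw [Finset.sum_range, PiLp.inner_apply]
  refine Finset.sum_congr rfl fun j _ => ?_
  simp [row, mul_comm]

theorem row_eq_iff {n : ℕ} {A : ℕ → ℕ → ℝ} {i : ℕ} {x : E n} :
    row n A i = x ↔ ∀ j : Fin n, A i j = x j := by
  constructor
  · rintro rfl j
    rfl
  · intro h
    ext j
    exact h j

theorem row_congr {n : ℕ} {A A' : ℕ → ℕ → ℝ} {i i' : ℕ} (h : ∀ j < n, A i j = A' i' j) :
    row n A i = row n A' i' :=
  row_eq_iff.2 fun j => h j j.2

/-! ### A basis of short vectors -/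

namespace Program

/-- `A₃` and `A₄` become the unit matrix, and `A₅` the sentinel weight. -/
def initBasis : Program :=
  .for 3 0 (.seq (.store 3 (.var 3) (.var 3) (.const 1))
    (.seq (.store 4 (.var 3) (.var 3) (.const 1))
      (.store 5 (.const 0) (.var 3) (.add (.mul (.var 2) (.var 2)) (.const 1)))))

/-- The coordinates of the input vector `u = x₅` go to `A₁₂`; the largest weight above `x₈` of a
basis vector which occurs in it goes to `x₈`, its index to `x₉`. -/
def coords : Program :=
  .for 3 0 (.seq (.sum 6 4 0 (.mul (.get 0 (.var 5) (.var 4)) (.get 4 (.var 3) (.var 4))))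
    (.seq (.store 12 (.const 0) (.var 3) (.var 6))
      (.ite (.const 0) (.mul (.var 6) (.var 6))
        (.ite (.var 8) (.get 5 (.const 0) (.var 3))
          (.seq (.assign 9 (.var 3)) (.assign 8 (.get 5 (.const 0) (.var 3)))) .skip) .skip)))

/-- The basis vector `x₉` is replaced by the input vector `x₅`. -/
def exchange : Program :=
  .seq (.assign 10 (.get 12 (.const 0) (.var 9)))
  (.seq (.fill 4 (.var 9) 4 0 (.div (.get 4 (.var 9) (.var 4)) (.var 10)))
  (.seq (.for 3 0 (.ite (.const 0) (.mul (.sub (.var 3) (.var 9)) (.sub (.var 3) (.var 9)))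
    (.fill 4 (.var 3) 4 0 (.sub (.get 4 (.var 3) (.var 4))
      (.mul (.get 12 (.const 0) (.var 3)) (.get 4 (.var 9) (.var 4))))) .skip))
  (.seq (.fill 3 (.var 9) 4 0 (.get 0 (.var 5) (.var 4)))
    (.store 5 (.const 0) (.var 9) (.var 7)))))

/-- One input vector is processed. -/
def improve : Program :=
  .seq (.sum 7 4 0 (.mul (.get 0 (.var 5) (.var 4)) (.get 0 (.var 5) (.var 4))))
  (.seq (.store 6 (.const 0) (.var 5) (.var 7))
  (.seq (.assign 8 (.var 7))
  (.seq coords (.ite (.var 7) (.var 8) exchange .skip))))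

/-- A basis of shortest vectors. -/
def minimalBasis : Program := .seq initBasis (.for 5 1 improve)

end Program

/-- The standard basis is its own dual. Its weight `B ^ 2 + 1` exceeds the squared norm of every
input vector and marks what still has to be replaced. -/
theorem Runs.initBasis {n : ℕ} {B : ℝ} {σ : State} (hn : σ.var 0 = n) (hB : σ.var 2 = B)
    (h3 : σ.arr 3 = 0) (h4 : σ.arr 4 = 0) :
    Runs .initBasis σ fun t τ => t ≤ 5 + n * 50 ∧
      (∀ i < n, ∀ j, τ.arr 3 i j = if i = j then 1 else 0) ∧
      (∀ i < n, ∀ j, τ.arr 4 i j = if i = j then 1 else 0) ∧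
      (∀ i < n, τ.arr 5 0 i = B ^ 2 + 1) := by
  refine (Runs.for 43 _ (fun k τ => (∀ i j, τ.arr 3 i j = if i = j ∧ i < k then 1 else 0) ∧
      (∀ i j, τ.arr 4 i j = if i = j ∧ i < k then 1 else 0) ∧
      (∀ i < k, τ.arr 5 0 i = B ^ 2 + 1)) (by decide) (by decide) (by decide) hn le_rfl
      (by simp [h3, h4]) ?_).mono ?_
  · rintro k hk τ h1 h2 hF ⟨i3, i4, i5⟩
    have hB' : τ.var 2 = B := by rw [hF.var 2 (by decide), hB]
    apply Runs.seq
    apply Runs.store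
    apply Runs.seq
    apply Runs.store
    apply Runs.store
    simp only [Expr.cost, Expr.eval, State.setArr_var, State.setVar_arr, h1, Nat.floor_natCast,
      State.setArr_arr, hB']
    refine ⟨by omega, ?_, ?_, ?_⟩
    · intro i j
      simp only [show (3 : ℕ) ≠ 5 by decide, show (3 : ℕ) ≠ 4 by decide, false_and, if_false,
        true_and, i3]
      split_ifs <;> first | rfl | omega | simp
    · intro i j
      simp only [show (4 : ℕ) ≠ 5 by decide, show (4 : ℕ) ≠ 3 by decide, false_and, if_false,
        true_and, i4]
      split_ifs <;> first | rfl | omega | simp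
    · intro i hi
      by_cases hik : i = k
      · simp [hik, pow_two]
      · simp [hik, i5 i (by omega)]
  · rintro t τ ⟨ht, ⟨i3, i4, i5⟩, -, -⟩
    exact ⟨ht, fun i hi j => by simp [i3, hi], fun i hi j => by simp [i4, hi], i5⟩

/-- The final value of `x₈` is the maximum of `w` and of the weights of the basis vectors that occur
in the input vector. In the application `w` is the squared norm of that vector, so `x₈` exceeds `w`
exactly if an exchange pays. -/
theorem Runs.coords {n u : ℕ} {w : ℝ} {σ : State} (hn : σ.var 0 = n) (hu : σ.var 5 = u)
    (hw : σ.var 8 = w) {c : ℕ → ℝ}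
    (hc : ∀ i, c i = ∑ j ∈ Finset.range n, σ.arr 0 u j * σ.arr 4 i j) :
    Runs .coords σ fun t τ => t ≤ 5 + n * (50 + n * 20) ∧
      (∀ i < n, τ.arr 12 0 i = c i) ∧ w ≤ τ.var 8 ∧
      (∀ i < n, c i ≠ 0 → σ.arr 5 0 i ≤ τ.var 8) ∧
      (τ.var 8 = w ∨ ∃ m < n, τ.var 9 = m ∧ c m ≠ 0 ∧ τ.var 8 = σ.arr 5 0 m) := by
  refine (Runs.for (43 + n * 20) (5 + n * (50 + n * 20)) (fun k τ => (∀ i < k, τ.arr 12 0 i = c i) ∧ w ≤ τ.var 8 ∧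
      (∀ i < k, c i ≠ 0 → σ.arr 5 0 i ≤ τ.var 8) ∧
      (τ.var 8 = w ∨ ∃ m < k, τ.var 9 = m ∧ c m ≠ 0 ∧ τ.var 8 = σ.arr 5 0 m))
      (by decide) (by decide) (by decide) hn (le_of_eq (by ring)) (by simp [hw]) ?_).mono ?_
  · rintro k hk τ h1 h2 hF ⟨i1, i2, i3, i4⟩
    have hu' : τ.var 5 = u := by rw [hF.var 5 (by decide), hu]
    have a0 := hF.arr 0 (by decide)
    have a4 := hF.arr 4 (by decide)
    have a5 := hF.arr 5 (by decide)
    apply Runs.seq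
    refine (Runs.sum (7 + n * 20) (fun j => σ.arr 0 u j * σ.arr 4 k j) (by decide) (by decide)
      (by decide) h2 (by simp only [Expr.cost]; omega) ?_).mono ?_
    · intro j hj ρ e1 e2 e3
      simp [Expr.eval, e1, e2, e3, hu', h1, a0, a4]
    rintro t ρ ⟨ht, e1, e2, e3⟩
    rw [← hc] at e1
    have e8 := e2 8 (by decide) (by decide)
    have e9 := e2 9 (by decide) (by decide)
    have e33 := e2 3 (by decide) (by decide)
    apply Runs.seq
    apply Runs.store
    simp only [Expr.cost, Expr.eval, e33, h1, Nat.floor_natCast, e1, Int.cast_zero, Nat.floor_zero]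
    have h12 : ∀ i < k + 1, (ρ.setArr 12 0 k (c k)).arr 12 0 i = c i := by
      intro i hi
      by_cases hik : i = k
      · simp [State.setArr_arr, hik]
      · simp [State.setArr_arr, hik, e3, i1 i (by omega)]
    have h5 : (ρ.setArr 12 0 k (c k)).arr 5 = σ.arr 5 := by
      rw [State.setArr_arr_of_ne _ _ _ _ (by decide), e3, a5]
    apply Runs.ite
    · intro hck
      -- The machine compares by `<` only, so `c k ≠ 0` is tested as `0 < c k * c k`. The same
      -- device is used for all tests of inequality.
      have hck0 : c k ≠ 0 := by
        intro h0
        simp [Expr.eval, e1, h0] at hck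
      apply Runs.ite
      · intro hlt
        apply Runs.seq
        apply Runs.assign
        apply Runs.assign
        simp only [Expr.cost, Expr.eval, State.setVar_var, State.setVar_arr, State.setArr_var,
          e33, h1, h5, Nat.floor_natCast, Int.cast_zero, Nat.floor_zero] at hlt ⊢
        simp only [e8] at hlt
        refine ⟨by omega, h12, ?_, ?_, ?_⟩
        · simp; linarith
        · intro i hi hci
          simp
          by_cases hik : i = k
          · simp [hik]
          · exact (i3 i (by omega) hci).trans hlt.le
        · right
          exact ⟨k, by omega, by simp, hck0, by simp⟩
      · intro hlt
        apply Runs.skip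
        simp only [Expr.cost, Expr.eval, State.setVar_var, State.setVar_arr, State.setArr_var,
          e33, h1, h5, Nat.floor_natCast, Int.cast_zero, Nat.floor_zero] at hlt ⊢
        refine ⟨by omega, h12, ?_, ?_, ?_⟩
        · simpa [e8] using i2
        · intro i hi hci
          simp [e8]
          by_cases hik : i = k
          · rw [hik]; rw [← e8]; exact not_lt.1 hlt
          · exact i3 i (by omega) hci
        · simp [e8, e9]
          rcases i4 with h | ⟨m, hm, h⟩
          · exact Or.inl h
          · exact Or.inr ⟨m, by omega, h⟩
    · intro hck
      have hck0 : c k = 0 := by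
        by_contra h0
        apply hck
        simp [Expr.eval, e1, h0]
      apply Runs.skip
      simp only [Expr.cost]
      refine ⟨by omega, h12, ?_, ?_, ?_⟩
      · simpa [e8] using i2
      · intro i hi hci
        simp [e8]
        by_cases hik : i = k
        · rw [hik] at hci; exact absurd hck0 hci
        · exact i3 i (by omega) hci
      · simp [e8, e9]
        rcases i4 with h | ⟨m, hm, h⟩
        · exact Or.inl h
        · exact Or.inr ⟨m, by omega, h⟩
  · rintro t τ ⟨ht, h, -, -⟩
    exact ⟨ht, h⟩

/-- These are the formulas of `IsDual.exchange`. The row `m` of the dual basis is rescaled first,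
and multiples of the rescaled row are subtracted from the others. -/
theorem Runs.exchange {n u m : ℕ} {σ : State} (hn : σ.var 0 = n) (hu : σ.var 5 = u)
    (hm : σ.var 9 = m) (hmn : m < n) :
    Runs .exchange σ fun t τ => t ≤ 30 + n * (80 + n * 25) ∧
      (∀ i j, i < n → j < n → τ.arr 4 i j = if i = m then σ.arr 4 m j / σ.arr 12 0 m else
        σ.arr 4 i j - σ.arr 12 0 i * (σ.arr 4 m j / σ.arr 12 0 m)) ∧
      (∀ i j, j < n → τ.arr 3 i j = if i = m then σ.arr 0 u j else σ.arr 3 i j) ∧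
      (∀ i, τ.arr 5 0 i = if i = m then σ.var 7 else σ.arr 5 0 i) := by
  apply Runs.seq
  apply Runs.assign
  apply Runs.seq
  refine (Runs.fill (5 + n * 20) (fun j => σ.arr 4 m j / σ.arr 12 0 m) m (by decide)
    (by simpa using hn) (by simp only [Expr.cost]; omega) ?_).mono ?_
  · intro k hk τ h1 h2 h3 h4
    have e9 := h2 9 (by decide)
    have e10 := h2 10 (by decide)
    have := h4 m k (by omega)
    simp only [State.setVar_var, if_true] at e9 e10
    simp [Expr.eval, e9, hm] at e10 this ⊢
    rw [e10, h1, Nat.floor_natCast, this]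
  rintro t1 τ1 ⟨ht1, f4, fv, fa⟩
  have v0 := fv 0 (by decide)
  have v5 := fv 5 (by decide)
  have v7 := fv 7 (by decide)
  have v9 := fv 9 (by decide)
  have a0 := fa 0 (by decide)
  have a3 := fa 3 (by decide)
  have a5 := fa 5 (by decide)
  have a12 := fa 12 (by decide)
  simp only [State.setVar_var, State.setVar_arr] at v0 v5 v7 v9 a0 a3 a5 a12 f4
  norm_num at v0 v5 v7 v9
  apply Runs.seq
  refine (Runs.for (25 + n * 25) (5 + n * (32 + n * 25))
    (fun k τ => ∀ i j, τ.arr 4 i j = if i = m ∨ k ≤ i ∨ n ≤ j then τ1.arr 4 i j else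
      τ1.arr 4 i j - σ.arr 12 0 i * τ1.arr 4 m j) (by decide) (by decide) (by decide)
      (v0.trans hn) (le_of_eq (by ring)) (by simp) ?_).mono ?_
  · rintro k hk τ h1 h2 hF hI
    have e9 : τ.var 9 = m := by rw [hF.var 9 (by decide), v9, hm]
    have e12 : τ.arr 12 = σ.arr 12 := by rw [hF.arr 12 (by decide), a12]
    apply Runs.ite
    · intro hlt
      have hkm : k ≠ m := by
        rintro rfl
        simp [Expr.eval, e9, h1] at hlt
      refine (Runs.fill (5 + n * 25) (fun j => τ.arr 4 k j - σ.arr 12 0 k * τ.arr 4 m j) k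
        (by decide) h2 (by simp only [Expr.cost]; omega) ?_).mono ?_
      · intro j hj ρ r1 r2 r3 r4
        have r12 := r3 12 (by decide)
        have r33 := r2 3 (by decide)
        have r9 := r2 9 (by decide)
        simp only [Expr.eval, r33, r9, e9, h1, r12, e12, r1, Nat.floor_natCast, Int.cast_zero,
          Nat.floor_zero, r4 k j (by omega), r4 m j (by omega)]
        simp
      · rintro t ρ ⟨r1, r2, r3, r4⟩
        refine ⟨by simp only [Expr.cost]; omega, ?_⟩
        intro i j
        simp only [State.setVar_arr, r2, hI]
        by_cases hik : i = k
        · subst hik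
          by_cases hj : j < n
          · simp [hj, hkm]
          · simp [hj, not_lt.1 hj]
        · have : k + 1 ≤ i ↔ k ≤ i := by omega
          simp [hik, this]
    · intro hlt
      have hkm : k = m := by
        by_contra hne
        apply hlt
        simp only [Expr.eval, e9, h1]
        have : (k : ℝ) - m ≠ 0 := sub_ne_zero.2 (by exact_mod_cast hne)
        simpa using this
      apply Runs.skip
      refine ⟨by simp only [Expr.cost]; omega, ?_⟩
      intro i j
      simp only [State.setVar_arr, hI]
      by_cases him : i = m
      · simp [him]
      · have : k + 1 ≤ i ↔ k ≤ i := by omega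
        simp [him, this]
  rintro t2 τ2 ⟨ht2, g4, -, gF⟩
  have w0 := gF.var 0 (by decide)
  have w5 := gF.var 5 (by decide)
  have w7 := gF.var 7 (by decide)
  have w9 := gF.var 9 (by decide)
  have b0 := gF.arr 0 (by decide)
  have b3 := gF.arr 3 (by decide)
  have b5 := gF.arr 5 (by decide)
  rw [v0, hn] at w0
  rw [v5, hu] at w5
  rw [v7] at w7
  rw [v9, hm] at w9
  rw [a0] at b0
  rw [a3] at b3
  rw [a5] at b5
  apply Runs.seq
  refine (Runs.fill (5 + n * 20) (fun j => σ.arr 0 u j) m (by decide)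
    w0 (by simp only [Expr.cost]; omega) ?_).mono ?_
  · intro k hk τ h1 h2 h3 h4
    simp [Expr.eval, h1, h2, h3, w9, w5, b0]
  rintro t3 τ3 ⟨ht3, k3, kv, ka⟩
  have x7 := kv 7 (by decide)
  have x9 := kv 9 (by decide)
  have c4 := ka 4 (by decide)
  have c5 := ka 5 (by decide)
  apply Runs.store
  simp only [Expr.cost, Expr.eval, x9, w9, x7, w7, Nat.floor_natCast, Int.cast_zero,
    Nat.floor_zero]
  refine ⟨?_, ?_, ?_, ?_⟩
  · have : n * (32 + n * 25) = n * 32 + n * (n * 25) := by ring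
    have : n * (80 + n * 25) = n * 80 + n * (n * 25) := by ring
    have : 0 < n := by omega
    omega
  · intro i j hi hj
    rw [State.setArr_arr_of_ne _ _ _ _ (by decide), c4, g4]
    by_cases him : i = m
    · simp [him, f4, hj]
    · simp [him, f4, hj, not_le.2 hi, not_le.2 hj]
  · intro i j hj
    rw [State.setArr_arr_of_ne _ _ _ _ (by decide), k3]
    simp [hj, b3]
  · intro i
    rw [State.setArr_arr, c5, b5]
    simp


/-- The invariant of the computation of a basis of shortest vectors, when `k` of the rows of the
array `a` have been processed. -/
structure MinimalBasisInv (n : ℕ) (a : ℕ → ℕ → ℝ) (B : ℝ) (k : ℕ) (τ : State) : Prop where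
  dual : IsDual (rows n (τ.arr 3)) (rows n (τ.arr 4))
  weight : ∀ i : Fin n, τ.arr 5 0 i = B ^ 2 + 1 ∨
    ∃ u < k, row n (τ.arr 3) i = row n a u ∧ τ.arr 5 0 i = ‖row n a u‖ ^ 2
  minimal : ∀ u < k, ∀ i : Fin n, inner ℝ (row n a u) (row n (τ.arr 4) i) ≠ (0 : ℝ) →
    τ.arr 5 0 i ≤ ‖row n a u‖ ^ 2
  norm : ∀ u < k, τ.arr 6 0 u = ‖row n a u‖ ^ 2

/-- The exchange step of the greedy algorithm: the input vector replaces the heaviest basis vector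
occurring in it, provided that one is heavier than the input vector. -/
theorem Runs.improve {n u : ℕ} {a : ℕ → ℕ → ℝ} {B : ℝ} {σ : State} (hn : σ.var 0 = n)
    (hu : σ.var 5 = u) (ha : σ.arr 0 = a) (hI : MinimalBasisInv n a B u σ) :
    Runs .improve σ fun t τ => t ≤ 60 + n * (150 + n * 45) ∧ MinimalBasisInv n a B (u + 1) τ := by
  set c : ℕ → ℝ := fun i => ∑ j ∈ Finset.range n, σ.arr 0 u j * σ.arr 4 i j with hc
  have hcin : ∀ i, c i = inner ℝ (row n a u) (row n (σ.arr 4) i) := by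
    intro i
    rw [hc, ← ha]
    exact sum_mul_eq_inner n _ _ _ _
  apply Runs.seq
  refine (Runs.sum (7 + n * 17) (fun j => σ.arr 0 u j * σ.arr 0 u j) (by decide) (by decide)
      (by decide) hn (by simp only [Expr.cost]; omega) ?_).mono ?_
  · intro k hk τ h1 h2 h3
    simp [Expr.eval, h1, h2, h3, hu]
  rintro t1 τ1 ⟨ht1, e1, e2, e3⟩
  rw [sum_mul_eq_inner, ha, real_inner_self_eq_norm_sq] at e1
  have v0 : τ1.var 0 = n := by rw [e2 0 (by decide) (by decide), hn]
  have v5 : τ1.var 5 = u := by rw [e2 5 (by decide) (by decide), hu]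
  apply Runs.seq
  apply Runs.store
  apply Runs.seq
  apply Runs.assign
  simp only [Expr.cost, Expr.eval, e1, v5, Nat.floor_natCast, Int.cast_zero,
    Nat.floor_zero, State.setArr_var]
  set τ2 := (τ1.setArr 6 0 u (‖row n a u‖ ^ 2)).setVar 8 (‖row n a u‖ ^ 2) with hτ2
  have w0 : τ2.var 0 = n := by simp [hτ2, v0]
  have w5 : τ2.var 5 = u := by simp [hτ2, v5]
  have w7 : τ2.var 7 = ‖row n a u‖ ^ 2 := by simp [hτ2, e1]
  have w8 : τ2.var 8 = ‖row n a u‖ ^ 2 := by simp [hτ2]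
  have b : ∀ a', a' ≠ 6 → τ2.arr a' = σ.arr a' := by
    intro a' ha'
    rw [hτ2, State.setVar_arr, State.setArr_arr_of_ne _ _ _ _ ha', e3]
  have b6 : ∀ u', τ2.arr 6 0 u' = if u' = u then ‖row n a u‖ ^ 2 else σ.arr 6 0 u' := by
    intro u'
    rw [hτ2, State.setVar_arr, State.setArr_arr, e3]
    simp
  clear_value τ2
  apply Runs.seq
  refine (Runs.coords w0 w5 w8 (c := c) (by
    intro i; rw [hc, b 0 (by decide), b 4 (by decide)])).frame.mono ?_
  rintro t3 τ3 ⟨⟨ht3, f12, fw, fle, fm⟩, F⟩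
  have x0 : τ3.var 0 = n := by rw [F.var 0 (by decide), w0]
  have x5 : τ3.var 5 = u := by rw [F.var 5 (by decide), w5]
  have x7 : τ3.var 7 = ‖row n a u‖ ^ 2 := by rw [F.var 7 (by decide), w7]
  have a0 : τ3.arr 0 = a := by rw [F.arr 0 (by decide), b 0 (by decide), ha]
  have a3 : τ3.arr 3 = σ.arr 3 := by rw [F.arr 3 (by decide), b 3 (by decide)]
  have a4 : τ3.arr 4 = σ.arr 4 := by rw [F.arr 4 (by decide), b 4 (by decide)]
  have a5 : τ3.arr 5 = σ.arr 5 := by rw [F.arr 5 (by decide), b 5 (by decide)]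
  have a6 : ∀ u' < u + 1, τ3.arr 6 0 u' = ‖row n a u'‖ ^ 2 := by
    intro u' hu'
    rw [F.arr 6 (by decide), b6]
    split_ifs with h
    · rw [h]
    · exact hI.norm u' (by omega)
  rw [b 5 (by decide)] at fle fm
  have hT : n * (150 + n * 45) = n * 150 + n * (n * 20) + n * (n * 25) := by ring
  have hT' : n * (50 + n * 20) = n * 50 + n * (n * 20) := by ring
  have hT'' : n * (80 + n * 25) = n * 80 + n * (n * 25) := by ring
  apply Runs.ite
  · intro hlt
    simp only [Expr.eval, x7] at hlt
    rcases fm with fm | ⟨m, hmn, fm, hcm, fm8⟩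
    · exact absurd fm hlt.ne'
    refine (Runs.exchange x0 x5 fm hmn).frame.mono ?_
    rintro t4 τ4 ⟨⟨ht4, g4, g3, g5⟩, F4⟩
    rw [a4, f12 m hmn] at g4
    rw [a0, a3] at g3
    rw [x7, a5] at g5
    refine ⟨by simp only [Expr.cost]; omega, ?_⟩
    have hd : rows n (τ4.arr 4) = fun i => if i = ⟨m, hmn⟩ then
        (inner ℝ (row n a u) (rows n (σ.arr 4) ⟨m, hmn⟩))⁻¹ • rows n (σ.arr 4) ⟨m, hmn⟩ else
        rows n (σ.arr 4) i - (inner ℝ (row n a u) (rows n (σ.arr 4) i) *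
          (inner ℝ (row n a u) (rows n (σ.arr 4) ⟨m, hmn⟩))⁻¹) • rows n (σ.arr 4) ⟨m, hmn⟩ := by
      funext i
      refine row_eq_iff.2 fun j => ?_
      rw [g4 i j i.2 j.2]
      have : (i : ℕ) = m ↔ i = ⟨m, hmn⟩ := by rw [Fin.ext_iff]
      simp only [this]
      split_ifs with him
      · simp only [rows, ← hcin]
        simp [row, div_eq_inv_mul]
      · simp only [rows, ← hcin, f12 i i.2]
        simp [row, div_eq_mul_inv]
        ring
    have hb : rows n (τ4.arr 3) = Function.update (rows n (σ.arr 3)) ⟨m, hmn⟩ (row n a u) := by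
      funext i
      by_cases him : i = ⟨m, hmn⟩
      · subst him
        rw [Function.update_self]
        exact row_congr fun j hj => by rw [g3 _ j hj]; simp
      · rw [Function.update_of_ne him]
        exact row_congr fun j hj => by
          rw [g3 _ j hj, if_neg]
          exact fun h => him (Fin.ext h)
    have hcm' : inner ℝ (row n a u) (rows n (σ.arr 4) ⟨m, hmn⟩) ≠ (0 : ℝ) := by
      rw [hcin] at hcm
      exact hcm
    have hd' : ∀ (x : E n) (i : Fin n), inner ℝ x (row n (τ4.arr 4) i) =
        if (i : ℕ) = m then (c m)⁻¹ * inner ℝ x (row n (σ.arr 4) m) else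
          inner ℝ x (row n (σ.arr 4) i) - c i * (c m)⁻¹ * inner ℝ x (row n (σ.arr 4) m) := by
      intro x i
      have := congrFun hd i
      change row n (τ4.arr 4) i = _ at this
      rw [this]
      have : (i : ℕ) = m ↔ i = ⟨m, hmn⟩ := by rw [Fin.ext_iff]
      simp only [this, hcin]
      split_ifs
      · rw [inner_smul_right]; rfl
      · rw [inner_sub_right, inner_smul_right]; rfl
    refine ⟨?_, ?_, ?_, ?_⟩
    · rw [hb, hd]
      exact hI.dual.exchange _ _ hcm'
    · intro i
      rw [g5]
      by_cases him : (i : ℕ) = m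
      · right
        refine ⟨u, by omega, ?_, by rw [if_pos him]⟩
        have := congrFun hb i
        rw [show i = ⟨m, hmn⟩ from Fin.ext him, Function.update_self] at this
        rw [him]
        exact this
      · rw [if_neg him]
        rcases hI.weight i with h | ⟨u', hu', h1, h2⟩
        · exact Or.inl h
        · refine Or.inr ⟨u', by omega, ?_, h2⟩
          rw [← h1]
          exact row_congr fun j hj => by rw [g3 _ j hj, if_neg him]
    · intro u' hu' i hne
      rw [g5]
      rw [hd'] at hne
      by_cases huu : u' = u
      · subst huu
        by_cases him : (i : ℕ) = m
        · rw [if_pos him]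
        -- After the exchange the input vector is a basis vector, hence orthogonal to all dual
        -- vectors but the `m`-th.
        · rw [if_neg him, ← hcin, ← hcin] at hne
          exact absurd (by field_simp; ring) hne
      · have hmin := hI.minimal u' (by omega)
        have key : inner ℝ (row n a u') (row n (σ.arr 4) m) ≠ (0 : ℝ) →
            τ3.var 8 ≤ ‖row n a u'‖ ^ 2 := by
          intro h
          rw [fm8]
          exact hmin ⟨m, hmn⟩ h
        by_cases him : (i : ℕ) = m
        · rw [if_pos him] at hne ⊢
          exact hlt.le.trans (key (right_ne_zero_of_mul hne))
        · rw [if_neg him] at hne ⊢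
          -- If `u'` was orthogonal to the old `i`-th dual vector, then `c i ≠ 0` and `u'` is not
          -- orthogonal to the `m`-th. The weight of `i` is at most that of `m`, the heaviest, which
          -- is at most the squared norm of `u'`.
          by_cases h1 : inner ℝ (row n a u') (row n (σ.arr 4) i) = (0 : ℝ)
          · rw [h1, zero_sub, neg_ne_zero] at hne
            refine (fle i i.2 ?_).trans (key (right_ne_zero_of_mul hne))
            exact left_ne_zero_of_mul (left_ne_zero_of_mul hne)
          · exact hmin i h1
    · intro u' hu'
      rw [F4.arr 6 (by decide)]
      exact a6 u' hu'
  · intro hlt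
    simp only [Expr.eval, x7] at hlt
    apply Runs.skip
    refine ⟨by simp only [Expr.cost]; omega, ?_⟩
    refine ⟨by rw [a3, a4]; exact hI.dual, ?_, ?_, a6⟩
    · rw [a3, a5]
      intro i
      rcases hI.weight i with h | ⟨u', hu', h⟩
      · exact Or.inl h
      · exact Or.inr ⟨u', by omega, h⟩
    · intro u' hu' i hne
      rw [a4] at hne
      rw [a5]
      by_cases huu : u' = u
      · subst huu
        rw [← hcin] at hne
        exact (fle i i.2 hne).trans (not_lt.1 hlt)
      · exact hI.minimal u' (by omega) i hne

theorem Runs.minimalBasis {n s : ℕ} {a : ℕ → ℕ → ℝ} {B : ℝ} {σ : State} (hn : σ.var 0 = n)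
    (hs : σ.var 1 = s) (hB : σ.var 2 = B) (ha : σ.arr 0 = a) (h3 : σ.arr 3 = 0) (h4 : σ.arr 4 = 0)
    (hspan : ∀ d : E n, (∀ u < s, inner ℝ (row n a u) d = (0 : ℝ)) → d = 0)
    (haB : ∀ u < s, ‖row n a u‖ ≤ B) :
    Runs .minimalBasis σ fun t τ => t ≤ 10 + n * 50 + s * (67 + n * (150 + n * 45)) ∧
      IsDual (rows n (τ.arr 3)) (rows n (τ.arr 4)) ∧
      (∀ i, ∃ u < s, rows n (τ.arr 3) i = row n a u) ∧
      (∀ u < s, ∀ i, inner ℝ (row n a u) (rows n (τ.arr 4) i) ≠ (0 : ℝ) →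
        ‖rows n (τ.arr 3) i‖ ≤ ‖row n a u‖) ∧
      (∀ u < s, τ.arr 6 0 u = ‖row n a u‖ ^ 2) := by
  apply Runs.seq
  refine (Runs.initBasis hn hB h3 h4).frame.mono ?_
  rintro t1 τ1 ⟨⟨ht1, i3, i4, i5⟩, F1⟩
  refine (Runs.for (60 + n * (150 + n * 45)) (5 + s * (67 + n * (150 + n * 45)))
    (fun k τ => MinimalBasisInv n a B k τ) (by decide) (by decide) (by decide)
    (by rw [F1.var 1 (by decide), hs]) (le_of_eq (by ring)) ?_ ?_).mono ?_
  · refine ⟨?_, fun i => Or.inl (i5 i i.2), by simp, by simp⟩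
    intro i j
    have e3 : rows n (τ1.arr 3) i = EuclideanSpace.single i 1 := by
      refine row_eq_iff.2 fun l => ?_
      rw [i3 i i.2]
      simp [Fin.ext_iff, eq_comm]
    have e4 : rows n (τ1.arr 4) j = EuclideanSpace.single j 1 := by
      refine row_eq_iff.2 fun l => ?_
      rw [i4 j j.2]
      simp [Fin.ext_iff, eq_comm]
    simp only [State.setVar_arr, e3, e4]
    rw [EuclideanSpace.inner_single_left]
    simp
  · intro k hk τ h1 h2 hF hI
    refine (Runs.improve ?_ h1 ?_ hI).mono fun t ρ h => ⟨h.1, ?_⟩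
    · rw [hF.var 0 (by decide), F1.var 0 (by decide), hn]
    · rw [hF.arr 0 (by decide), F1.arr 0 (by decide), ha]
    · exact ⟨h.2.dual, h.2.weight, h.2.minimal, h.2.norm⟩
  · rintro t τ ⟨ht, hI, -, -⟩
    have hw : ∀ i : Fin n, ∃ u < s, row n (τ.arr 3) i = row n a u ∧
        τ.arr 5 0 i = ‖row n a u‖ ^ 2 := by
      intro i
      -- No sentinel survives: the dual vector is nonzero, hence not orthogonal to some input
      -- vector, which bounds the weight by `B ^ 2`.
      refine (hI.weight i).resolve_left fun h => ?_
      have h0 : row n (τ.arr 4) i ≠ 0 := by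
        intro h0
        have := hI.dual i i
        rw [if_pos rfl] at this
        change inner ℝ _ (row n (τ.arr 4) i) = (1 : ℝ) at this
        rw [h0, inner_zero_right] at this
        exact zero_ne_one this
      apply h0
      refine hspan _ fun u hu => ?_
      by_contra hne
      have h2 := hI.minimal u hu i hne
      have h3 := pow_le_pow_left₀ (norm_nonneg _) (haB u hu) 2
      linarith
    refine ⟨by omega, hI.dual, ?_, ?_, hI.norm⟩
    · intro i
      obtain ⟨u, hu, h, -⟩ := hw i
      exact ⟨u, hu, h⟩
    · intro u hu i hne
      obtain ⟨u', hu', h, h'⟩ := hw i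
      have h2 := hI.minimal u hu i hne
      change ‖row n (τ.arr 3) i‖ ≤ _
      rw [h]
      rw [h'] at h2
      exact (sq_le_sq₀ (norm_nonneg _) (norm_nonneg _)).1 h2


/-- The rows of `a` are the short vectors of the integral lattice `L`, the family `b` consists of
short vectors and `d` is dual to `b`. -/
structure Setting (n s : ℕ) (L : Submodule ℤ (E n)) (B : ℝ) (a : ℕ → ℕ → ℝ)
    (b d : Fin n → E n) : Prop where
  pos : 0 < n
  integral : IsIntegral L
  short : ∀ u < s, row n a u ∈ shortVectors L B
  surj : ∀ x ∈ shortVectors L B, ∃ u < s, row n a u = x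
  dual : IsDual b d
  basis : ∀ i, b i ∈ shortVectors L B

/-! ### Codes of vectors -/

/-- The basis in which small integers are used as digits. -/
noncomputable def radix (B : ℝ) : ℤ := ⌊2 * B ^ 2⌋ + 1

/-- The number with digits `y 0, …, y (n - 1)`. -/
noncomputable def code (n : ℕ) (B : ℝ) (y : ℕ → ℝ) : ℝ :=
  ∑ i ∈ Finset.range n, y i * (radix B : ℝ) ^ i

/-- Digits of absolute value at most `B ^ 2` differ by at most `2 * B ^ 2`, which is less than the
radix. So the digitwise difference is an admissible, possibly negative, digit sequence for the
number zero. -/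
theorem code_injective {n : ℕ} {B : ℝ} {y y' : ℕ → ℝ} (hy : ∀ i < n, ∃ z : ℤ, y i = z)
    (hy' : ∀ i < n, ∃ z : ℤ, y' i = z) (hB : ∀ i < n, |y i| ≤ B ^ 2) (hB' : ∀ i < n, |y' i| ≤ B ^ 2)
    (h : code n B y = code n B y') : ∀ i < n, y i = y' i := by
  have hz : ∀ i, ∃ z : ℤ, i < n → y i = z := fun i => by
    by_cases hi : i < n
    · obtain ⟨z, hz⟩ := hy i hi
      exact ⟨z, fun _ => hz⟩
    · exact ⟨0, fun h => absurd h hi⟩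
  have hz' : ∀ i, ∃ z : ℤ, i < n → y' i = z := fun i => by
    by_cases hi : i < n
    · obtain ⟨z, hz⟩ := hy' i hi
      exact ⟨z, fun _ => hz⟩
    · exact ⟨0, fun h => absurd h hi⟩
  choose z hz using hz
  choose z' hz' using hz'
  have key := eq_zero_of_sum_mul_pow (radix B) n (fun i => z i - z' i) ?_ ?_
  · intro i hi
    rw [hz i hi, hz' i hi, sub_eq_zero.1 (key i hi)]
  · intro i hi
    rw [radix, Int.lt_add_one_iff, Int.le_floor]
    push_cast
    rw [← hz i hi, ← hz' i hi]
    calc |y i - y' i| ≤ |y i| + |y' i| := abs_sub _ _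
      _ ≤ 2 * B ^ 2 := by linarith [hB i hi, hB' i hi]
  · have h1 : ((∑ i ∈ Finset.range n, (z i - z' i) * radix B ^ i : ℤ) : ℝ) = 0 := by
      push_cast
      rw [code, code, ← sub_eq_zero, ← Finset.sum_sub_distrib] at h
      rw [← h]
      refine Finset.sum_congr rfl fun i hi => ?_
      rw [Finset.mem_range] at hi
      rw [hz i hi, hz' i hi]
      ring
    exact_mod_cast h1

theorem exists_int_code {n : ℕ} {B : ℝ} {y : ℕ → ℝ} (hy : ∀ i < n, ∃ z : ℤ, y i = z) :
    ∃ z : ℤ, code n B y = z := by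
  have : ∀ m ≤ n, ∃ z : ℤ, ∑ i ∈ Finset.range m, y i * (radix B : ℝ) ^ i = z := by
    intro m
    induction m with
    | zero => exact fun _ => ⟨0, by simp⟩
    | succ m ih =>
      intro hm
      obtain ⟨z, hz⟩ := ih (by omega)
      obtain ⟨w, hw⟩ := hy m (by omega)
      exact ⟨z + w * radix B ^ m, by rw [Finset.sum_range_succ, hz, hw]; push_cast; ring⟩
  exact this n le_rfl

/-- Array indices are natural numbers, so a signed code addresses a cell by the pair of its positive
and negative parts. -/
theorem eq_of_floors_eq {r r' : ℝ} (hr : ∃ z : ℤ, r = z) (hr' : ∃ z : ℤ, r' = z)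
    (h : ⌊r⌋₊ = ⌊r'⌋₊) (h' : ⌊0 - r⌋₊ = ⌊0 - r'⌋₊) : r = r' := by
  obtain ⟨z, rfl⟩ := hr
  obtain ⟨z', rfl⟩ := hr'
  have e1 : ∀ z : ℤ, ⌊(z : ℝ)⌋₊ = z.toNat := fun z => by
    rw [← Int.floor_toNat, Int.floor_intCast]
  have e2 : ∀ z : ℤ, ⌊0 - (z : ℝ)⌋₊ = (-z).toNat := fun z => by
    rw [← e1]; push_cast; rw [zero_sub]
  rw [e1, e1] at h
  rw [e2, e2] at h'
  have : z = z' := by omega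
  rw [this]

/-- The inner products of a vector with the rows of an array. -/
noncomputable def gramCoord (n : ℕ) (A : ℕ → ℕ → ℝ) (x : E n) (i : ℕ) : ℝ :=
  inner ℝ x (row n A i)

/-- The array in which the codes of the short vectors are marked. -/
def IsDictionary (n s : ℕ) (B : ℝ) (a A : ℕ → ℕ → ℝ) (D : ℕ → ℕ → ℝ) : Prop :=
  ∀ p q, D p q = if (p = 0 ∧ q = 0) ∨ ∃ u < s, p = ⌊code n B (gramCoord n A (row n a u))⌋₊ ∧
    q = ⌊0 - code n B (gramCoord n A (row n a u))⌋₊ then 1 else 0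

/-- The code of a part of a short vector is marked if and only if that part belongs to `L`. -/
theorem Setting.dictionary {n s : ℕ} {L : Submodule ℤ (E n)} {B : ℝ} {a A D : ℕ → ℕ → ℝ}
    {d : Fin n → E n} (S : Setting n s L B a (rows n A) d) (hD : IsDictionary n s B a A D)
    {g : ℕ → ℕ} (hg : ∀ i j, inner ℝ (rows n A i) (rows n A j) ≠ (0 : ℝ) → g i = g j)
    {x : E n} (hx : x ∈ shortVectors L B) (c : ℕ) {e : ℝ}
    (he : e = code n B fun i => if g i = c then gramCoord n A x i else 0) :
    D ⌊e⌋₊ ⌊0 - e⌋₊ < 1 ↔ part (rows n A) d (fun i => g i) c x ∉ L := by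
  have hB0 : 0 ≤ B := (norm_nonneg _).trans hx.2.2
  have hbd : ∀ y : E n, ‖y‖ ≤ B → ∀ i < n, |gramCoord n A y i| ≤ B ^ 2 := by
    intro y hy i hi
    calc |inner ℝ y (row n A i)| ≤ ‖y‖ * ‖row n A i‖ := abs_real_inner_le_norm _ _
      _ ≤ B * B := mul_le_mul hy (S.basis ⟨i, hi⟩).2.2 (norm_nonneg _) hB0
      _ = B ^ 2 := by ring
  have hint : ∀ y ∈ L, ∀ i < n, ∃ z : ℤ, gramCoord n A y i = z :=
    fun y hy i hi => S.integral y hy _ (S.basis ⟨i, hi⟩).1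
  set p := part (rows n A) d (fun i => g i) c x with hp
  have hpc : ∀ i < n, gramCoord n A p i = if g i = c then gramCoord n A x i else 0 := by
    intro i hi
    exact S.dual.inner_part (g := fun i : Fin n => g i) hg c x ⟨i, hi⟩
  have he' : e = code n B (gramCoord n A p) := by
    rw [he]
    refine Finset.sum_congr rfl fun i hi => ?_
    rw [hpc i (Finset.mem_range.1 hi)]
  have hpB : ‖p‖ ≤ B := (S.dual.norm_part_le hg c x).trans hx.2.2
  have hpint : ∀ i < n, ∃ z : ℤ, gramCoord n A p i = z := by
    intro i hi
    rw [hpc i hi]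
    split_ifs
    · exact hint x hx.1 i hi
    · exact ⟨0, by simp⟩
  have hzero : ∀ i, gramCoord n A 0 i = 0 := fun i => by simp [gramCoord]
  -- The cell determines the code, the code the inner products with the basis, and these the vector.
  -- This holds for `p` even if it is outside `L`, since its products with the basis are those of
  -- `x` or zero.
  have hinj : ∀ y ∈ L, ‖y‖ ≤ B → ⌊e⌋₊ = ⌊code n B (gramCoord n A y)⌋₊ →
      ⌊0 - e⌋₊ = ⌊0 - code n B (gramCoord n A y)⌋₊ → p = y := by
    intro y hy hyB h1 h2
    rw [he'] at h1 h2
    have h3 := eq_of_floors_eq (exists_int_code hpint) (exists_int_code (hint y hy)) h1 h2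
    have h4 := code_injective hpint (hint y hy) (hbd p hpB) (hbd y hyB) h3
    exact S.dual.ext fun i => h4 i i.2
  have hcz : code n B (gramCoord n A 0) = 0 := by simp [code, hzero]
  rw [hD]
  split_ifs with h
  · simp only [lt_self_iff_false, false_iff, not_not]
    rcases h with ⟨h1, h2⟩ | ⟨u, hu, h1, h2⟩
    · rw [hinj 0 L.zero_mem (by simpa using hB0) (by rw [hcz, h1]; simp) (by rw [hcz, h2]; simp)]
      exact L.zero_mem
    · rw [hinj _ (S.short u hu).1 (S.short u hu).2.2 h1 h2]
      exact (S.short u hu).1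
  · simp only [zero_lt_one, true_iff]
    intro hpL
    apply h
    by_cases hp0 : p = 0
    · left
      rw [he', hp0, hcz]
      simp
    · right
      obtain ⟨u, hu, hup⟩ := S.surj p ⟨hpL, hp0, hpB⟩
      exact ⟨u, hu, by rw [he', hup], by rw [he', hup]⟩

namespace Program

/-- The powers of the radix go to `A₉`. -/
def powers : Program :=
  .seq (.assign 12 (.add (.floor (.mul (.const 2) (.mul (.var 2) (.var 2)))) (.const 1)))
  (.seq (.assign 13 (.const 1))
  (.for 3 0 (.seq (.store 9 (.const 0) (.var 3) (.var 13))
    (.assign 13 (.mul (.var 13) (.var 12))))))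

/-- The inner products of the input vector `x₅` with the basis and the dual basis go to `A₈` and
`A₇`, its code is marked in `A₁₀`. -/
def tableRow : Program :=
  .seq (.assign 11 (.const 0))
  (.seq (.for 3 0
    (.seq (.sum 6 4 0 (.mul (.get 0 (.var 5) (.var 4)) (.get 3 (.var 3) (.var 4))))
    (.seq (.sum 10 4 0 (.mul (.get 0 (.var 5) (.var 4)) (.get 4 (.var 3) (.var 4))))
    (.seq (.store 8 (.var 5) (.var 3) (.var 6))
    (.seq (.store 7 (.var 5) (.var 3) (.var 10))
    (.assign 11 (.add (.var 11) (.mul (.var 6) (.get 9 (.const 0) (.var 3)))))))))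
  ) (.store 10 (.var 11) (.sub (.const 0) (.var 11)) (.const 1)))

/-- The tables of inner products and codes. -/
def tables : Program :=
  .seq powers (.seq (.store 10 (.const 0) (.const 0) (.const 1)) (.for 5 1 tableRow))

end Program

theorem Runs.powers {n : ℕ} {B : ℝ} {σ : State} (hn : σ.var 0 = n) (hB : σ.var 2 = B) :
    Runs .powers σ fun t τ => t ≤ 20 + n * 20 ∧
      ∀ i < n, τ.arr 9 0 i = (radix B : ℝ) ^ i := by
  apply Runs.seq
  apply Runs.assign
  apply Runs.seq
  apply Runs.assign
  have e1 : (Expr.add (.floor (.mul (.const 2) (.mul (.var 2) (.var 2)))) (.const 1)).eval σ =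
      radix B := by
    simp [Expr.eval, hB, radix, pow_two]
  rw [e1]
  refine (Runs.for 8 (5 + n * 15) (fun k τ => τ.var 13 = (radix B : ℝ) ^ k ∧
    ∀ i < k, τ.arr 9 0 i = (radix B : ℝ) ^ i) (by decide) (by decide) (by decide)
    (by simp [hn]) le_rfl (by simp [Expr.eval]) ?_).mono ?_
  · rintro k hk τ h1 h2 hF ⟨i1, i2⟩
    have v12 := hF.var 12 (by decide)
    simp at v12
    apply Runs.seq
    apply Runs.store
    apply Runs.assign
    simp only [Expr.cost, Expr.eval, h1, Nat.floor_natCast, Int.cast_zero,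
      Nat.floor_zero, State.setArr_var, i1, v12]
    refine ⟨by omega, by simp [pow_succ], ?_⟩
    intro i hi
    by_cases hik : i = k
    · simp [State.setArr_arr, hik]
    · simp [State.setArr_arr, hik, i2 i (by omega)]
  · rintro t τ ⟨ht, ⟨-, h⟩, -, -⟩
    exact ⟨by simp only [Expr.cost]; omega, h⟩

theorem Runs.tableRow {n u : ℕ} {B : ℝ} {σ : State} (hn : σ.var 0 = n) (hu : σ.var 5 = u)
    (h9 : ∀ i < n, σ.arr 9 0 i = (radix B : ℝ) ^ i) :
    Runs .tableRow σ fun t τ => t ≤ 20 + n * (60 + n * 40) ∧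
      (∀ v, ∀ i < n, τ.arr 8 v i = if v = u then
        gramCoord n (σ.arr 3) (row n (σ.arr 0) u) i else σ.arr 8 v i) ∧
      (∀ v, ∀ i < n, τ.arr 7 v i = if v = u then
        gramCoord n (σ.arr 4) (row n (σ.arr 0) u) i else σ.arr 7 v i) ∧
      (∀ p q, τ.arr 10 p q =
        if p = ⌊code n B (gramCoord n (σ.arr 3) (row n (σ.arr 0) u))⌋₊ ∧
          q = ⌊0 - code n B (gramCoord n (σ.arr 3) (row n (σ.arr 0) u))⌋₊ then 1
        else σ.arr 10 p q) := by
  set y := gramCoord n (σ.arr 3) (row n (σ.arr 0) u) with hy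
  set c := gramCoord n (σ.arr 4) (row n (σ.arr 0) u) with hc
  apply Runs.seq
  apply Runs.assign
  apply Runs.seq
  refine (Runs.for (N := n) (40 + n * 40) (5 + n * (47 + n * 40)) (fun k τ =>
    τ.var 11 = ∑ i ∈ Finset.range k, y i * (radix B : ℝ) ^ i ∧
    (∀ v, ∀ i < n, τ.arr 8 v i = if v = u ∧ i < k then y i else σ.arr 8 v i) ∧
    (∀ v, ∀ i < n, τ.arr 7 v i = if v = u ∧ i < k then c i else σ.arr 7 v i))
    (by decide) (by decide) (by decide) (by simp [hn]) (le_of_eq (by ring))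
    (by simp [Expr.eval]) ?_).mono ?_
  · rintro k hk τ h1 h2 hF ⟨i11, i8, i7⟩
    have v5 := hF.var 5 (by decide)
    have a0 := hF.arr 0 (by decide)
    have a3 := hF.arr 3 (by decide)
    have a4 := hF.arr 4 (by decide)
    have a9 := hF.arr 9 (by decide)
    simp only [State.setVar_arr] at a0 a3 a4 a9
    simp [hu] at v5
    apply Runs.seq
    refine (Runs.sum (7 + n * 20) (fun j => σ.arr 0 u j * σ.arr 3 k j) (by decide) (by decide)
      (by decide) h2 (by simp only [Expr.cost]; omega) ?_).mono ?_
    · intro j hj ρ e1 e2 e3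
      simp [Expr.eval, e1, e2, e3, v5, h1, a0, a3]
    rintro t1 τ1 ⟨ht1, e6, e2, e3⟩
    rw [sum_mul_eq_inner] at e6
    have e0 := e2 0 (by decide) (by decide)
    have e5 := e2 5 (by decide) (by decide)
    have e33 := e2 3 (by decide) (by decide)
    have e11 := e2 11 (by decide) (by decide)
    rw [h2] at e0
    rw [v5] at e5
    rw [h1] at e33
    apply Runs.seq
    refine (Runs.sum (7 + n * 20) (fun j => σ.arr 0 u j * σ.arr 4 k j) (by decide) (by decide)
      (by decide) e0 (by simp only [Expr.cost]; omega) ?_).mono ?_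
    · intro j hj ρ f1 f2 f3
      simp [Expr.eval, f1, f2, f3, e5, e33, e3, a0, a4]
    rintro t2 τ2 ⟨ht2, f10, f2, f3⟩
    rw [sum_mul_eq_inner] at f10
    have f5 := f2 5 (by decide) (by decide)
    have f6 := f2 6 (by decide) (by decide)
    have f33 := f2 3 (by decide) (by decide)
    have f11 := f2 11 (by decide) (by decide)
    rw [e5] at f5
    rw [e6] at f6
    rw [e33] at f33
    rw [e11, i11] at f11
    rw [e3] at f3
    apply Runs.seq
    apply Runs.store
    apply Runs.seq
    apply Runs.store
    apply Runs.assign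
    simp only [Expr.cost, Expr.eval, Nat.floor_natCast, Int.cast_zero,
      Nat.floor_zero, State.setArr_var, f5, f6, f33, f11, f10]
    refine ⟨by omega, ?_, ?_, ?_⟩
    · rw [Finset.sum_range_succ, State.setArr_arr_of_ne _ _ _ _ (by decide),
        State.setArr_arr_of_ne _ _ _ _ (by decide), f3, a9, h9 k hk]
      simp [hy, gramCoord]
    · intro v i hi
      rw [State.setVar_arr, State.setVar_arr, State.setArr_arr_of_ne _ _ _ _ (by decide),
        State.setArr_arr, f3, i8 v i hi]
      by_cases hvu : v = u
      · by_cases hik : i = k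
        · simp [hvu, hik, hy, gramCoord]
        · have : i < k + 1 ↔ i < k := by omega
          simp [hvu, hik, this]
      · simp [hvu]
    · intro v i hi
      rw [State.setVar_arr, State.setVar_arr,
        State.setArr_arr, State.setArr_arr_of_ne _ _ _ _ (by decide), f3, i7 v i hi]
      by_cases hvu : v = u
      · by_cases hik : i = k
        · simp [hvu, hik, hc, gramCoord]
        · have : i < k + 1 ↔ i < k := by omega
          simp [hvu, hik, this]
      · simp [hvu]
  · rintro t τ ⟨ht, ⟨i11, i8, i7⟩, -, hF⟩
    have a10 := hF.arr 10 (by decide)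
    simp only [State.setVar_arr] at a10
    apply Runs.store
    simp only [Expr.cost, Expr.eval, i11, Int.cast_zero]
    refine ⟨?_, ?_, ?_, ?_⟩
    · have : n * (60 + n * 40) = n * (47 + n * 40) + n * 13 := by ring
      omega
    · intro v i hi
      rw [State.setArr_arr_of_ne _ _ _ _ (by decide), i8 v i hi]
      simp [hi]
    · intro v i hi
      rw [State.setArr_arr_of_ne _ _ _ _ (by decide), i7 v i hi]
      simp [hi]
    · intro p q
      rw [State.setArr_arr, a10]
      simp [code]

theorem Runs.tables {n s : ℕ} {B : ℝ} {σ : State} (hn : σ.var 0 = n) (hs : σ.var 1 = s)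
    (hB : σ.var 2 = B) (h10 : σ.arr 10 = 0) :
    Runs .tables σ fun t τ => t ≤ 40 + n * 20 + s * (30 + n * (60 + n * 40)) ∧
      (∀ i < n, τ.arr 9 0 i = (radix B : ℝ) ^ i) ∧
      (∀ u < s, ∀ i < n, τ.arr 8 u i = gramCoord n (σ.arr 3) (row n (σ.arr 0) u) i) ∧
      (∀ u < s, ∀ i < n, τ.arr 7 u i = gramCoord n (σ.arr 4) (row n (σ.arr 0) u) i) ∧
      IsDictionary n s B (σ.arr 0) (σ.arr 3) (τ.arr 10) := by
  apply Runs.seq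
  refine (Runs.powers hn hB).frame.mono ?_
  rintro t1 τ1 ⟨⟨ht1, h9⟩, F1⟩
  have v0 := F1.var 0 (by decide)
  have v1 := F1.var 1 (by decide)
  have a0 := F1.arr 0 (by decide)
  have a3 := F1.arr 3 (by decide)
  have a4 := F1.arr 4 (by decide)
  have a10 := F1.arr 10 (by decide)
  apply Runs.seq
  -- The zero vector is not among the input vectors, so its cell is marked separately.
  apply Runs.store
  simp only [Expr.cost, Expr.eval, Int.cast_zero, Nat.floor_zero, Int.cast_one]
  refine (Runs.for (N := s) (20 + n * (60 + n * 40)) (5 + s * (27 + n * (60 + n * 40))) (fun k τ =>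
    (∀ u < k, ∀ i < n, τ.arr 8 u i = gramCoord n (σ.arr 3) (row n (σ.arr 0) u) i) ∧
    (∀ u < k, ∀ i < n, τ.arr 7 u i = gramCoord n (σ.arr 4) (row n (σ.arr 0) u) i) ∧
    IsDictionary n k B (σ.arr 0) (σ.arr 3) (τ.arr 10)) (by decide) (by decide) (by decide)
    (by simp [v1, hs]) (le_of_eq (by ring)) ?_ ?_).mono ?_
  · refine ⟨by simp, by simp, ?_⟩
    intro p q
    simp [State.setArr_arr, a10, h10]
  · rintro k hk τ k1 k2 hF ⟨i8, i7, i10⟩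
    have w0 := hF.var 0 (by decide)
    have b0 := hF.arr 0 (by decide)
    have b3 := hF.arr 3 (by decide)
    have b4 := hF.arr 4 (by decide)
    have b9 := hF.arr 9 (by decide)
    rw [State.setArr_arr_of_ne _ _ _ _ (by decide)] at b0 b3 b4 b9
    rw [State.setArr_var] at w0
    refine (Runs.tableRow (B := B) (by rw [w0, v0, hn]) k1 ?_).mono ?_
    · rw [b9]
      exact h9
    rintro t ρ ⟨ht, j8, j7, j10⟩
    rw [b0, b3, a0, a3] at j8 j10
    rw [b0, b4, a0, a4] at j7
    refine ⟨ht, ?_, ?_, ?_⟩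
    · intro u hu i hi
      rw [State.setVar_arr, j8 u i hi]
      split_ifs with h
      · rw [h]
      · exact i8 u (by omega) i hi
    · intro u hu i hi
      rw [State.setVar_arr, j7 u i hi]
      split_ifs with h
      · rw [h]
      · exact i7 u (by omega) i hi
    · intro p q
      rw [State.setVar_arr, j10, i10]
      set P : ℕ → Prop := fun u => p = ⌊code n B (gramCoord n (σ.arr 3) (row n (σ.arr 0) u))⌋₊ ∧
        q = ⌊0 - code n B (gramCoord n (σ.arr 3) (row n (σ.arr 0) u))⌋₊ with hP
      have key : (p = 0 ∧ q = 0 ∨ ∃ u < k + 1, P u) ↔ P k ∨ (p = 0 ∧ q = 0 ∨ ∃ u < k, P u) := by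
        simp only [Nat.lt_succ_iff_lt_or_eq, or_and_right, exists_or, exists_eq_left]
        rw [← or_assoc, or_comm]
      change (if P k then (1 : ℝ) else if p = 0 ∧ q = 0 ∨ ∃ u < k, P u then 1 else 0) =
        if p = 0 ∧ q = 0 ∨ ∃ u < k + 1, P u then 1 else 0
      simp only [key]
      by_cases h : P k <;> simp [h]
  · rintro t τ ⟨ht, ⟨i8, i7, i10⟩, -, hF⟩
    have b9 := hF.arr 9 (by decide)
    rw [State.setArr_arr_of_ne _ _ _ _ (by decide)] at b9
    refine ⟨?_, ?_, i8, i7, i10⟩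
    · have : s * (30 + n * (60 + n * 40)) = s * (27 + n * (60 + n * 40)) + s * 3 := by ring
      omega
    · rw [b9]
      exact h9


/-! ### Grouping the basis vectors -/

/-- The first `n` entries of the row `0` of `A` are labels `< n` which do not split `L`. -/
structure IsGrouping (n : ℕ) (L : Submodule ℤ (E n)) (b : Fin n → E n) (A : ℕ → ℕ → ℝ)
    (g : ℕ → ℕ) : Prop where
  label : ∀ i < n, A 0 i = g i
  lt : ∀ i < n, g i < n
  unsplit : Unsplit L b fun i => g i

namespace Program

/-- The label of `x₂₂` is replaced by the label of `x₃`. -/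
def mergeLabels : Program :=
  .seq (.assign 18 (.get 11 (.const 0) (.var 3)))
  (.seq (.assign 19 (.get 11 (.const 0) (.var 22)))
  (.for 20 0 (.ite (.const 0)
    (.mul (.sub (.get 11 (.const 0) (.var 20)) (.var 19))
      (.sub (.get 11 (.const 0) (.var 20)) (.var 19)))
    .skip (.store 11 (.const 0) (.var 20) (.var 18)))))

/-- The basis vectors are grouped by the relation of not being orthogonal. -/
def gramGroups : Program :=
  .seq (.fill 11 (.const 0) 3 0 (.var 3))
  (.for 3 0 (.for 22 0
    (.seq (.sum 6 4 0 (.mul (.get 3 (.var 3) (.var 4)) (.get 3 (.var 22) (.var 4))))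
    (.ite (.const 0) (.mul (.var 6) (.var 6)) mergeLabels .skip))))

end Program

/-- Both labels are saved before the loop, because the loop overwrites the entry of `q` as well. -/
theorem Runs.mergeLabels {n p q : ℕ} {g : ℕ → ℕ} {σ : State} (hn : σ.var 0 = n)
    (hp : σ.var 3 = p) (hq : σ.var 22 = q) (hpn : p < n) (hqn : q < n)
    (hg : ∀ i < n, σ.arr 11 0 i = g i) :
    Runs .mergeLabels σ fun t τ => t ≤ 30 + n * 30 ∧
      ∀ i < n, τ.arr 11 0 i = ((if g i = g q then g p else g i : ℕ) : ℝ) := by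
  apply Runs.seq
  apply Runs.assign
  apply Runs.seq
  apply Runs.assign
  simp only [Expr.cost, Expr.eval, Int.cast_zero, Nat.floor_zero, hp, hq, Nat.floor_natCast,
    hg p hpn, hg q hqn, State.setVar_arr, State.setVar_var, show (22 : ℕ) ≠ 18 by decide, if_false]
  refine (Runs.for (N := n) 20 (5 + n * 27) (fun k τ => ∀ i < n, τ.arr 11 0 i =
    ((if g i = g q ∧ i < k then g p else g i : ℕ) : ℝ)) (by decide) (by decide) (by decide)
    (by simp [hn]) le_rfl (by simpa using hg) ?_).mono ?_
  · intro k hk τ h1 h2 hF hI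
    have v18 := hF.var 18 (by decide)
    have v19 := hF.var 19 (by decide)
    simp at v18 v19
    have hk' := hI k hk
    simp only [lt_irrefl, and_false, if_false] at hk'
    apply Runs.ite
    · intro hlt
      simp only [Expr.eval, Int.cast_zero, Nat.floor_zero, h1, Nat.floor_natCast, hk', v19] at hlt
      have hne : g k ≠ g q := by
        intro h
        rw [h] at hlt
        simp at hlt
      apply Runs.skip
      refine ⟨by simp only [Expr.cost]; omega, ?_⟩
      intro i hi
      rw [State.setVar_arr, hI i hi]
      by_cases hik : i = k
      · subst hik
        simp [hne]
      · have : i < k + 1 ↔ i < k := by omega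
        simp [this]
    · intro hlt
      simp only [Expr.eval, Int.cast_zero, Nat.floor_zero, h1, Nat.floor_natCast, hk', v19] at hlt
      have he : g k = g q := by
        by_contra hne
        apply hlt
        have : (g k : ℝ) - g q ≠ 0 := sub_ne_zero.2 (by exact_mod_cast hne)
        simpa using this
      apply Runs.store
      simp only [Expr.cost, Expr.eval, Int.cast_zero, Nat.floor_zero, h1, Nat.floor_natCast, v18]
      refine ⟨by omega, ?_⟩
      intro i hi
      rw [State.setVar_arr, State.setArr_arr, hI i hi]
      by_cases hik : i = k
      · subst hik
        simp [he]
      · have : i < k + 1 ↔ i < k := by omega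
        simp [hik, this]
  · rintro t τ ⟨ht, hI, -, -⟩
    refine ⟨by omega, ?_⟩
    intro i hi
    rw [hI i hi]
    simp [hi]

/-- Every vector of the basis belongs to one side of every splitting. -/
theorem Setting.unsplit_singletons {n s : ℕ} {L : Submodule ℤ (E n)} {B : ℝ} {a : ℕ → ℕ → ℝ}
    {b d : Fin n → E n} (S : Setting n s L B a b d)
    (hmin : ∀ u < s, ∀ i, inner ℝ (row n a u) (d i) ≠ (0 : ℝ) → ‖b i‖ ≤ ‖row n a u‖) :
    Unsplit L b fun i => i := by
  intro M N hL hMN i j hij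
  have : i = j := Fin.ext hij
  subst this
  simp only [and_self]
  refine mem_or_mem_of_minimal hL hMN (d := d i) (S.basis i) ?_ ?_
  · rw [S.dual i i, if_pos rfl]
    exact one_ne_zero
  · intro y hy hne
    obtain ⟨u, hu, rfl⟩ := S.surj y hy
    exact hmin u hu i hne

/-- The new label of an index depends on its old label only, so labels that agree once agree
forever, and the pairs already treated need no second visit. There are `n ^ 2` pairs of cost `O(n)`
each. -/
theorem Runs.gramGroups {n : ℕ} {L : Submodule ℤ (E n)} {σ : State} (hn : σ.var 0 = n)
    (hpos : 0 < n) (hu : Unsplit L (rows n (σ.arr 3)) fun i => i) :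
    Runs .gramGroups σ fun t τ => t ≤ n ^ 3 * 300 ∧ ∃ g,
      IsGrouping n L (rows n (σ.arr 3)) (τ.arr 11) g ∧
      ∀ i j, i < n → j < n → inner ℝ (row n (σ.arr 3) i) (row n (σ.arr 3) j) ≠ (0 : ℝ) →
        g i = g j := by
  set A := σ.arr 3 with hA
  apply Runs.seq
  refine (Runs.fill (5 + n * 11) (fun j => (j : ℝ)) 0 (by decide) hn
    (by simp only [Expr.cost]; omega) ?_).mono ?_
  · intro k hk τ h1 h2 h3 h4
    simp [Expr.eval, h1]
  rintro t1 τ1 ⟨ht1, f11, fv, fa⟩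
  have v0 : τ1.var 0 = n := by rw [fv 0 (by decide), hn]
  have a3 : τ1.arr 3 = A := by rw [fa 3 (by decide)]
  refine (Runs.for (N := n) (5 + n * (60 + n * 50)) (5 + n * (12 + n * (60 + n * 50))) (fun k τ =>
    ∃ g, IsGrouping n L (rows n A) (τ.arr 11) g ∧ ∀ i j, i < k → j < n →
      inner ℝ (row n A i) (row n A j) ≠ (0 : ℝ) → g i = g j) (by decide) (by decide) (by decide)
    v0 (le_of_eq (by ring)) ?_ ?_).mono ?_
  · refine ⟨fun i => i, ⟨?_, fun i hi => hi, hu⟩, by simp⟩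
    intro i hi
    rw [State.setVar_arr, f11]
    simp [hi]
  · rintro p hp τ h1 h2 hF ⟨g, hG, hI⟩
    have b3 : τ.arr 3 = A := by rw [hF.arr 3 (by decide), a3]
    refine (Runs.for (N := n) (53 + n * 50) (5 + n * (60 + n * 50)) (fun k τ =>
      ∃ g, IsGrouping n L (rows n A) (τ.arr 11) g ∧
      (∀ i j, i < p → j < n → inner ℝ (row n A i) (row n A j) ≠ (0 : ℝ) → g i = g j) ∧
      ∀ j < k, inner ℝ (row n A p) (row n A j) ≠ (0 : ℝ) → g p = g j) (by decide) (by decide)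
      (by decide) h2 (le_of_eq (by ring)) ⟨g, hG, hI, by simp⟩ ?_).mono ?_
    · rintro q hq ρ k1 k2 kF ⟨g, hG, hI, hJ⟩
      have c3 : ρ.arr 3 = A := by rw [kF.arr 3 (by decide), b3]
      have w3 : ρ.var 3 = p := by rw [kF.var 3 (by decide), h1]
      apply Runs.seq
      refine (Runs.sum (7 + n * 20) (fun j => A p j * A q j) (by decide) (by decide)
        (by decide) k2 (by simp only [Expr.cost]; omega) ?_).mono ?_
      · intro j hj ρ' e1 e2 e3
        simp [Expr.eval, e1, e2, e3, k1, w3, c3]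
      rintro t2 ρ2 ⟨ht2, e6, e2, e3⟩
      rw [sum_mul_eq_inner] at e6
      have x0 := e2 0 (by decide) (by decide)
      have x3 := e2 3 (by decide) (by decide)
      have x22 := e2 22 (by decide) (by decide)
      rw [k2] at x0
      rw [w3] at x3
      rw [k1] at x22
      apply Runs.ite
      · intro hlt
        have hne : inner ℝ (row n A p) (row n A q) ≠ (0 : ℝ) := by
          intro h
          simp [Expr.eval, e6, h] at hlt
        refine (Runs.mergeLabels x0 x3 x22 hp hq (g := g) (by rw [e3]; exact hG.label)).mono ?_
        rintro t3 ρ3 ⟨ht3, hl⟩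
        refine ⟨by simp only [Expr.cost]; omega, fun i => if g i = g q then g p else g i,
          ⟨hl, ?_, ?_⟩, ?_, ?_⟩
        · intro i hi
          split_ifs
          · exact hG.lt p hp
          · exact hG.lt i hi
        · refine hG.unsplit.merge (p := ⟨p, hp⟩) (q := ⟨q, hq⟩) hne ?_
          intro i j hij
          dsimp only at hij ⊢
          split_ifs at hij <;> omega
        · intro i j hi hj h
          dsimp only
          rw [hI i j hi hj h]
        · intro j hj h
          dsimp only
          by_cases hjq : j = q
          · rw [hjq]
            simp
          · rw [hJ j (by omega) h]
      · intro hlt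
        have hz : inner ℝ (row n A p) (row n A q) = (0 : ℝ) := by
          by_contra h
          apply hlt
          simp only [Expr.eval, e6, Int.cast_zero]
          exact mul_self_pos.2 h
        apply Runs.skip
        refine ⟨by simp only [Expr.cost]; omega, g, ⟨?_, hG.lt, hG.unsplit⟩, hI, ?_⟩
        · rw [State.setVar_arr, e3]
          exact hG.label
        · intro j hj h
          by_cases hjq : j = q
          · rw [hjq] at h
            exact absurd hz h
          · exact hJ j (by omega) h
    · rintro t ρ ⟨ht, ⟨g, hG, hI, hJ⟩, -, -⟩
      refine ⟨ht, g, ⟨hG.label, hG.lt, hG.unsplit⟩, ?_⟩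
      intro i j hi hj h
      by_cases hip : i = p
      · rw [hip] at h ⊢
        exact hJ j hj h
      · exact hI i j (by omega) hj h
  · rintro t τ ⟨ht, h, -, -⟩
    refine ⟨?_, h⟩
    have h2 : n ≤ n ^ 3 := Nat.le_self_pow (by decide) n
    have h3 : n ^ 2 ≤ n ^ 3 := Nat.pow_le_pow_right hpos (by decide)
    have h4 : n * (12 + n * (60 + n * 50)) = 12 * n + 60 * n ^ 2 + 50 * n ^ 3 := by ring
    omega


/-! ### Coarsening the grouping until all parts of short vectors are in the lattice -/

namespace Program

/-- The codes of the parts of the input vector with the index `x` go to `A₁₂`. -/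
def groupCodes (x : ℕ) : Program :=
  .seq (.fill 12 (.const 0) 4 0 (.const 0))
  (.for 3 0 (.store 12 (.const 0) (.get 11 (.const 0) (.var 3))
    (.add (.get 12 (.const 0) (.get 11 (.const 0) (.var 3)))
      (.mul (.get 8 (.var x) (.var 3)) (.get 9 (.const 0) (.var 3))))))

/-- The mark of the part whose label is that of the basis vector `x₃`. -/
def lookup : Expr :=
  .get 10 (.get 12 (.const 0) (.get 11 (.const 0) (.var 3)))
    (.sub (.const 0) (.get 12 (.const 0) (.get 11 (.const 0) (.var 3))))

/-- The search for a shortest vector with a part outside of the lattice: the vector `x₅` is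
compared to the best one `x₁₅` so far. -/
def scan : Program :=
  .seq (groupCodes 5)
  (.seq (.assign 14 (.const 0))
  (.seq (.for 3 0 (.ite lookup (.const 1) (.assign 14 (.const 1)) .skip))
  (.ite (.const 0) (.var 14)
    (.ite (.get 6 (.const 0) (.var 5)) (.var 16)
      (.seq (.assign 16 (.get 6 (.const 0) (.var 5))) (.assign 15 (.var 5))) .skip) .skip)))

/-- The labels of the parts of the vector `x₁₅` outside of the lattice are identified. -/
def identify : Program :=
  .seq (groupCodes 15)
  (.seq (.assign 18 (.const 0))
  (.seq (.for 3 0 (.ite lookup (.const 1) (.assign 18 (.get 11 (.const 0) (.var 3))) .skip))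
  (.for 3 0 (.ite lookup (.const 1) (.store 11 (.const 0) (.var 3) (.var 18)) .skip))))

/-- A pass over all input vectors. -/
def pass : Program :=
  .seq (.assign 16 (.add (.mul (.var 2) (.var 2)) (.const 1)))
  (.seq (.assign 15 (.const 0))
  (.seq (.for 5 1 scan) identify))

/-- The grouping is coarsened until all parts of all input vectors are in the lattice. -/
def coarsen : Program := .for 17 0 pass

end Program

/-- Each digit is added to the entry of its label, so one sweep over the coordinates yields the
codes of all parts. This keeps the cost per input vector linear in `n`. -/
theorem Runs.groupCodes {n u x : ℕ} {B : ℝ} {g : ℕ → ℕ} {y : ℕ → ℝ} {σ : State}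
    (hn : σ.var 0 = n) (hx : σ.var x = u) (hx3 : x ≠ 3) (hx4 : x ≠ 4)
    (hg : ∀ i < n, σ.arr 11 0 i = g i)
    (h8 : ∀ i < n, σ.arr 8 u i = y i) (h9 : ∀ i < n, σ.arr 9 0 i = (radix B : ℝ) ^ i) :
    Runs (.groupCodes x) σ fun t τ => t ≤ 10 + n * 40 ∧
      ∀ c < n, τ.arr 12 0 c = code n B fun i => if g i = c then y i else 0 := by
  apply Runs.seq
  refine (Runs.fill (5 + n * 11) (fun _ => 0) 0 (by decide) hn
    (by simp only [Expr.cost]; omega) ?_).mono ?_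
  · intro k hk τ h1 h2 h3 h4
    simp [Expr.eval]
  rintro t1 τ1 ⟨ht1, f12, fv, fa⟩
  have v0 : τ1.var 0 = n := by rw [fv 0 (by decide), hn]
  refine (Runs.for (N := n) 20 (5 + n * 27) (fun k τ => ∀ c < n, τ.arr 12 0 c =
    ∑ i ∈ Finset.range k, (if g i = c then y i else 0) * (radix B : ℝ) ^ i)
    (by decide) (by simp [Program.vars]) (by simp [Program.vars]) v0 le_rfl ?_ ?_).mono ?_
  · intro c hc
    rw [State.setVar_arr, f12]
    simp [hc]
  · intro k hk τ h1 h2 hF hI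
    have e8 := hF.arr 8 (by simp [Program.for, Program.arrs])
    have e9 := hF.arr 9 (by simp [Program.for, Program.arrs])
    have e11 := hF.arr 11 (by simp [Program.for, Program.arrs])
    have ex := hF.var x (by simp [Program.for, Program.vars, hx3])
    rw [fa _ (by decide)] at e8 e9 e11
    rw [fv _ hx4, hx] at ex
    apply Runs.store
    simp only [Expr.cost, Expr.eval, Int.cast_zero, Nat.floor_zero, h1, ex, Nat.floor_natCast,
      e8, e9, e11, hg k hk, h8 k hk, h9 k hk]
    refine ⟨by omega, ?_⟩
    intro c hc
    rw [State.setVar_arr, State.setArr_arr, Finset.sum_range_succ, ← hI c hc]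
    by_cases hck : c = g k
    · simp [hck]
    · simp [hck, Ne.symm hck]
  · rintro t τ ⟨ht, h, -, -⟩
    exact ⟨by omega, h⟩

/-- The tables needed for the grouping. -/
structure Tables (n s : ℕ) (B : ℝ) (a A : ℕ → ℕ → ℝ) (τ : State) : Prop where
  dim : τ.var 0 = n
  card : τ.var 1 = s
  bound : τ.var 2 = B
  norm : ∀ u < s, τ.arr 6 0 u = ‖row n a u‖ ^ 2
  gram : ∀ u < s, ∀ i < n, τ.arr 8 u i = gramCoord n A (row n a u) i
  power : ∀ i < n, τ.arr 9 0 i = (radix B : ℝ) ^ i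
  dict : IsDictionary n s B a A (τ.arr 10)

theorem Tables.congr {n s : ℕ} {B : ℝ} {a A : ℕ → ℕ → ℝ} {σ τ : State} (h : Tables n s B a A σ)
    {c : Program} (hF : Frame c σ τ) (h0 : 0 ∉ c.vars) (h1 : 1 ∉ c.vars) (h2 : 2 ∉ c.vars)
    (h6 : 6 ∉ c.arrs) (h8 : 8 ∉ c.arrs) (h9 : 9 ∉ c.arrs) (h10 : 10 ∉ c.arrs) :
    Tables n s B a A τ := by
  refine ⟨?_, ?_, ?_, ?_, ?_, ?_, ?_⟩
  · rw [hF.var 0 h0, h.dim]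
  · rw [hF.var 1 h1, h.card]
  · rw [hF.var 2 h2, h.bound]
  · rw [hF.arr 6 h6]; exact h.norm
  · rw [hF.arr 8 h8]; exact h.gram
  · rw [hF.arr 9 h9]; exact h.power
  · rw [hF.arr 10 h10]; exact h.dict

/-- The vector `u` has a part outside of the lattice, whose label is that of `i`. -/
def BadPart {n : ℕ} (L : Submodule ℤ (E n)) (a A : ℕ → ℕ → ℝ) (d : Fin n → E n) (g : ℕ → ℕ)
    (u i : ℕ) : Prop :=
  part (rows n A) d (fun i => g i) (g i) (row n a u) ∉ L

/-- A grouping for which vectors in different groups are orthogonal. -/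
structure Grouped (n : ℕ) (L : Submodule ℤ (E n)) (A : ℕ → ℕ → ℝ) (τ : State) (g : ℕ → ℕ) :
    Prop extends IsGrouping n L (rows n A) (τ.arr 11) g where
  orth : ∀ i j : Fin n, inner ℝ (rows n A i) (rows n A j) ≠ (0 : ℝ) → g i = g j

section
variable {n s : ℕ} {L : Submodule ℤ (E n)} {B : ℝ} {a A : ℕ → ℕ → ℝ} {d : Fin n → E n}
  {g : ℕ → ℕ}

theorem lookup_lt {σ : State} {u k : ℕ} (S : Setting n s L B a (rows n A) d)
    (hD : IsDictionary n s B a A (σ.arr 10))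
    (hg : ∀ i j : Fin n, inner ℝ (rows n A i) (rows n A j) ≠ (0 : ℝ) → g i = g j) (hu : u < s)
    (h12 : σ.arr 12 0 (g k) =
      code n B fun i => if g i = g k then gramCoord n A (row n a u) i else 0)
    (h3 : σ.var 3 = k) (h11 : σ.arr 11 0 k = g k) :
    Program.lookup.eval σ < (Expr.const 1).eval σ ↔ BadPart L a A d g u k := by
  simp only [Program.lookup, Expr.eval, Int.cast_zero, Nat.floor_zero, h3, Nat.floor_natCast, h11,
    Int.cast_one]
  exact S.dictionary hD (g := g) (fun i j => hg i j) (S.short u hu) (g k) h12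

theorem Runs.scan {σ : State} {u : ℕ} (S : Setting n s L B a (rows n A) d)
    (T : Tables n s B a A σ) (G : Grouped n L A σ g) (hu : u < s) (h5 : σ.var 5 = u) :
    Runs .scan σ fun t τ => t ≤ 50 + n * 80 ∧
      (((∃ i < n, BadPart L a A d g u i) ∧ ‖row n a u‖ ^ 2 < σ.var 16 ∧ τ.var 15 = u ∧
        τ.var 16 = ‖row n a u‖ ^ 2) ∨
      (((∃ i < n, BadPart L a A d g u i) → σ.var 16 ≤ ‖row n a u‖ ^ 2) ∧
        τ.var 15 = σ.var 15 ∧ τ.var 16 = σ.var 16)) := by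
  apply Runs.seq
  refine (Runs.groupCodes (B := B) T.dim h5 (by decide) (by decide) G.label (T.gram u hu)
    T.power).frame.mono ?_
  rintro t1 τ1 ⟨⟨ht1, h12⟩, F1⟩
  have T1 := T.congr F1 (by decide) (by decide) (by decide) (by decide) (by decide) (by decide)
    (by decide)
  have e11 := F1.arr 11 (by decide)
  have v5 := F1.var 5 (by decide)
  have v15 := F1.var 15 (by decide)
  have v16 := F1.var 16 (by decide)
  rw [h5] at v5
  apply Runs.seq
  apply Runs.assign
  apply Runs.seq
  refine (Runs.for (N := n) 25 (5 + n * 32) (fun k τ => 0 < τ.var 14 ↔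
    ∃ i < k, BadPart L a A d g u i) (by decide) (by decide) (by decide)
    (by simpa using T1.dim) le_rfl (by simp [Expr.eval]) ?_).mono ?_
  · intro k hk τ h1 h2 hF hI
    have hlook := lookup_lt (k := k) (σ := τ) (g := g) (u := u) S ?_ G.orth hu ?_ h1 ?_
    · have key : (∃ i < k + 1, BadPart L a A d g u i) ↔
          (∃ i < k, BadPart L a A d g u i) ∨ BadPart L a A d g u k := by
        simp only [Nat.lt_succ_iff_lt_or_eq, or_and_right, exists_or, exists_eq_left]
      apply Runs.ite
      · intro hlt
        apply Runs.assign
        refine ⟨by simp only [Program.lookup, Expr.cost]; omega, ?_⟩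
        rw [key]
        simp [Expr.eval, hlook.1 hlt]
      · intro hlt
        apply Runs.skip
        refine ⟨by simp only [Program.lookup, Expr.cost]; omega, ?_⟩
        rw [key, ← hI]
        have hk : ¬ BadPart L a A d g u k := fun h => hlt (hlook.2 h)
        simp [hk]
    · rw [hF.arr 10 (by decide)]; exact T1.dict
    · rw [hF.arr 12 (by decide)]
      exact h12 _ (G.lt k hk)
    · rw [hF.arr 11 (by decide), State.setVar_arr, e11]
      exact G.label k hk
  · rintro t2 τ2 ⟨ht2, hbad, -, F2⟩
    have w5 : τ2.var 5 = u := by rw [F2.var 5 (by decide)]; simpa using v5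
    have w15 : τ2.var 15 = σ.var 15 := by rw [F2.var 15 (by decide)]; simpa using v15
    have w16 : τ2.var 16 = σ.var 16 := by rw [F2.var 16 (by decide)]; simpa using v16
    have e6 : τ2.arr 6 0 u = ‖row n a u‖ ^ 2 := by
      rw [F2.arr 6 (by decide)]; exact T1.norm u hu
    apply Runs.ite
    · intro hlt
      simp only [Expr.eval, Int.cast_zero, hbad] at hlt
      apply Runs.ite
      · intro hlt'
        simp only [Expr.eval, Int.cast_zero, Nat.floor_zero, w5, Nat.floor_natCast, e6, w16] at hlt'
        apply Runs.seq
        apply Runs.assign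
        apply Runs.assign
        refine ⟨by simp only [Expr.cost]; omega, Or.inl ⟨hlt, hlt', ?_, ?_⟩⟩
        · simp [Expr.eval, w5]
        · simp [Expr.eval, w5, e6]
      · intro hlt'
        simp only [Expr.eval, Int.cast_zero, Nat.floor_zero, w5, Nat.floor_natCast, e6, w16] at hlt'
        apply Runs.skip
        exact ⟨by simp only [Expr.cost]; omega, Or.inr ⟨fun _ => not_lt.1 hlt', w15, w16⟩⟩
    · intro hlt
      simp only [Expr.eval, Int.cast_zero, hbad] at hlt
      apply Runs.skip
      exact ⟨by simp only [Expr.cost]; omega, Or.inr ⟨fun h => absurd h hlt, w15, w16⟩⟩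

/-- The first sweep selects the label of some bad part, the second gives it to all indices of bad
parts. The second sweep does not touch the codes and reads the label of an index before overwriting
it, so the lookups still refer to the old grouping. Without bad parts nothing changes, whatever `l`
is. -/
theorem Runs.identify {σ : State} {u : ℕ} (S : Setting n s L B a (rows n A) d)
    (T : Tables n s B a A σ) (G : Grouped n L A σ g) (hu : u < s) (h15 : σ.var 15 = u) :
    Runs .identify σ fun t τ => t ≤ 50 + n * 120 ∧ ∃ l,
      ((∃ i < n, BadPart L a A d g u i) → ∃ i < n, BadPart L a A d g u i ∧ l = g i) ∧
      ∀ i < n, (BadPart L a A d g u i → τ.arr 11 0 i = (l : ℕ)) ∧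
        (¬ BadPart L a A d g u i → τ.arr 11 0 i = g i) := by
  apply Runs.seq
  refine (Runs.groupCodes (B := B) T.dim h15 (by decide) (by decide) G.label (T.gram u hu)
    T.power).frame.mono ?_
  rintro t1 τ1 ⟨⟨ht1, h12⟩, F1⟩
  have T1 := T.congr F1 (by decide) (by decide) (by decide) (by decide) (by decide) (by decide)
    (by decide)
  have e11 := F1.arr 11 (by decide)
  apply Runs.seq
  apply Runs.assign
  apply Runs.seq
  refine (Runs.for (N := n) 28 (5 + n * 35) (fun k τ => ∃ l : ℕ, τ.var 18 = l ∧
    ((∃ i < k, BadPart L a A d g u i) → ∃ i < n, BadPart L a A d g u i ∧ l = g i)) (by decide)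
    (by decide) (by decide) (by simpa using T1.dim) le_rfl ⟨0, by simp [Expr.eval]⟩ ?_).mono ?_
  · rintro k hk τ h1 h2 hF ⟨l, hl, hI⟩
    have hlab : ∀ i < n, τ.arr 11 0 i = g i := by
      rw [hF.arr 11 (by decide), State.setVar_arr, e11]
      exact G.label
    have hlook := lookup_lt (k := k) (σ := τ) (g := g) (u := u) S ?_ G.orth hu ?_ h1 (hlab k hk)
    · apply Runs.ite
      · intro hlt
        apply Runs.assign
        refine ⟨by simp only [Program.lookup, Expr.cost]; omega, g k, ?_,
          fun _ => ⟨k, hk, hlook.1 hlt, rfl⟩⟩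
        simp [Expr.eval, h1, hlab k hk]
      · intro hlt
        apply Runs.skip
        refine ⟨by simp only [Program.lookup, Expr.cost]; omega, l, by simpa using hl, ?_⟩
        rintro ⟨i, hi, hb⟩
        by_cases hik : i = k
        · exact absurd (hlook.2 (hik ▸ hb)) hlt
        · exact hI ⟨i, by omega, hb⟩
    · rw [hF.arr 10 (by decide)]; exact T1.dict
    · rw [hF.arr 12 (by decide)]
      exact h12 _ (G.lt k hk)
  · rintro t2 τ2 ⟨ht2, ⟨l, h18, hl⟩, -, F2⟩
    refine (Runs.for (N := n) 28 (5 + n * 35) (fun k τ => ∀ i < n,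
      (BadPart L a A d g u i ∧ i < k → τ.arr 11 0 i = (l : ℕ)) ∧
      (¬ (BadPart L a A d g u i ∧ i < k) → τ.arr 11 0 i = g i)) (by decide)
      (by decide) (by decide) (by rw [F2.var 0 (by decide)]; simpa using T1.dim) le_rfl ?_ ?_).mono
      ?_
    · intro i hi
      refine ⟨by simp, fun _ => ?_⟩
      rw [State.setVar_arr, F2.arr 11 (by decide), State.setVar_arr, e11]
      exact G.label i hi
    · intro k hk τ h1 h2 hF hI
      have w18 : τ.var 18 = l := by rw [hF.var 18 (by decide), h18]
      have hlook := lookup_lt (k := k) (σ := τ) (g := g) (u := u) S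
        (by rw [hF.arr 10 (by decide), F2.arr 10 (by decide)]; exact T1.dict) G.orth hu
        (by rw [hF.arr 12 (by decide), F2.arr 12 (by decide)]; exact h12 _ (G.lt k hk)) h1
        ((hI k hk).2 (by simp))
      apply Runs.ite
      · intro hlt
        apply Runs.store
        simp only [Expr.cost, Program.lookup, Expr.eval, Int.cast_zero, Nat.floor_zero, h1,
          Nat.floor_natCast, w18]
        refine ⟨by omega, ?_⟩
        intro i hi
        rw [State.setVar_arr, State.setArr_arr]
        by_cases hik : i = k
        · subst hik
          simp [hlook.1 hlt]
        · have : i < k + 1 ↔ i < k := by omega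
          simpa [hik, this] using hI i hi
      · intro hlt
        apply Runs.skip
        refine ⟨by simp only [Program.lookup, Expr.cost]; omega, ?_⟩
        intro i hi
        rw [State.setVar_arr]
        by_cases hik : i = k
        · subst hik
          have hb : ¬ BadPart L a A d g u i := fun h => hlt (hlook.2 h)
          simpa [hb] using (hI i hi).2 (by simp)
        · have : i < k + 1 ↔ i < k := by omega
          simpa [hik, this] using hI i hi
    · rintro t3 τ3 ⟨ht3, hI, -, -⟩
      refine ⟨by simp only [Expr.cost]; omega, l, hl, ?_⟩
      intro i hi
      simpa [hi] using hI i hi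

end


section
variable {n s : ℕ} {L : Submodule ℤ (E n)} {B : ℝ} {a A : ℕ → ℕ → ℝ} {d : Fin n → E n}
  {g : ℕ → ℕ}

theorem BadPart.congr {u i j : ℕ} (h : BadPart L a A d g u i) (hij : g i = g j) :
    BadPart L a A d g u j := by
  rw [BadPart] at h ⊢
  rwa [← hij]

/-- All parts of all short vectors belong to the lattice. -/
def PartsInLattice (n s : ℕ) (L : Submodule ℤ (E n)) (a A : ℕ → ℕ → ℝ) (d : Fin n → E n)
    (g : ℕ → ℕ) : Prop :=
  ∀ u < s, ∀ i < n, ¬ BadPart L a A d g u i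

-- The number of labels drops because a second bad label, different from `l`, exists and disappears.
open Classical in
theorem Grouped.identify {σ τ : State} {u l : ℕ} (S : Setting n s L B a (rows n A) d)
    (G : Grouped n L A σ g) (hu : u < s)
    (hmin : ∀ v < s, (∃ i < n, BadPart L a A d g v i) → ‖row n a u‖ ^ 2 ≤ ‖row n a v‖ ^ 2)
    {i₀ : ℕ} (hi₀ : i₀ < n) (hb : BadPart L a A d g u i₀) (hl : l = g i₀)
    (hτ : ∀ i < n, (BadPart L a A d g u i → τ.arr 11 0 i = (l : ℕ)) ∧
      (¬ BadPart L a A d g u i → τ.arr 11 0 i = g i)) :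
    ∃ g', Grouped n L A τ g' ∧
      ((Finset.range n).image g').card < ((Finset.range n).image g).card := by
  refine ⟨fun i => if BadPart L a A d g u i then l else g i, ⟨⟨?_, ?_, ?_⟩, ?_⟩, ?_⟩
  · intro i hi
    split_ifs with h
    · exact (hτ i hi).1 h
    · exact (hτ i hi).2 h
  · intro i hi
    split_ifs with h
    · rw [hl]; exact G.lt i₀ hi₀
    · exact G.lt i hi
  · refine S.dual.unsplit_merge (g := fun i => g i) G.orth G.unsplit (S.short u hu) ?_ ?_
    · rintro y hy ⟨i, hi⟩
      obtain ⟨v, hv, rfl⟩ := S.surj y hy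
      exact (sq_le_sq₀ (norm_nonneg _) (norm_nonneg _)).1 (hmin v hv ⟨i, i.2, hi⟩)
    · intro i j hij
      split_ifs at hij with h1 h2 h2
      · exact Or.inr ⟨h1, h2⟩
      · exact absurd (hb.congr (hl.symm.trans hij)) h2
      · exact absurd (hb.congr (hl.symm.trans hij.symm)) h1
      · exact Or.inl hij
  · intro i j h
    have := G.orth i j h
    have hiff : BadPart L a A d g u i ↔ BadPart L a A d g u j :=
      ⟨fun h => h.congr this, fun h => h.congr this.symm⟩
    simp only [hiff, this]
  · obtain ⟨j, hj, hjb⟩ := S.dual.exists_part_notMem (g := fun i => g i) (S.short u hu).1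
      (i := ⟨i₀, hi₀⟩) hb
    refine lt_of_le_of_lt (Finset.card_le_card (t := ((Finset.range n).image g).erase (g j)) ?_)
      (Finset.card_erase_lt_of_mem (Finset.mem_image_of_mem _ (Finset.mem_range.2 j.2)))
    intro c hc
    obtain ⟨i, hi, rfl⟩ := Finset.mem_image.1 hc
    rw [Finset.mem_erase]
    split_ifs with h
    · rw [hl]
      exact ⟨fun e => hj e.symm, Finset.mem_image_of_mem _ (Finset.mem_range.2 hi₀)⟩
    · refine ⟨fun e => h ?_, Finset.mem_image_of_mem _ hi⟩
      exact BadPart.congr (show BadPart L a A d g u j from hjb) e.symm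

theorem Runs.pass {σ : State} (S : Setting n s L B a (rows n A) d) (hs : 0 < s)
    (T : Tables n s B a A σ) (G : Grouped n L A σ g) :
    Runs .pass σ fun t τ => t ≤ 80 + n * 120 + s * (60 + n * 80) ∧ ∃ g', Grouped n L A τ g' ∧
      (PartsInLattice n s L a A d g' ∨ (¬ PartsInLattice n s L a A d g ∧
        ((Finset.range n).image g').card < ((Finset.range n).image g).card)) := by
  apply Runs.seq
  apply Runs.assign
  apply Runs.seq
  apply Runs.assign
  apply Runs.seq
  set σ' := (σ.setVar 16 _).setVar 15 _ with hσ'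
  have w16 : σ'.var 16 = B ^ 2 + 1 := by simp [hσ', Expr.eval, T.bound, pow_two]
  have w15 : σ'.var 15 = 0 := by simp [hσ', Expr.eval]
  have T' : Tables n s B a A σ' :=
    ⟨by simp [hσ', T.dim], by simp [hσ', T.card], by simp [hσ', T.bound], T.norm, T.gram, T.power,
      T.dict⟩
  have G' : Grouped n L A σ' g := ⟨⟨G.label, G.lt, G.unsplit⟩, G.orth⟩
  clear_value σ'
  refine (Runs.for (50 + n * 80) (5 + s * (57 + n * 80)) (N := s) (fun k τ =>
    (∀ u < k, (∃ i < n, BadPart L a A d g u i) → τ.var 16 ≤ ‖row n a u‖ ^ 2) ∧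
    ((τ.var 16 = B ^ 2 + 1 ∧ τ.var 15 = 0) ∨ ∃ m < k, (∃ i < n, BadPart L a A d g m i) ∧
      τ.var 15 = m ∧ τ.var 16 = ‖row n a m‖ ^ 2))
    (by decide) (by decide) (by decide) T'.card (le_of_eq (by ring)) ?_ ?_).mono ?_
  · exact ⟨by simp, Or.inl ⟨by simpa using w16, by simpa using w15⟩⟩
  · rintro k hk τ h1 h2 hF ⟨hI, hJ⟩
    have Tτ := T'.congr hF (by decide) (by decide) (by decide) (by decide) (by decide) (by decide)
      (by decide)
    have Gτ : Grouped n L A τ g :=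
      ⟨⟨by rw [hF.arr 11 (by decide)]; exact G'.label, G.lt, G.unsplit⟩, G.orth⟩
    refine (Runs.scan S Tτ Gτ hk h1).mono ?_
    rintro t ρ ⟨ht, h⟩
    refine ⟨ht, ?_⟩
    simp only [State.setVar_var, show (16 : ℕ) ≠ 5 by decide, show (15 : ℕ) ≠ 5 by decide, if_false]
    rcases h with ⟨hb, hlt, r15, r16⟩ | ⟨hb, r15, r16⟩
    · refine ⟨?_, Or.inr ⟨k, by omega, hb, r15, r16⟩⟩
      intro u hu hbu
      rw [r16]
      by_cases huk : u = k
      · rw [huk]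
      · exact hlt.le.trans (hI u (by omega) hbu)
    · rw [r15, r16]
      refine ⟨?_, hJ.imp id ?_⟩
      · intro u hu hbu
        by_cases huk : u = k
        · rw [huk] at hbu ⊢
          exact hb hbu
        · exact hI u (by omega) hbu
      · rintro ⟨m, hm, h⟩
        exact ⟨m, by omega, h⟩
  · rintro t1 τ ⟨ht1, ⟨hI, hJ⟩, -, hF⟩
    have Tτ := T'.congr hF (by decide) (by decide) (by decide) (by decide) (by decide) (by decide)
      (by decide)
    have Gτ : Grouped n L A τ g :=
      ⟨⟨by rw [hF.arr 11 (by decide)]; exact G'.label, G.lt, G.unsplit⟩, G.orth⟩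
    have htime : ∀ t2 : ℕ, t2 ≤ 50 + n * 120 →
        ((Expr.var 2).mul (Expr.var 2) |>.add (Expr.const 1)).cost + 1 +
          ((Expr.const 0).cost + 1 + (t1 + t2)) ≤ 80 + n * 120 + s * (60 + n * 80) := by
      intro t2 ht2
      have : s * (60 + n * 80) = s * (57 + n * 80) + s * 3 := by ring
      simp only [Expr.cost]
      omega
    rcases hJ with ⟨h16, h15⟩ | ⟨m, hm, hbm, h15, h16⟩
    -- The value `B ^ 2 + 1` in `x₁₆` exceeds all squared norms, so no vector has a bad part. Then
    -- `identify` runs on the vector with index 0, which exists as `0 < s`, and changes nothing.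
    · have hdone : PartsInLattice n s L a A d g := by
        intro u hu i hi hb
        have h1 := hI u hu ⟨i, hi, hb⟩
        have h2 := pow_le_pow_left₀ (norm_nonneg _) (S.short u hu).2.2 2
        linarith
      refine (Runs.identify S Tτ Gτ hs (by rw [h15, Nat.cast_zero])).mono ?_
      rintro t2 ρ ⟨ht2, l, -, hρ⟩
      exact ⟨htime t2 ht2, g,
        ⟨⟨fun i hi => (hρ i hi).2 (hdone 0 hs i hi), G.lt, G.unsplit⟩, G.orth⟩, Or.inl hdone⟩
    · refine (Runs.identify S Tτ Gτ hm h15).mono ?_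
      rintro t2 ρ ⟨ht2, l, hl, hρ⟩
      obtain ⟨i₀, hi₀, hb, hl⟩ := hl hbm
      obtain ⟨g', hG', hc⟩ := Gτ.identify S hm (fun v hv hv' => h16 ▸ hI v hv hv') hi₀ hb hl hρ
      exact ⟨htime t2 ht2, g', hG', Or.inr ⟨fun h => h m hm i₀ hi₀ hb, hc⟩⟩

/-- There are at most `n` labels and always at least one, and a pass that does not leave all parts
in the lattice lowers their number. So `n` passes suffice, and no test for completion is needed. -/
theorem Runs.coarsen {σ : State} (S : Setting n s L B a (rows n A) d) (hs : 0 < s)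
    (T : Tables n s B a A σ) (G : Grouped n L A σ g) :
    Runs .coarsen σ fun t τ => t ≤ 5 + n * (90 + n * 120 + s * (60 + n * 80)) ∧
      ∃ g', Grouped n L A τ g' ∧ PartsInLattice n s L a A d g' := by
  refine (Runs.for (80 + n * 120 + s * (60 + n * 80)) (5 + n * (90 + n * 120 + s * (60 + n * 80)))
    (N := n) (fun k τ => ∃ g, Grouped n L A τ g ∧ (PartsInLattice n s L a A d g ∨
      ((Finset.range n).image g).card + k ≤ n)) (by decide) (by decide) (by decide) T.dim ?_ ?_
    ?_).mono ?_
  · refine Nat.add_le_add_left (Nat.mul_le_mul_left n ?_) 5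
    omega
  · refine ⟨g, ⟨⟨G.label, G.lt, G.unsplit⟩, G.orth⟩, Or.inr ?_⟩
    simpa using Finset.card_image_le (s := Finset.range n) (f := g)
  · rintro k hk τ h1 h2 hF ⟨g, G, hg⟩
    have Tτ := T.congr hF (by decide) (by decide) (by decide) (by decide) (by decide) (by decide)
      (by decide)
    refine (Runs.pass S hs Tτ G).mono ?_
    rintro t ρ ⟨ht, g', G', hg'⟩
    refine ⟨ht, g', ⟨⟨G'.label, G'.lt, G'.unsplit⟩, G'.orth⟩, ?_⟩
    rcases hg' with h | ⟨h, h'⟩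
    · exact Or.inl h
    · exact Or.inr (by have := hg.resolve_left h; omega)
  · rintro t τ ⟨ht, ⟨g', G', hg'⟩, -, -⟩
    refine ⟨ht, g', G', hg'.resolve_right fun h => ?_⟩
    have : 0 < ((Finset.range n).image g').card :=
      Finset.card_pos.2 ⟨g' 0, Finset.mem_image_of_mem _ (Finset.mem_range.2 S.pos)⟩
    omega

end


/-! ### A basis adapted to the grouping -/

namespace Program

/-- One step of the Euclidean algorithm for the row `x₂₀` of `A₁₃` and the part of the vector
`A₁₄` with the same label. -/
def euclidStep : Program :=
  .seq (.assign 10 (.floor (.add (.div (.get 14 (.const 0) (.var 20))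
    (.get 13 (.var 20) (.var 20))) (.div (.const 1) (.const 2)))))
  (.seq (.assign 23 (.get 11 (.const 0) (.var 20)))
  (.for 4 0 (.ite (.const 0)
    (.mul (.sub (.get 11 (.const 0) (.var 4)) (.var 23))
      (.sub (.get 11 (.const 0) (.var 4)) (.var 23))) .skip
    (.seq (.assign 21 (.get 14 (.const 0) (.var 4)))
    (.seq (.store 14 (.const 0) (.var 4) (.get 13 (.var 20) (.var 4)))
    (.store 13 (.var 20) (.var 4)
      (.sub (.var 21) (.mul (.var 10) (.get 13 (.var 20) (.var 4))))))))))

/-- The Euclidean algorithm. -/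
def euclid : Program :=
  .loop (.const 0) (.mul (.get 14 (.const 0) (.var 20)) (.get 14 (.const 0) (.var 20))) euclidStep

/-- The input vector `x₅` is reduced by the rows of `A₁₃`. -/
def insert : Program :=
  .seq (.fill 14 (.const 0) 4 0 (.get 7 (.var 5) (.var 4)))
  (.for 3 0 (.seq (.assign 20 (.sub (.sub (.var 0) (.const 1)) (.var 3))) euclid))

/-- A triangular basis. -/
def triangularBasis : Program :=
  .seq (.for 3 0 (.store 13 (.var 3) (.var 3) (.const 1))) (.for 5 1 insert)

end Program

/-- The row `k` of the array `13` as a coordinate vector. -/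
def State.basisRow (n : ℕ) (τ : State) (k : ℕ) : Fin n → ℝ := fun j => τ.arr 13 k j

/-- The vector being reduced. -/
def State.current (n : ℕ) (τ : State) : Fin n → ℝ := fun j => τ.arr 14 0 j

/-- The step `(h, v) ↦ (v - q h, h)`, applied to the row `k` and to the part of the current vector
with the label of `k`. Adding `1 / 2` before rounding down makes `q` a nearest integer to the
quotient. -/
theorem Runs.euclidStep {n k : ℕ} {g : ℕ → ℕ} {σ : State} (hn : σ.var 0 = n)
    (hk : σ.var 20 = k) (hkn : k < n) (hg : ∀ i < n, σ.arr 11 0 i = g i)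
    (hs : ∀ j < n, g j ≠ g k → σ.arr 13 k j = 0) :
    Runs .euclidStep σ fun t τ => t ≤ 40 + n * 50 ∧ ∃ q : ℤ,
      q = ⌊σ.arr 14 0 k / σ.arr 13 k k + 1 / 2⌋ ∧
      τ.basisRow n k = mask (fun i => g i) (g k) (σ.current n) - (q : ℝ) • σ.basisRow n k ∧
      mask (fun i => g i) (g k) (τ.current n) = σ.basisRow n k ∧
      (∀ j < n, g j ≠ g k → τ.arr 14 0 j = σ.arr 14 0 j) ∧
      (∀ i, i ≠ k → τ.arr 13 i = σ.arr 13 i) := by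
  set q : ℤ := ⌊σ.arr 14 0 k / σ.arr 13 k k + 1 / 2⌋ with hq
  apply Runs.seq
  apply Runs.assign
  apply Runs.seq
  apply Runs.assign
  have e1 : (Expr.floor (.add (.div (.get 14 (.const 0) (.var 20))
    (.get 13 (.var 20) (.var 20))) (.div (.const 1) (.const 2)))).eval σ = q := by
    simp [Expr.eval, hk, hq]
  rw [e1]
  simp only [Expr.cost, Expr.eval, Int.cast_zero, Nat.floor_zero, State.setVar_arr,
    State.setVar_var, show (20 : ℕ) ≠ 10 by decide, if_false, hk, Nat.floor_natCast, hg k hkn]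
  refine (Runs.for (N := n) 43 (5 + n * 50) (fun m τ =>
    (∀ j < n, τ.arr 14 0 j = if g j = g k ∧ j < m then σ.arr 13 k j else σ.arr 14 0 j) ∧
    (∀ j < n, τ.arr 13 k j = if g j = g k ∧ j < m then σ.arr 14 0 j - q * σ.arr 13 k j
      else σ.arr 13 k j) ∧ (∀ i, i ≠ k → τ.arr 13 i = σ.arr 13 i)) (by decide) (by decide)
    (by decide) (by simp [hn]) le_rfl (by simp) ?_).mono ?_
  · rintro m hm τ h1 h2 hF ⟨i14, i13, io⟩
    have v10 := hF.var 10 (by decide)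
    have v20 := hF.var 20 (by decide)
    have v23 := hF.var 23 (by decide)
    have e11 := hF.arr 11 (by decide)
    simp [hk] at v10 v20 v23 e11
    apply Runs.ite
    · intro hlt
      simp only [Expr.eval, Int.cast_zero, Nat.floor_zero, h1, Nat.floor_natCast, e11, hg m hm,
        v23] at hlt
      have hne : g m ≠ g k := by
        intro h
        rw [h] at hlt
        simp at hlt
      apply Runs.skip
      refine ⟨by simp only [Expr.cost]; omega, ?_, ?_, ?_⟩
      · intro j hj
        rw [State.setVar_arr, i14 j hj]
        by_cases hjm : j = m
        · simp [hjm, hne]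
        · have : j < m + 1 ↔ j < m := by omega
          simp [this]
      · intro j hj
        rw [State.setVar_arr, i13 j hj]
        by_cases hjm : j = m
        · simp [hjm, hne]
        · have : j < m + 1 ↔ j < m := by omega
          simp [this]
      · intro i hi
        rw [State.setVar_arr, io i hi]
    · intro hlt
      simp only [Expr.eval, Int.cast_zero, Nat.floor_zero, h1, Nat.floor_natCast, e11, hg m hm,
        v23] at hlt
      have he : g m = g k := by
        by_contra hne
        exact hlt (mul_self_pos.2 (sub_ne_zero.2 (by exact_mod_cast hne)))
      have j14 := i14 m hm
      have j13 := i13 m hm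
      simp only [lt_irrefl, and_false, if_false] at j14 j13
      apply Runs.seq
      apply Runs.assign
      apply Runs.seq
      apply Runs.store
      apply Runs.store
      simp only [Expr.cost, Expr.eval, Int.cast_zero, Nat.floor_zero, h1, Nat.floor_natCast,
        State.setArr_var, State.setVar_var, State.setVar_arr, v10, v20, if_true,
        show (20 : ℕ) ≠ 21 by decide, show (4 : ℕ) ≠ 21 by decide, show (10 : ℕ) ≠ 21 by decide,
        if_false, j14, j13]
      rw [State.setArr_arr_of_ne _ _ _ _ (show (13 : ℕ) ≠ 14 by decide)]
      refine ⟨by omega, ?_, ?_, ?_⟩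
      · intro j hj
        rw [State.setArr_arr_of_ne _ _ _ _ (by decide), State.setArr_arr]
        by_cases hjm : j = m
        · simp [hjm, he]
        · have : j < m + 1 ↔ j < m := by omega
          simp [hjm, this, i14 j hj]
      · intro j hj
        rw [State.setArr_arr, State.setArr_arr_of_ne _ _ _ _ (show (13 : ℕ) ≠ 14 by decide)]
        by_cases hjm : j = m
        · simp [hjm, he, j13]
        · have : j < m + 1 ↔ j < m := by omega
          simp [hjm, this, i13 j hj]
      · intro i hi
        funext j
        rw [State.setArr_arr, State.setArr_arr_of_ne _ _ _ _ (show (13 : ℕ) ≠ 14 by decide)]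
        simp [hi, io i hi]
  · rintro t τ ⟨ht, ⟨i14, i13, io⟩, -, -⟩
    refine ⟨by omega, q, rfl, ?_, ?_, ?_, io⟩
    · funext j
      simp only [State.basisRow, mask, State.current, Pi.sub_apply, Pi.smul_apply, smul_eq_mul]
      rw [i13 j j.2]
      by_cases hj : g j = g k
      · simp [hj]
      · simp [hj, hs j j.2 hj]
    · funext j
      simp only [State.basisRow, mask, State.current]
      rw [i14 j j.2]
      by_cases hj : g j = g k
      · simp [hj]
      · simp [hj, hs j j.2 hj]
    · intro j hj hne
      rw [i14 j hj]
      simp [hne]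

theorem span_pair_euclid {n : ℕ} (h v : Fin n → ℝ) (q : ℤ) :
    Submodule.span ℤ {v - (q : ℝ) • h, h} = Submodule.span ℤ {h, v} := by
  have e : (q : ℝ) • h = q • h := Int.cast_smul_eq_zsmul ℝ q h
  rw [e]
  apply le_antisymm <;> rw [Submodule.span_le]
  · rintro x (rfl | rfl)
    · exact Submodule.sub_mem _ (Submodule.subset_span (by simp))
        (Submodule.smul_mem _ _ (Submodule.subset_span (by simp)))
    · exact Submodule.subset_span (by simp)
  · rintro x (rfl | rfl)
    · exact Submodule.subset_span (by simp)
    · have h1 : x = (x - q • h) + q • h := by abel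
      rw [SetLike.mem_coe, h1]
      exact Submodule.add_mem _ (Submodule.subset_span (by simp))
        (Submodule.smul_mem _ _ (Submodule.subset_span (by simp)))

/-- The result of the Euclidean algorithm with `m` steps. -/
structure EuclidPost (n k : ℕ) (g : ℕ → ℕ) (σ τ : State) (m : ℕ) : Prop where
  ne_zero : τ.arr 13 k k ≠ 0
  zero : τ.arr 14 0 k = 0
  size : 2 ^ m * |τ.arr 13 k k| ≤ 4 * |σ.arr 13 k k|
  span : Submodule.span ℤ {τ.basisRow n k, mask (fun i => g i) (g k) (τ.current n)} =
    Submodule.span ℤ {σ.basisRow n k, mask (fun i => g i) (g k) (σ.current n)}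
  other : ∀ j < n, g j ≠ g k → τ.arr 14 0 j = σ.arr 14 0 j
  rows : ∀ i, i ≠ k → τ.arr 13 i = σ.arr 13 i
  supp : ∀ j < n, g j ≠ g k → τ.arr 13 k j = 0

theorem abs_sub_round_mul_le (v : ℝ) {h : ℝ} (hh : h ≠ 0) :
    2 * |v - (⌊v / h + 1 / 2⌋ : ℤ) * h| ≤ |h| := by
  have h1 : v - (⌊v / h + 1 / 2⌋ : ℤ) * h = (v / h - (⌊v / h + 1 / 2⌋ : ℤ)) * h := by
    field_simp
  rw [h1, abs_mul]
  have h2 : |v / h - (⌊v / h + 1 / 2⌋ : ℤ)| ≤ 1 / 2 := by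
    rw [← round_eq]
    exact abs_sub_round _
  nlinarith [abs_nonneg h]

/-- A remainder is at most half as large as the divisor. Multiplied by `D` the leading entries are
integers, so the strong induction on a bound for `D * |σ.arr 13 k k|` ends; each step with nonzero
remainder contributes a factor 2 to `EuclidPost.size`. -/
theorem Runs.euclid {n k D : ℕ} {g : ℕ → ℕ} (hkn : k < n) (hD : 0 < D) (N : ℕ) :
    ∀ σ : State, σ.var 0 = n → σ.var 20 = k → (∀ i < n, σ.arr 11 0 i = g i) →
    (∀ j < n, g j ≠ g k → σ.arr 13 k j = 0) → σ.arr 13 k k ≠ 0 →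
    (∃ z : ℤ, D * σ.arr 13 k k = z) → (∃ z : ℤ, D * σ.arr 14 0 k = z) →
    D * |σ.arr 13 k k| ≤ N →
    Runs .euclid σ fun t τ => ∃ m, t ≤ 9 + m * (50 + n * 50) ∧ EuclidPost n k g σ τ m := by
  induction N using Nat.strong_induction_on with
  | _ N ih =>
    intro σ hn hk hg hs h0 hh hv hN
    have hterm : ∀ τ : State, τ.var 20 = k → τ.arr 14 0 k = 0 →
        ¬ (Expr.const 0).eval τ < (Expr.mul (.get 14 (.const 0) (.var 20))
          (.get 14 (.const 0) (.var 20))).eval τ := by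
      intro τ h1 h2
      simp [Expr.eval, h1, h2]
    have hgo : ∀ τ : State, τ.var 20 = k → τ.arr 14 0 k ≠ 0 →
        (Expr.const 0).eval τ < (Expr.mul (.get 14 (.const 0) (.var 20))
          (.get 14 (.const 0) (.var 20))).eval τ := by
      intro τ h1 h2
      simp only [Expr.eval, Int.cast_zero, Nat.floor_zero, h1, Nat.floor_natCast]
      exact mul_self_pos.2 h2
    by_cases hv0 : σ.arr 14 0 k = 0
    · refine Runs.loop_false (hterm σ hk hv0) ⟨0, by simp [Expr.cost], h0, hv0, ?_, rfl,
        fun _ _ _ => rfl, fun _ _ => rfl, hs⟩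
      linarith [abs_nonneg (σ.arr 13 k k)]
    refine Runs.loop_true (hgo σ hk hv0) ((Runs.euclidStep hn hk hkn hg hs).frame.mono ?_)
    rintro t τ ⟨⟨ht, q, hq, hrow, hcur, hoth, hrows⟩, hF⟩
    have w0 : τ.var 0 = n := by rw [hF.var 0 (by decide), hn]
    have w20 : τ.var 20 = k := by rw [hF.var 20 (by decide), hk]
    have e11 : ∀ i < n, τ.arr 11 0 i = g i := by rw [hF.arr 11 (by decide)]; exact hg
    have hs' : ∀ j < n, g j ≠ g k → τ.arr 13 k j = 0 := by
      intro j hj hne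
      have := congrFun hrow ⟨j, hj⟩
      simpa [State.basisRow, mask, hne, hs j hj hne] using this
    have hr : τ.arr 13 k k = σ.arr 14 0 k - q * σ.arr 13 k k := by
      have := congrFun hrow ⟨k, hkn⟩
      simpa [State.basisRow, mask, State.current] using this
    have hv' : τ.arr 14 0 k = σ.arr 13 k k := by
      have := congrFun hcur ⟨k, hkn⟩
      simpa [State.basisRow, mask, State.current] using this
    have hspan : Submodule.span ℤ {τ.basisRow n k, mask (fun i => g i) (g k) (τ.current n)} =
        Submodule.span ℤ {σ.basisRow n k, mask (fun i => g i) (g k) (σ.current n)} := by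
      rw [hrow, hcur, span_pair_euclid]
    have hle : 2 * |τ.arr 13 k k| ≤ |σ.arr 13 k k| := by
      rw [hr, hq]
      exact abs_sub_round_mul_le _ h0
    by_cases hr0 : τ.arr 13 k k = 0
    -- The row now has diagonal entry zero, and the divisor is in `A₁₄`. As a quotient by zero is
    -- zero, the next `q` is `⌊1 / 2⌋ = 0`, and one more step moves the divisor back. These two
    -- steps do not shrink the entry, whence the factor 4 in `EuclidPost.size`.
    · refine Runs.loop_true (hgo τ w20 (hv' ▸ h0))
        ((Runs.euclidStep w0 w20 hkn e11 hs').frame.mono ?_)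
      rintro t' ρ ⟨⟨ht', q', hq', hrow', hcur', hoth', hrows'⟩, hF'⟩
      rw [hr0, div_zero] at hq'
      norm_num at hq'
      have hr' : ρ.arr 13 k k = σ.arr 13 k k := by
        have := congrFun hrow' ⟨k, hkn⟩
        simpa [State.basisRow, mask, State.current, hq', hv'] using this
      have hz : ρ.arr 14 0 k = 0 := by
        have := congrFun hcur' ⟨k, hkn⟩
        simpa [State.basisRow, mask, State.current, hr0] using this
      refine Runs.loop_false (hterm ρ (by rw [hF'.var 20 (by decide), w20]) hz) ⟨2, ?_, hr' ▸ h0,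
        hz, ?_, ?_, ?_, ?_, ?_⟩
      · simp only [Expr.cost]
        omega
      · rw [hr']
        norm_num
      · rw [hrow', hcur', span_pair_euclid, hspan]
      · intro j hj hne
        rw [hoth' j hj hne, hoth j hj hne]
      · intro i hi
        rw [hrows' i hi, hrows i hi]
      · intro j hj hne
        have := congrFun hrow' ⟨j, hj⟩
        simpa [State.basisRow, mask, hne, hs' j hj hne] using this
    · have hz' : ∃ z : ℤ, D * τ.arr 13 k k = z := by
        obtain ⟨z, hz⟩ := hh
        obtain ⟨w, hw⟩ := hv
        refine ⟨w - q * z, ?_⟩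
        rw [hr]
        push_cast
        rw [← hz, ← hw]
        ring
      obtain ⟨z, hz⟩ := hz'
      have hzabs : (D : ℝ) * |τ.arr 13 k k| = (z.natAbs : ℕ) := by
        rw [Nat.cast_natAbs, Int.cast_abs, ← hz, abs_mul, Nat.abs_cast]
      have hlt : z.natAbs < N := by
        have h1 : (0 : ℝ) < |τ.arr 13 k k| := abs_pos.2 hr0
        have h2 : (0 : ℝ) < D := by exact_mod_cast hD
        have h3 : ((z.natAbs : ℕ) : ℝ) < N := by
          rw [← hzabs]
          nlinarith
        exact_mod_cast h3
      refine (ih z.natAbs hlt τ w0 w20 e11 hs' hr0 ⟨z, hz⟩ (hv' ▸ hh) hzabs.le).mono ?_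
      rintro t' ρ ⟨m, ht', hP⟩
      refine ⟨m + 1, ?_, hP.ne_zero, hP.zero, ?_, hP.span.trans hspan, ?_, ?_, hP.supp⟩
      · simp only [Expr.cost]
        rw [Nat.succ_mul]
        omega
      · rw [pow_succ]
        have := hP.size
        linarith
      · intro j hj hne
        rw [hP.other j hj hne, hoth j hj hne]
      · intro i hi
        rw [hP.rows i hi, hrows i hi]


theorem comb_mem_of_mem_span {n : ℕ} {b : Fin n → E n} {L : Submodule ℤ (E n)}
    {s : Set (Fin n → ℝ)} (hs : ∀ x ∈ s, comb b x ∈ L) {x : Fin n → ℝ}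
    (hx : x ∈ Submodule.span ℤ s) : comb b x ∈ L := by
  induction hx using Submodule.span_induction with
  | mem x hx => exact hs x hx
  | zero => rw [comb_zero]; exact L.zero_mem
  | add x y _ _ h1 h2 => rw [comb_add]; exact L.add_mem h1 h2
  | smul a x _ h =>
    rw [← Int.cast_smul_eq_zsmul ℝ, comb_smul, Int.cast_smul_eq_zsmul]
    exact L.smul_mem a h

theorem comb_mem_span {n : ℕ} (b : Fin n → E n) {s : Set (Fin n → ℝ)} {x : Fin n → ℝ}
    (hx : x ∈ Submodule.span ℤ s) : comb b x ∈ Submodule.span ℤ (comb b '' s) :=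
  comb_mem_of_mem_span (fun _ hy => Submodule.subset_span (Set.mem_image_of_mem _ hy)) hx

theorem apply_eq_zero_of_mem_span {n : ℕ} {s : Set (Fin n → ℝ)} {j : Fin n}
    (hs : ∀ x ∈ s, x j = 0) {x : Fin n → ℝ} (hx : x ∈ Submodule.span ℤ s) : x j = 0 := by
  induction hx using Submodule.span_induction with
  | mem x hx => exact hs x hx
  | zero => rfl
  | add x y _ _ h1 h2 => rw [Pi.add_apply, h1, h2, add_zero]
  | smul a x _ h => rw [Pi.smul_apply, h, smul_zero]

/-- The array `13` holds a triangular matrix of lattice vectors adapted to the grouping. -/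
structure Adapted (n : ℕ) (L : Submodule ℤ (E n)) (b : Fin n → E n) (g : ℕ → ℕ) (τ : State) :
    Prop where
  supp : ∀ k < n, ∀ j < n, g j ≠ g k → τ.arr 13 k j = 0
  tri : ∀ k < n, ∀ j < n, k < j → τ.arr 13 k j = 0
  diag : ∀ k < n, τ.arr 13 k k ≠ 0
  mem : ∀ k < n, comb b (τ.basisRow n k) ∈ L

/-- The group generated by the rows. -/
def rowSpan (n : ℕ) (τ : State) : Submodule ℤ (Fin n → ℝ) :=
  Submodule.span ℤ (Set.range fun k : Fin n => τ.basisRow n k)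

/-- The group generated by the rows and the parts of the vector being reduced. -/
def fullSpan (n : ℕ) (g : ℕ → ℕ) (τ : State) : Submodule ℤ (Fin n → ℝ) :=
  Submodule.span ℤ ((Set.range fun k : Fin n => τ.basisRow n k) ∪
    Set.range fun c : ℕ => mask (fun i : Fin n => g i) c (τ.current n))

/-- The invariant of the reduction of a vector, after the last `m` coordinates. -/
structure Inserting (n : ℕ) (L : Submodule ℤ (E n)) (b : Fin n → E n) (g : ℕ → ℕ) (m : ℕ)
    (τ : State) : Prop extends Adapted n L b g τ where
  zero : ∀ j < n, n ≤ j + m → τ.arr 14 0 j = 0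
  part_mem : ∀ c, comb b (mask (fun i : Fin n => g i) c (τ.current n)) ∈ L

/-- The potential which pays for the Euclidean algorithm. -/
noncomputable def potential (n : ℕ) (τ : State) : ℝ :=
  ∑ k ∈ Finset.range n, Real.logb 2 |τ.arr 13 k k|

section
variable {n : ℕ} {L : Submodule ℤ (E n)} {b : Fin n → E n} {g : ℕ → ℕ}

/-- Only the row `k` and one part of the current vector change, and both stay in the group they
generated before. What holds throughout that group persists: membership in `L` and zeros beyond the
coordinate `k`. The logarithm of `2 ^ p * |h'| ≤ 4 * |h|` gives the inequality for the potential. -/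
theorem Inserting.euclid {σ τ : State} {m k p : ℕ} (hI : Inserting n L b g m σ)
    (hk : k + 1 + m = n) (hP : EuclidPost n k g σ τ p) :
    Inserting n L b g (m + 1) τ ∧ fullSpan n g σ ≤ fullSpan n g τ ∧
      p + potential n τ ≤ 2 + potential n σ := by
  have hkn : k < n := by omega
  have hrow : τ.basisRow n k ∈ Submodule.span ℤ
      {σ.basisRow n k, mask (fun i => g i) (g k) (σ.current n)} := by
    rw [← hP.span]
    exact Submodule.subset_span (by simp)
  have hcur : mask (fun i => g i) (g k) (τ.current n) ∈ Submodule.span ℤ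
      {σ.basisRow n k, mask (fun i => g i) (g k) (σ.current n)} := by
    rw [← hP.span]
    exact Submodule.subset_span (by simp)
  have hrows : ∀ i, i ≠ k → τ.basisRow n i = σ.basisRow n i := by
    intro i hi
    funext j
    simp [State.basisRow, hP.rows i hi]
  have hmask : ∀ c, c ≠ g k → mask (fun i : Fin n => g i) c (τ.current n) =
      mask (fun i : Fin n => g i) c (σ.current n) := by
    intro c hc
    funext j
    simp only [mask, State.current]
    split_ifs with h
    · exact hP.other j j.2 (h ▸ hc)
    · rfl
  have hmem2 : ∀ x ∈ ({σ.basisRow n k, mask (fun i => g i) (g k) (σ.current n)} :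
      Set (Fin n → ℝ)), comb b x ∈ L := by
    rintro x (rfl | rfl)
    · exact hI.mem k hkn
    · exact hI.part_mem _
  have hzero2 : ∀ j : Fin n, k < j →
      ∀ x ∈ ({σ.basisRow n k, mask (fun i => g i) (g k) (σ.current n)} : Set (Fin n → ℝ)),
      x j = 0 := by
    rintro j hj x (rfl | rfl)
    · exact hI.tri k hkn j j.2 hj
    · have := hI.zero j j.2 (by omega)
      simp [mask, State.current, this]
  refine ⟨⟨⟨?_, ?_, ?_, ?_⟩, ?_, ?_⟩, ?_, ?_⟩
  · intro i hi j hj hne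
    by_cases hik : i = k
    · rw [hik] at hne ⊢
      exact hP.supp j hj hne
    · rw [hP.rows i hik]
      exact hI.supp i hi j hj hne
  · intro i hi j hj hij
    by_cases hik : i = k
    · rw [hik] at hij ⊢
      exact apply_eq_zero_of_mem_span (hzero2 ⟨j, hj⟩ hij) hrow
    · rw [hP.rows i hik]
      exact hI.tri i hi j hj hij
  · intro i hi
    by_cases hik : i = k
    · rw [hik]
      exact hP.ne_zero
    · rw [hP.rows i hik]
      exact hI.diag i hi
  · intro i hi
    by_cases hik : i = k
    · rw [hik]
      exact comb_mem_of_mem_span hmem2 hrow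
    · rw [hrows i hik]
      exact hI.mem i hi
  · intro j hj hjm
    by_cases hjk : j = k
    · rw [hjk]
      exact hP.zero
    · by_cases hg : g j = g k
      · have := apply_eq_zero_of_mem_span (hzero2 ⟨j, hj⟩ (by simp only; omega)) hcur
        simpa [mask, State.current, hg] using this
      · rw [hP.other j hj hg]
        exact hI.zero j hj (by omega)
  · intro c
    by_cases hc : c = g k
    · rw [hc]
      exact comb_mem_of_mem_span hmem2 hcur
    · rw [hmask c hc]
      exact hI.part_mem c
  · have hle : Submodule.span ℤ {σ.basisRow n k, mask (fun i => g i) (g k) (σ.current n)} ≤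
        fullSpan n g τ := by
      rw [← hP.span]
      refine Submodule.span_mono ?_
      rintro x (rfl | rfl)
      · exact Or.inl ⟨⟨k, hkn⟩, rfl⟩
      · exact Or.inr ⟨g k, rfl⟩
    rw [fullSpan, Submodule.span_le]
    rintro x (⟨i, rfl⟩ | ⟨c, rfl⟩)
    · by_cases hik : (i : ℕ) = k
      · dsimp only
        rw [hik]
        exact hle (Submodule.subset_span (by simp))
      · dsimp only
        rw [← hrows i hik]
        exact Submodule.subset_span (Or.inl ⟨i, rfl⟩)
    · by_cases hc : c = g k
      · dsimp only
        rw [hc]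
        exact hle (Submodule.subset_span (by simp))
      · dsimp only
        rw [← hmask c hc]
        exact Submodule.subset_span (Or.inr ⟨c, rfl⟩)
  · have h1 : potential n τ - potential n σ =
        Real.logb 2 |τ.arr 13 k k| - Real.logb 2 |σ.arr 13 k k| := by
      rw [potential, potential, ← Finset.sum_sub_distrib]
      refine Finset.sum_eq_single_of_mem k (Finset.mem_range.2 hkn) fun i _ hik => ?_
      rw [hP.rows i hik, sub_self]
    have hpos : 0 < |τ.arr 13 k k| := abs_pos.2 hP.ne_zero
    have hpos' : 0 < |σ.arr 13 k k| := abs_pos.2 (hI.diag k hkn)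
    have h2 := Real.logb_le_logb_of_le (b := 2) (by norm_num) (by positivity) hP.size
    rw [Real.logb_mul (by positivity) hpos.ne', Real.logb_mul (by norm_num) hpos'.ne',
      Real.logb_pow, Real.logb_self_eq_one (by norm_num)] at h2
    have h3 : Real.logb 2 4 = 2 := by
      rw [show (4 : ℝ) = 2 ^ 2 by norm_num, Real.logb_pow, Real.logb_self_eq_one (by norm_num)]
      norm_num
    rw [h3] at h2
    linarith

/-- The rows are used from the last to the first, each clearing one more coordinate from the end.
Finally the current vector is zero, so the rows alone generate all parts of `c` and hence `c`. The
parts are required to be in `L` so that the rows remain lattice vectors. -/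
theorem Runs.insert {d : Fin n → E n} {u D : ℕ} {σ : State} {c : Fin n → ℝ} (hdual : IsDual b d)
    (hD : 0 < D) (hden : ∀ x ∈ L, ∀ i, ∃ z : ℤ, (D : ℝ) * inner ℝ x (d i) = z)
    (hn : σ.var 0 = n) (hu : σ.var 5 = u) (hg : ∀ i < n, σ.arr 11 0 i = g i)
    (hc : ∀ i : Fin n, σ.arr 7 u i = c i)
    (hcL : ∀ l, comb b (mask (fun i : Fin n => g i) l c) ∈ L) (hA : Adapted n L b g σ) :
    Runs .insert σ fun t τ =>
      (t : ℝ) ≤ 20 + n * 50 + (50 + n * 50) * (2 * n + potential n σ - potential n τ) ∧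
      Adapted n L b g τ ∧ rowSpan n σ ≤ rowSpan n τ ∧ c ∈ rowSpan n τ := by
  apply Runs.seq
  refine (Runs.fill (5 + n * 15) (fun j => σ.arr 7 u j) 0 (by decide) hn
    (by simp only [Expr.cost]; omega) ?_).mono ?_
  · intro k hk τ h1 h2 h3 h4
    simp [Expr.eval, h1, h2, h3, hu]
  rintro t1 τ1 ⟨ht1, f14, fv, fa⟩
  have v0 : τ1.var 0 = n := by rw [fv 0 (by decide), hn]
  have e13 := fa 13 (by decide)
  have e11 := fa 11 (by decide)
  have hcur : τ1.current n = c := by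
    funext j
    simp [State.current, f14, hc]
  have hbr : ∀ k, τ1.basisRow n k = σ.basisRow n k := by
    intro k
    funext j
    simp [State.basisRow, e13]
  have hpot : potential n τ1 = potential n σ := by simp [potential, e13]
  have hI : Inserting n L b g 0 τ1 := by
    refine ⟨⟨?_, ?_, ?_, ?_⟩, ?_, ?_⟩
    · rw [e13]; exact hA.supp
    · rw [e13]; exact hA.tri
    · rw [e13]; exact hA.diag
    · intro k hk
      rw [hbr]
      exact hA.mem k hk
    · intro j hj hj'
      omega
    · rw [hcur]; exact hcL
  refine (Runs.for_time (N := n) (fun m t τ =>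
    (t : ℝ) ≤ 5 + m * 30 + (50 + n * 50) * (2 * m + potential n τ1 - potential n τ) ∧
    Inserting n L b g m τ ∧ fullSpan n g τ1 ≤ fullSpan n g τ) (by decide) (by decide) (by decide)
    v0 ?_ ?_).mono ?_
  · refine ⟨?_, ⟨⟨hI.supp, hI.tri, hI.diag, hI.mem⟩, hI.zero, hI.part_mem⟩, le_rfl⟩
    change ((5 : ℕ) : ℝ) ≤ 5 + ((0 : ℕ) : ℝ) * 30 + (50 + n * 50) *
      (2 * ((0 : ℕ) : ℝ) + potential n τ1 - potential n τ1)
    simp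
  · rintro m hm t τ h1 h2 hF ⟨ht, hJ, hle⟩
    obtain ⟨k, hk⟩ : ∃ k, k + 1 + m = n := ⟨n - 1 - m, by omega⟩
    apply Runs.seq
    apply Runs.assign
    have ek : (Expr.sub (.sub (.var 0) (.const 1)) (.var 3)).eval τ = k := by
      simp only [Expr.eval, h1, h2, ← hk]
      push_cast
      ring
    rw [ek]
    have hkn : k < n := by omega
    have hden1 := hden _ (hJ.mem k hkn) ⟨k, hkn⟩
    have hden2 := hden _ (hJ.part_mem (g k)) ⟨k, hkn⟩
    rw [hdual.inner_comb] at hden1 hden2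
    obtain ⟨N, hN⟩ := exists_nat_ge ((D : ℝ) * |τ.arr 13 k k|)
    refine (Runs.euclid (g := g) hkn hD N (τ.setVar 20 k) (by simpa using h2) (by simp) ?_
      (hJ.supp k hkn) (hJ.diag k hkn) hden1 ?_ hN).mono ?_
    · intro i hi
      rw [State.setVar_arr, hF.arr 11 (by decide), e11]
      exact hg i hi
    · simpa [mask, State.current] using hden2
    rintro t' ρ ⟨p, ht', hP⟩
    have hJ' : Inserting n L b g m (τ.setVar 20 k) :=
      ⟨⟨hJ.supp, hJ.tri, hJ.diag, hJ.mem⟩, hJ.zero, hJ.part_mem⟩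
    obtain ⟨q1, q2, q3⟩ := hJ'.euclid hk hP
    refine ⟨?_, ⟨⟨q1.supp, q1.tri, q1.diag, q1.mem⟩, q1.zero, q1.part_mem⟩, hle.trans q2⟩
    have q3' : p + potential n ρ ≤ 2 + potential n τ := q3
    change ((_ : ℕ) : ℝ) ≤ 5 + ((m + 1 : ℕ) : ℝ) * 30 + (50 + n * 50) *
      (2 * ((m + 1 : ℕ) : ℝ) + potential n τ1 - potential n ρ)
    have ht'' : (t' : ℝ) ≤ 9 + p * (50 + n * 50) := by exact_mod_cast ht'
    have hmul := mul_le_mul_of_nonneg_right q3' (by positivity : (0 : ℝ) ≤ 50 + n * 50)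
    simp only [Expr.cost]
    push_cast
    nlinarith
  · rintro t τ ⟨⟨ht, hJ, hle⟩, -, -⟩
    have hzero : ∀ l, mask (fun i : Fin n => g i) l (τ.current n) = 0 := by
      intro l
      funext j
      simp [mask, State.current, hJ.zero j j.2 (by omega)]
    have hfull : fullSpan n g τ ≤ rowSpan n τ := by
      rw [fullSpan, Submodule.span_le]
      rintro x (⟨i, rfl⟩ | ⟨l, rfl⟩)
      · exact Submodule.subset_span ⟨i, rfl⟩
      · dsimp only
        rw [hzero]
        exact Submodule.zero_mem _
    refine ⟨?_, hJ.toAdapted, ?_, ?_⟩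
    · rw [hpot] at ht
      have h3 : (t1 : ℝ) ≤ 5 + n * 15 := by exact_mod_cast ht1
      push_cast
      linarith
    · refine le_trans ?_ (hle.trans hfull)
      rw [rowSpan, Submodule.span_le]
      rintro x ⟨i, rfl⟩
      dsimp only
      rw [← hbr]
      exact Submodule.subset_span (Or.inl ⟨i, rfl⟩)
    · refine hfull (hle ?_)
      rw [← sum_mask (A := Finset.univ.image fun i : Fin n => g i) (g := fun i : Fin n => g i)
        (fun i => by simp) c]
      refine Submodule.sum_mem _ fun l _ => ?_
      rw [← hcur]
      exact Submodule.subset_span (Or.inr ⟨l, rfl⟩)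

/-- The unit matrix stands for `b` itself and has potential zero. The potential differences
telescope over the `s` insertions, so the logarithm of the denominator enters only once and not with
a factor `s`. -/
theorem Runs.triangularBasis {d : Fin n → E n} {s D : ℕ} {σ : State} (hdual : IsDual b d)
    (hbL : ∀ i, b i ∈ L)
    (hD : 0 < D) (hden : ∀ x ∈ L, ∀ i, ∃ z : ℤ, (D : ℝ) * inner ℝ x (d i) = z)
    (hn : σ.var 0 = n) (hs : σ.var 1 = s) (hg : ∀ i < n, σ.arr 11 0 i = g i)
    (hcL : ∀ u < s, ∀ l, comb b (mask (fun i : Fin n => g i) l fun j => σ.arr 7 u j) ∈ L)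
    (h13 : σ.arr 13 = 0) :
    Runs .triangularBasis σ fun t τ =>
      (t : ℝ) ≤ 20 + n * 20 + s * (30 + n * 50 + (50 + n * 50) * (2 * n)) +
        (50 + n * 50) * (n * Real.logb 2 D) ∧
      Adapted n L b g τ ∧ ∀ u < s, (fun j : Fin n => σ.arr 7 u j) ∈ rowSpan n τ := by
  apply Runs.seq
  refine (Runs.for (N := n) 4 (5 + n * 11) (fun k τ => ∀ i j, τ.arr 13 i j =
    if i = j ∧ i < k then 1 else 0) (by decide) (by decide) (by decide) hn le_rfl (by simp [h13])
    ?_).mono ?_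
  · intro k hk τ h1 h2 hF hI
    apply Runs.store
    simp only [Expr.cost, Expr.eval, h1, Nat.floor_natCast, Int.cast_one]
    refine ⟨by omega, ?_⟩
    intro i j
    rw [State.setVar_arr, State.setArr_arr, hI]
    simp only [true_and]
    split_ifs <;> first | rfl | omega
  rintro t1 τ1 ⟨ht1, f13, -, F1⟩
  have v0 : τ1.var 0 = n := by rw [F1.var 0 (by decide), hn]
  have v1 : τ1.var 1 = s := by rw [F1.var 1 (by decide), hs]
  have e7 := F1.arr 7 (by decide)
  have e11 := F1.arr 11 (by decide)
  have hA : Adapted n L b g τ1 := by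
    refine ⟨?_, ?_, ?_, ?_⟩
    · intro k hk j hj hne
      rw [f13, if_neg]
      rintro ⟨rfl, -⟩
      exact hne rfl
    · intro k hk j hj hne
      rw [f13, if_neg]
      omega
    · intro k hk
      rw [f13]
      simp [hk]
    · intro k hk
      have : comb b (τ1.basisRow n k) = b ⟨k, hk⟩ := by
        rw [comb, Finset.sum_eq_single ⟨k, hk⟩]
        · simp [State.basisRow, f13, hk]
        · intro j _ hj
          have : k ≠ j := fun h => hj (Fin.ext h.symm)
          simp [State.basisRow, f13, this]
        · simp
      rw [this]
      exact hbL _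
  have hpot : potential n τ1 = 0 := by
    refine Finset.sum_eq_zero fun k hk => ?_
    rw [f13]
    simp [Finset.mem_range.1 hk]
  refine (Runs.for_time (N := s) (fun m t τ => (t : ℝ) ≤ 5 + m * (30 + n * 50) +
    (50 + n * 50) * (m * (2 * n) - potential n τ) ∧ Adapted n L b g τ ∧
    ∀ u < m, (fun j : Fin n => σ.arr 7 u j) ∈ rowSpan n τ) (by decide) (by decide) (by decide)
    v1 ?_ ?_).mono ?_
  · refine ⟨?_, ⟨hA.supp, hA.tri, hA.diag, hA.mem⟩, by simp⟩
    change ((5 : ℕ) : ℝ) ≤ 5 + ((0 : ℕ) : ℝ) * (30 + n * 50) +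
      (50 + n * 50) * (((0 : ℕ) : ℝ) * (2 * n) - potential n τ1)
    simp [hpot]
  · rintro u hu t τ h1 h2 hF ⟨ht, hJ, hle⟩
    refine (Runs.insert (c := fun j => σ.arr 7 u j) hdual hD hden
      (by rw [hF.var 0 (by decide), v0]) h1
      (by rw [hF.arr 11 (by decide), e11]; exact hg)
      (fun i => by rw [hF.arr 7 (by decide), e7]) (hcL u hu) hJ).mono ?_
    rintro t' ρ ⟨ht', q1, q2, q3⟩
    refine ⟨?_, ⟨q1.supp, q1.tri, q1.diag, q1.mem⟩, ?_⟩
    · change ((_ : ℕ) : ℝ) ≤ 5 + ((u + 1 : ℕ) : ℝ) * (30 + n * 50) +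
        (50 + n * 50) * (((u + 1 : ℕ) : ℝ) * (2 * n) - potential n ρ)
      push_cast
      nlinarith
    · intro v hv
      change _ ∈ rowSpan n ρ
      by_cases hvu : v = u
      · rw [hvu]
        exact q3
      · exact q2 (hle v (by omega))
  · rintro t τ ⟨⟨ht, hJ, hle⟩, -, -⟩
    refine ⟨?_, hJ, hle⟩
    -- A diagonal entry is a nonzero coordinate of a lattice vector, so `D` times it is a nonzero
    -- integer.
    have hlow : -(n * Real.logb 2 D) ≤ potential n τ := by
      have h1 : ∀ k ∈ Finset.range n, -Real.logb 2 D ≤ Real.logb 2 |τ.arr 13 k k| := by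
        intro k hk
        have hkn := Finset.mem_range.1 hk
        obtain ⟨z, hz⟩ := hden _ (hJ.mem k hkn) ⟨k, hkn⟩
        rw [hdual.inner_comb] at hz
        have hz' : (D : ℝ) * τ.arr 13 k k = z := hz
        have hD' : (0 : ℝ) < D := by exact_mod_cast hD
        have hne := hJ.diag k hkn
        have hz0 : z ≠ 0 := by
          rintro rfl
          rw [Int.cast_zero] at hz'
          rcases mul_eq_zero.1 hz' with h | h
          · exact hD'.ne' h
          · exact hne h
        have h2 : (1 : ℝ) ≤ D * |τ.arr 13 k k| := by
          have : (1 : ℝ) ≤ |(z : ℝ)| := by exact_mod_cast Int.one_le_abs hz0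
          rwa [← hz', abs_mul, Nat.abs_cast] at this
        have h3 := Real.logb_le_logb_of_le (b := 2) (by norm_num) one_pos h2
        rw [Real.logb_one, Real.logb_mul hD'.ne' (abs_ne_zero.2 hne)] at h3
        linarith
      calc -(n * Real.logb 2 D) = ∑ _k ∈ Finset.range n, -Real.logb 2 D := by simp
        _ ≤ potential n τ := Finset.sum_le_sum h1
    have h4 := mul_le_mul_of_nonneg_left hlow (by positivity : (0 : ℝ) ≤ 50 + n * 50)
    have h5 : (t1 : ℝ) ≤ 5 + n * 11 := by exact_mod_cast ht1
    push_cast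
    nlinarith [Nat.cast_nonneg (α := ℝ) n]

end


/-! ### The output -/

namespace Program

/-- The basis vectors are written to `A₁`. -/
def outputBasis : Program :=
  .for 3 0 (.for 22 0
    (.seq (.sum 6 4 0 (.mul (.get 13 (.var 3) (.var 4)) (.get 3 (.var 4) (.var 22))))
    (.store 1 (.var 3) (.var 22) (.var 6))))

/-- The labels are renumbered. -/
def renumber : Program :=
  .seq (.assign 13 (.const 0))
  (.for 3 0 (.seq
    (.ite (.get 15 (.const 0) (.get 11 (.const 0) (.var 3))) (.const 1)
      (.seq (.assign 13 (.add (.var 13) (.const 1)))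
        (.store 15 (.const 0) (.get 11 (.const 0) (.var 3)) (.var 13))) .skip)
    (.store 2 (.const 0) (.var 3)
      (.sub (.get 15 (.const 0) (.get 11 (.const 0) (.var 3))) (.const 1)))))

/-- The output. -/
def output : Program := .seq outputBasis (.seq renumber (.assign 0 (.var 13)))

end Program

theorem Runs.outputBasis {n : ℕ} {σ : State} (hn : σ.var 0 = n) :
    Runs .outputBasis σ fun t τ => t ≤ 5 + n * (12 + n * (50 + n * 20)) ∧
      ∀ i < n, row n (τ.arr 1) i = comb (rows n (σ.arr 3)) (σ.basisRow n i) := by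
  refine (Runs.for (N := n) (5 + n * (50 + n * 20)) (5 + n * (12 + n * (50 + n * 20)))
    (fun k τ => ∀ i < k, ∀ j < n, τ.arr 1 i j =
      ∑ l ∈ Finset.range n, σ.arr 13 i l * σ.arr 3 l j) (by decide) (by decide) (by decide) hn
    (le_of_eq (by ring)) (by simp) ?_).mono ?_
  · intro k hk τ h1 h2 hF hI
    have a3 := hF.arr 3 (by decide)
    have a13 := hF.arr 13 (by decide)
    refine (Runs.for (N := n) (43 + n * 20) (5 + n * (50 + n * 20))
      (fun m τ => ∀ i j, j < n → (i < k ∨ i = k ∧ j < m) → τ.arr 1 i j =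
        ∑ l ∈ Finset.range n, σ.arr 13 i l * σ.arr 3 l j) (by decide) (by decide) (by decide) h2
      (le_of_eq (by ring)) ?_ ?_).mono ?_
    · intro i j hj hi
      exact hI i (by omega) j hj
    · intro m hm ρ k1 k2 kF hJ
      have b3 := kF.arr 3 (by decide)
      have b13 := kF.arr 13 (by decide)
      have v3 := kF.var 3 (by decide)
      rw [a3] at b3
      rw [a13] at b13
      rw [h1] at v3
      apply Runs.seq
      refine (Runs.sum (7 + n * 20) (fun l => σ.arr 13 k l * σ.arr 3 l m) (by decide) (by decide)
        (by decide) k2 (by simp only [Expr.cost]; omega) ?_).mono ?_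
      · intro l hl ρ' e1 e2 e3
        simp [Expr.eval, e1, e2, e3, k1, v3, b3, b13]
      rintro t ρ' ⟨ht, e6, e2, e3⟩
      apply Runs.store
      simp only [Expr.cost, Expr.eval, e2 3 (by decide) (by decide), v3,
        e2 22 (by decide) (by decide), k1, e6, Nat.floor_natCast]
      refine ⟨by omega, ?_⟩
      intro i j hj hi
      rw [State.setVar_arr, State.setArr_arr, e3]
      by_cases hij : i = k ∧ j = m
      · simp [hij]
      · rw [if_neg (by tauto)]
        exact hJ i j hj (by omega)
    · rintro t ρ ⟨ht, hJ, -, -⟩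
      refine ⟨ht, ?_⟩
      intro i hi j hj
      exact hJ i j hj (by omega)
  · rintro t τ ⟨ht, hI, -, -⟩
    refine ⟨ht, fun i hi => row_eq_iff.2 fun j => ?_⟩
    rw [hI i hi j j.2, Finset.sum_range]
    simp [comb, rows, row, State.basisRow]

/-- The entry `A₁₅[0, l]` is one more than the new number of the label `l`. The shift keeps the
initial value 0 free for labels not yet met. -/
theorem Runs.renumber {n : ℕ} {g : ℕ → ℕ} {σ : State} (hn : σ.var 0 = n)
    (hg : ∀ i < n, σ.arr 11 0 i = g i) (h15 : σ.arr 15 = 0) :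
    Runs .renumber σ fun t τ => t ≤ 10 + n * 50 ∧ ∃ (r : ℕ) (c : ℕ → ℕ), τ.var 13 = r ∧
      (∀ i < n, τ.arr 2 0 i = c i) ∧ (∀ i < n, c i < r) ∧
      (∀ i < n, ∀ j < n, c i = c j ↔ g i = g j) ∧ ∀ l < r, ∃ i < n, c i = l := by
  apply Runs.seq
  apply Runs.assign
  refine (Runs.for (N := n) 35 (5 + n * 42) (fun k τ => ∃ (r : ℕ) (f : ℕ → ℕ), τ.var 13 = r ∧
    (∀ l, τ.arr 15 0 l = f l) ∧ (∀ i < k, 1 ≤ f (g i)) ∧ (∀ l, f l ≤ r) ∧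
    (∀ l l', f l = f l' → f l ≠ 0 → l = l') ∧ (∀ m, 1 ≤ m → m ≤ r → ∃ i < k, f (g i) = m) ∧
    ∀ i < k, τ.arr 2 0 i = (f (g i) : ℝ) - 1) (by decide) (by decide) (by decide)
    (by simpa using hn) le_rfl ?_ ?_).mono ?_
  · refine ⟨0, fun _ => 0, by simp [Expr.eval], by simp [h15], by simp, by simp, by simp, ?_,
      by simp⟩
    intro m h1 h2
    omega
  · rintro k hk τ h1 h2 hF ⟨r, f, h13, h15, hf1, hfr, hinj, hsurj, h2⟩
    have e11 : τ.arr 11 0 k = g k := by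
      rw [hF.arr 11 (by decide)]
      exact hg k hk
    have hcond : (Expr.get 15 (.const 0) (.get 11 (.const 0) (.var 3))).eval τ <
        (Expr.const 1).eval τ ↔ f (g k) = 0 := by
      simp only [Expr.eval, Int.cast_zero, Nat.floor_zero, h1, Nat.floor_natCast, e11, h15,
        Int.cast_one]
      rw [Nat.cast_lt_one]
    apply Runs.seq
    apply Runs.ite
    · intro hlt
      rw [hcond] at hlt
      apply Runs.seq
      apply Runs.assign
      apply Runs.store
      apply Runs.store
      simp only [Expr.cost, Expr.eval, Int.cast_zero, Nat.floor_zero, h1, Nat.floor_natCast,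
        State.setVar_var, State.setVar_arr, State.setArr_var, h13, if_true,
        show (3 : ℕ) ≠ 13 by decide, if_false, e11,
        State.setArr_arr_of_ne _ _ _ _ (show (11 : ℕ) ≠ 15 by decide), Int.cast_one]
      have hne : ∀ i < k, g i ≠ g k := fun i hi h => by
        have := hf1 i hi
        rw [h] at this
        omega
      refine ⟨by omega, r + 1, Function.update f (g k) (r + 1), by push_cast; simp, ?_, ?_, ?_,
        ?_, ?_, ?_⟩
      · intro l
        rw [State.setArr_arr_of_ne _ _ _ _ (by decide), State.setArr_arr, State.setVar_arr, h15,
          Function.update_apply]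
        by_cases hl : l = g k <;> simp [hl]
      · intro i hi
        by_cases hik : i = k
        · simp [hik]
        · rw [Function.update_of_ne (hne i (by omega))]
          exact hf1 i (by omega)
      · intro l
        rw [Function.update_apply]
        have := hfr l
        split_ifs <;> omega
      · intro l l' hll h0
        simp only [Function.update_apply] at hll h0
        have := hfr l
        have := hfr l'
        split_ifs at hll h0
        · omega
        · omega
        · omega
        · exact hinj l l' hll h0
      · intro m hm hmr
        by_cases hmr' : m = r + 1
        · exact ⟨k, by omega, by simp [hmr']⟩
        · obtain ⟨i, hi, hfi⟩ := hsurj m hm (by omega)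
          refine ⟨i, by omega, ?_⟩
          rw [Function.update_of_ne (hne i hi), hfi]
      · intro i hi
        rw [State.setArr_arr]
        by_cases hik : i = k
        · subst hik
          simp [State.setArr_arr]
        · rw [if_neg (by tauto), State.setArr_arr_of_ne _ _ _ _ (by decide), State.setVar_arr,
            h2 i (by omega), Function.update_of_ne (hne i (by omega))]
    · intro hlt
      rw [hcond] at hlt
      apply Runs.skip
      apply Runs.store
      simp only [Expr.cost, Expr.eval, Int.cast_zero, Nat.floor_zero, h1, Nat.floor_natCast,
        e11, h15, Int.cast_one]
      refine ⟨by omega, r, f, by simpa using h13, ?_, ?_, hfr, hinj, ?_, ?_⟩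
      · intro l
        rw [State.setVar_arr, State.setArr_arr_of_ne _ _ _ _ (by decide), h15]
      · intro i hi
        by_cases hik : i = k
        · rw [hik]
          omega
        · exact hf1 i (by omega)
      · intro m hm hmr
        obtain ⟨i, hi, hfi⟩ := hsurj m hm hmr
        exact ⟨i, by omega, hfi⟩
      · intro i hi
        rw [State.setVar_arr, State.setArr_arr]
        by_cases hik : i = k
        · subst hik
          simp
        · rw [if_neg (by tauto), h2 i (by omega)]
  · rintro t τ ⟨ht, ⟨r, f, h13, h15, hf1, hfr, hinj, hsurj, h2⟩, -, -⟩
    refine ⟨by simp only [Expr.cost]; omega, r, fun i => f (g i) - 1, h13, ?_, ?_, ?_, ?_⟩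
    · intro i hi
      rw [h2 i hi, Nat.cast_sub (hf1 i hi), Nat.cast_one]
    · intro i hi
      have := hf1 i hi
      have := hfr (g i)
      dsimp only
      omega
    · intro i hi j hj
      have h1 := hf1 i hi
      have h2 := hf1 j hj
      constructor
      · intro h
        dsimp only at h
        exact hinj _ _ (by omega) (by omega)
      · intro h
        dsimp only
        rw [h]
    · intro l hl
      obtain ⟨i, hi, hfi⟩ := hsurj (l + 1) (by omega) (by omega)
      exact ⟨i, hi, by dsimp only; omega⟩

theorem Runs.output {n : ℕ} {g : ℕ → ℕ} {σ : State} (hn : σ.var 0 = n)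
    (hg : ∀ i < n, σ.arr 11 0 i = g i) (h15 : σ.arr 15 = 0) :
    Runs .output σ fun t τ => t ≤ 20 + n * (62 + n * (50 + n * 20)) ∧
      (∀ i : Fin n, outputVector n τ i = comb (rows n (σ.arr 3)) (σ.basisRow n i)) ∧
      ∃ (r : ℕ) (c : Fin n → Fin r), τ.var 0 = r ∧
      (∀ i : Fin n, τ.arr 2 0 i = ((c i : ℕ) : ℝ)) ∧
      (∀ i j : Fin n, c i = c j ↔ g i = g j) ∧ Function.Surjective c := by
  apply Runs.seq
  refine (Runs.outputBasis hn).frame.mono ?_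
  rintro t1 τ1 ⟨⟨ht1, hrow⟩, F1⟩
  apply Runs.seq
  refine (Runs.renumber (n := n) (g := g) (by rw [F1.var 0 (by decide), hn])
    (by rw [F1.arr 11 (by decide)]; exact hg) (by rw [F1.arr 15 (by decide), h15])).frame.mono ?_
  rintro t2 τ2 ⟨⟨ht2, r, c, h13, h2, hlt, hc, hs⟩, F2⟩
  apply Runs.assign
  refine ⟨?_, ?_, r, fun i => ⟨c i, hlt i i.2⟩, ?_, ?_, ?_, ?_⟩
  · have : n * (62 + n * (50 + n * 20)) = n * (12 + n * (50 + n * 20)) + n * 50 := by ring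
    simp only [Expr.cost]
    omega
  · intro i
    rw [← hrow i i.2]
    change row n (τ2.arr 1) i = _
    rw [F2.arr 1 (by decide)]
  · simpa [Expr.eval] using h13
  · exact fun i => h2 i i.2
  · intro i j
    rw [Fin.mk.injEq]
    exact hc i i.2 j j.2
  · rintro ⟨l, hl⟩
    obtain ⟨i, hi, rfl⟩ := hs l hl
    exact ⟨⟨i, hi⟩, rfl⟩


/-! ### The algorithm -/

/-- The decomposition of a lattice generated by its short vectors. -/
def Program.decompose : Program :=
  .seq minimalBasis (.seq tables (.seq gramGroups (.seq coarsen (.seq triangularBasis output))))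

/-- Yields `1 ≤ B`, so that the logarithm in the time bound is nonnegative. -/
theorem one_le_norm {n : ℕ} {L : Submodule ℤ (E n)} (hL : IsIntegral L) {x : E n} (hx : x ∈ L)
    (h0 : x ≠ 0) : 1 ≤ ‖x‖ := by
  obtain ⟨z, hz⟩ := hL x hx x hx
  rw [real_inner_self_eq_norm_sq] at hz
  have h1 : 0 < ‖x‖ := norm_pos_iff.2 h0
  have h2 : (0 : ℝ) < z := by rw [← hz]; positivity
  have h3 : (1 : ℝ) ≤ z := by exact_mod_cast (Int.cast_pos.1 h2 : 0 < z)
  rw [← hz] at h3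
  nlinarith

/-- A generating set of a lattice of full rank spans the space. This guarantees that every sentinel
of `initBasis` is replaced. -/
theorem eq_zero_of_inner_eq_zero {n : ℕ} {L : Submodule ℤ (E n)} [DiscreteTopology L]
    [IsZLattice ℝ L] {S : Set (E n)} (hS : Submodule.span ℤ S = L) {d : E n}
    (hd : ∀ x ∈ S, inner ℝ x d = (0 : ℝ)) : d = 0 := by
  have h1 : ∀ x ∈ L, inner ℝ x d = (0 : ℝ) := by
    intro x hx
    have : Orthogonal (Submodule.span ℤ S) (Submodule.span ℤ {d}) :=
      Orthogonal.span (by rintro x hx _ rfl; exact hd x hx)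
    exact this x (hS ▸ hx) d (Submodule.mem_span_singleton_self d)
  have h2 : ∀ x ∈ Submodule.span ℝ (L : Set (E n)), inner ℝ x d = (0 : ℝ) := by
    intro x hx
    induction hx using Submodule.span_induction with
    | mem x hx => exact h1 x hx
    | zero => simp
    | add x y _ _ h1 h2 => rw [inner_add_left, h1, h2, add_zero]
    | smul a x _ h1 => rw [inner_smul_left, h1, mul_zero]
  rw [IsZLattice.span_top] at h2
  exact inner_self_eq_zero.1 (h2 d trivial)

/-- Here `n * B ^ 2 ≤ (n * B) ^ 2`, and the constant 3 bounds `2 / log 2`. -/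
theorem logb_denominator_le {n D : ℕ} {B : ℝ} (hn : 0 < n) (hB : 1 ≤ B) (hD : 0 < D)
    (h : (D : ℝ) ≤ (n * B ^ 2) ^ n) : Real.logb 2 D ≤ 3 * n * Real.log (n * B) := by
  have hn1 : (1 : ℝ) ≤ n := by exact_mod_cast hn
  have hD' : (0 : ℝ) < D := by exact_mod_cast hD
  have h1 : Real.log D ≤ n * (2 * Real.log (n * B)) := by
    calc Real.log D ≤ Real.log ((n * B ^ 2) ^ n) := Real.log_le_log hD' h
      _ = n * Real.log (n * B ^ 2) := Real.log_pow _ _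
      _ ≤ n * Real.log ((n * B) ^ 2) := by
        gcongr
        rw [mul_pow]
        gcongr
        nlinarith
      _ = n * (2 * Real.log (n * B)) := by rw [Real.log_pow]; norm_num
  have h0 : 0 ≤ Real.log (n * B) := Real.log_nonneg (by nlinarith)
  have h2 := Real.log_two_gt_d9
  rw [Real.logb, div_le_iff₀ (by linarith)]
  have h3 : 0 ≤ n * Real.log (n * B) := by positivity
  nlinarith

/-- Absorbs the costs that involve neither `s` nor a logarithm. For `n ≥ 2` the logarithm is at
least `log 2`, and `3 * (log 2) ^ 2 > 1`. For `n = 1` it may vanish, and the term with `s` pays. -/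
theorem cube_le {n s : ℕ} {B : ℝ} (hn : 0 < n) (hs : 0 < s) (hB : 1 ≤ B) :
    (n : ℝ) ^ 3 ≤ 3 * ((n : ℝ) ^ 6 * Real.log (n * B) ^ 2) + (s : ℝ) * (n : ℝ) ^ 2 := by
  have hs1 : (1 : ℝ) ≤ s := by exact_mod_cast hs
  have hn1 : (1 : ℝ) ≤ n := by exact_mod_cast hn
  rcases Nat.lt_or_ge 1 n with h | h
  · have hn2 : (2 : ℝ) ≤ n := by exact_mod_cast h
    have h1 : Real.log 2 ≤ Real.log (n * B) := Real.log_le_log (by norm_num) (by nlinarith)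
    have h2 := Real.log_two_gt_d9
    have h3 : 1 ≤ 3 * Real.log (n * B) ^ 2 := by nlinarith
    have h4 : (n : ℝ) ^ 3 ≤ (n : ℝ) ^ 6 := pow_le_pow_right₀ hn1 (by norm_num)
    have h5 : (n : ℝ) ^ 6 * 1 ≤ (n : ℝ) ^ 6 * (3 * Real.log (n * B) ^ 2) := by gcongr
    have h6 : 0 ≤ (s : ℝ) * (n : ℝ) ^ 2 := by positivity
    linarith
  · obtain rfl : n = 1 := by omega
    have h6 : 0 ≤ 3 * (((1 : ℕ) : ℝ) ^ 6 * Real.log ((1 : ℕ) * B) ^ 2) := by positivity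
    simp only [Nat.cast_one, one_pow, mul_one] at h6 ⊢
    linarith

/-- With `e = log (n B)` the orders to be bounded are `s n ^ 2`, `n ^ 3` and, from the Euclidean
algorithms, `n ^ 3 e`. The last is handled by `e ≤ 1 + e ^ 2`. -/
theorem total_time_le {n s : ℕ} {B l : ℝ} (hn : 0 < n) (hs : 0 < s) (hB : 1 ≤ B)
    (hl : l ≤ 3 * n * Real.log (n * B)) :
    (10 + n * 50 + s * (67 + n * (150 + n * 45)) + (40 + n * 20 + s * (30 + n * (60 + n * 40))) +
      n ^ 3 * 300 + (5 + n * (90 + n * 120 + s * (60 + n * 80))) +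
      (20 + n * 20 + s * (30 + n * 50 + (50 + n * 50) * (2 * n)) + (50 + n * 50) * (n * l)) +
      (20 + n * (62 + n * (50 + n * 20))) : ℝ) ≤
      5000 * ((n : ℝ) ^ 6 * Real.log (n * B) ^ 2 + (s : ℝ) * (n : ℝ) ^ 2) := by
  have hs1 : (1 : ℝ) ≤ s := by exact_mod_cast hs
  have hn1 : (1 : ℝ) ≤ n := by exact_mod_cast hn
  have hc := cube_le hn hs hB
  set x : ℝ := (n : ℝ) with hx
  set y : ℝ := (s : ℝ) with hy
  set e : ℝ := Real.log (x * B) with he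
  have he0 : 0 ≤ e := Real.log_nonneg (by nlinarith)
  have h12 : x ≤ x ^ 2 := by nlinarith
  have h02 : 1 ≤ x ^ 2 := by nlinarith
  have h23 : x ^ 2 ≤ x ^ 3 := by nlinarith [sq_nonneg x]
  have y0 : y ≤ y * x ^ 2 := by nlinarith
  have y1 : y * x ≤ y * x ^ 2 := by nlinarith
  have h36 : x ^ 3 ≤ x ^ 6 := pow_le_pow_right₀ hn1 (by norm_num)
  have e1 : x ^ 3 * e ≤ x ^ 3 + x ^ 6 * e ^ 2 := by
    have h1 : e ≤ 1 + e ^ 2 := by nlinarith [sq_nonneg (e - 1)]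
    have h2 : x ^ 3 * e ≤ x ^ 3 * (1 + e ^ 2) := by gcongr
    have h3 : x ^ 3 * e ^ 2 ≤ x ^ 6 * e ^ 2 := by gcongr
    linarith
  have e2 : (50 + x * 50) * (x * l) ≤ 300 * (x ^ 3 * e) := by
    calc (50 + x * 50) * (x * l) ≤ (50 + x * 50) * (x * (3 * x * e)) := by gcongr
      _ ≤ (100 * x) * (x * (3 * x * e)) := by
        gcongr
        linarith
      _ = 300 * (x ^ 3 * e) := by ring
  nlinarith

theorem Runs.decompose {n s : ℕ} {L : Submodule ℤ (E n)} [DiscreteTopology L] [IsZLattice ℝ L]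
    (hn : 0 < n) (hL : IsIntegral L) {B : ℝ} {v : Fin s → E n}
    (hv : Set.range v = shortVectors L B) (hspan : Submodule.span ℤ (Set.range v) = L) :
    Runs .decompose (inputState n s B v) fun t τ => OutputsDecomposition L τ ∧
      (t : ℝ) ≤ 5000 * ((n : ℝ) ^ 6 * Real.log (n * B) ^ 2 + (s : ℝ) * (n : ℝ) ^ 2) := by
  set σ := inputState n s B v with hσ
  set a := σ.arr 0 with ha
  have hrow : ∀ u (hu : u < s), row n a u = v ⟨u, hu⟩ := by
    intro u hu
    refine row_eq_iff.2 fun j => ?_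
    simp [ha, hσ, inputState, hu]
  have hz : ∀ i, i ≠ 0 → σ.arr i = 0 := by
    intro i hi
    funext p q
    simp [hσ, inputState, hi]
  have v0 : σ.var 0 = n := by simp [hσ, inputState]
  have v1 : σ.var 1 = s := by simp [hσ, inputState]
  have v2 : σ.var 2 = B := by simp [hσ, inputState]
  have hshort : ∀ u < s, row n a u ∈ shortVectors L B := by
    intro u hu
    rw [hrow u hu, ← hv]
    exact ⟨_, rfl⟩
  have hsurj : ∀ x ∈ shortVectors L B, ∃ u < s, row n a u = x := by
    intro x hx
    rw [← hv] at hx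
    obtain ⟨u, rfl⟩ := hx
    exact ⟨u, u.2, hrow u u.2⟩
  have hnondeg : ∀ d : E n, (∀ u < s, inner ℝ (row n a u) d = (0 : ℝ)) → d = 0 := by
    intro d hd
    refine eq_zero_of_inner_eq_zero hspan ?_
    rintro _ ⟨u, rfl⟩
    rw [← hrow u u.2]
    exact hd u u.2
  apply Runs.seq
  refine (Runs.minimalBasis v0 v1 v2 ha.symm (hz 3 (by decide)) (hz 4 (by decide)) hnondeg
    fun u hu => (hshort u hu).2.2).frame.mono ?_
  rintro t1 τ1 ⟨⟨ht1, hdual, hbasis, hmin, hnorm⟩, F1⟩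
  set A := τ1.arr 3 with hA
  set d := rows n (τ1.arr 4) with hd
  have a0 : τ1.arr 0 = a := F1.arr 0 (by decide)
  have S : Setting n s L B a (rows n A) d := by
    refine ⟨hn, hL, hshort, hsurj, hdual, fun i => ?_⟩
    obtain ⟨u, hu, h⟩ := hbasis i
    rw [h]
    exact hshort u hu
  have hs : 0 < s := by
    obtain ⟨u, hu, -⟩ := hbasis ⟨0, hn⟩
    omega
  have hB : 1 ≤ B := (one_le_norm hL (hshort 0 hs).1 (hshort 0 hs).2.1).trans (hshort 0 hs).2.2
  apply Runs.seq
  refine (Runs.tables (n := n) (s := s) (B := B) (by rw [F1.var 0 (by decide), v0])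
    (by rw [F1.var 1 (by decide), v1]) (by rw [F1.var 2 (by decide), v2])
    (by rw [F1.arr 10 (by decide), hz 10 (by decide)])).frame.mono ?_
  rintro t2 τ2 ⟨⟨ht2, h9, h8, h7, hdict⟩, F2⟩
  rw [a0] at h8 h7 hdict
  have T2 : Tables n s B a A τ2 := by
    refine ⟨?_, ?_, ?_, ?_, h8, h9, hdict⟩
    · rw [F2.var 0 (by decide), F1.var 0 (by decide), v0]
    · rw [F2.var 1 (by decide), F1.var 1 (by decide), v1]
    · rw [F2.var 2 (by decide), F1.var 2 (by decide), v2]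
    · rw [F2.arr 6 (by decide)]
      exact hnorm
  have a3 : τ2.arr 3 = A := F2.arr 3 (by decide)
  apply Runs.seq
  refine (Runs.gramGroups (L := L) T2.dim hn
    (by rw [a3]; exact S.unsplit_singletons hmin)).frame.mono ?_
  rintro t3 τ3 ⟨⟨ht3, g, hG, horth⟩, F3⟩
  rw [a3] at hG horth
  have T3 := T2.congr F3 (by decide) (by decide) (by decide) (by decide) (by decide) (by decide)
    (by decide)
  apply Runs.seq
  refine (Runs.coarsen S hs T3 ⟨hG, fun i j => horth i j i.2 j.2⟩).frame.mono ?_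
  clear hG horth g
  rintro t4 τ4 ⟨⟨ht4, g, hG, hparts⟩, F4⟩
  have T4 := T3.congr F4 (by decide) (by decide) (by decide) (by decide) (by decide) (by decide)
    (by decide)
  have e7 : ∀ u < s, (fun j : Fin n => τ4.arr 7 u j) = fun j => inner ℝ (row n a u) (d j) := by
    intro u hu
    funext j
    rw [F4.arr 7 (by decide), F3.arr 7 (by decide), h7 u hu j j.2]
    rfl
  obtain ⟨D, hD, hDle, hden⟩ := S.dual.exists_denominator hL (fun i => (S.basis i).1)
    (fun i => (S.basis i).2.2) hn
  apply Runs.seq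
  refine (Runs.triangularBasis (g := g) S.dual (fun i => (S.basis i).1) hD hden T4.dim T4.card
    hG.label ?_ ?_).frame.mono ?_
  · intro u hu l
    rw [e7 u hu]
    by_cases hl : ∃ i : Fin n, g i = l
    · obtain ⟨i, rfl⟩ := hl
      exact not_not.1 (hparts u hu i i.2)
    -- A label that no index carries has zero part.
    · have : mask (fun i : Fin n => g i) l (fun j => inner ℝ (row n a u) (d j)) = 0 := by
        funext i
        simp only [mask]
        rw [if_neg fun h => hl ⟨i, h⟩]
        rfl
      rw [this, comb_zero]
      exact L.zero_mem
  · rw [F4.arr 13 (by decide), F3.arr 13 (by decide), F2.arr 13 (by decide),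
      F1.arr 13 (by decide), hz 13 (by decide)]
  rintro t5 τ5 ⟨⟨ht5, hAd, hmem⟩, F5⟩
  refine (Runs.output (n := n) (g := g) (by rw [F5.var 0 (by decide), T4.dim])
    (by rw [F5.arr 11 (by decide)]; exact hG.label) ?_).mono ?_
  · rw [F5.arr 15 (by decide), F4.arr 15 (by decide), F3.arr 15 (by decide),
      F2.arr 15 (by decide), F1.arr 15 (by decide), hz 15 (by decide)]
  rintro t6 τ6 ⟨ht6, hout, r, c, hr, hc2, hc, hcs⟩
  have b3 : τ5.arr 3 = A := by
    rw [F5.arr 3 (by decide), F4.arr 3 (by decide), F3.arr 3 (by decide), a3]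
  rw [b3] at hout
  have hout' : outputVector n τ6 = fun k : Fin n => comb (rows n A) (τ5.basisRow n k) :=
    funext hout
  refine ⟨⟨r, c, hr, hc2, ?_, ?_⟩, ?_⟩
  · rw [hout']
    exact S.dual.linearIndependent_comb (fun k j h => hAd.tri k k.2 j j.2 h)
      fun k => hAd.diag k k.2
  · rw [hout']
    refine S.dual.isIndecomposableDecomposition (g := fun i => g i)
      (H := fun k : Fin n => τ5.basisRow n k) hG.orth hG.unsplit
      (fun k j h => hAd.supp k k.2 j j.2 h) (fun k => hAd.diag k k.2) (fun k => hAd.mem k k.2) ?_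
      hc hcs
    rw [← hspan, Submodule.span_le]
    rintro _ ⟨u, rfl⟩
    have h1 := comb_mem_span (rows n A) (hmem u u.2)
    rw [e7 u u.2, S.dual.comb_inner, hrow u u.2] at h1
    rwa [← Set.range_comp] at h1
  · refine le_trans ?_ (total_time_le hn hs hB (logb_denominator_le hn hB hD hDle))
    have c1 : (t1 : ℝ) ≤ 10 + n * 50 + s * (67 + n * (150 + n * 45)) := by exact_mod_cast ht1
    have c2 : (t2 : ℝ) ≤ 40 + n * 20 + s * (30 + n * (60 + n * 40)) := by exact_mod_cast ht2
    have c3 : (t3 : ℝ) ≤ n ^ 3 * 300 := by exact_mod_cast ht3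
    have c4 : (t4 : ℝ) ≤ 5 + n * (90 + n * 120 + s * (60 + n * 80)) := by exact_mod_cast ht4
    have c6 : (t6 : ℝ) ≤ 20 + n * (62 + n * (50 + n * 20)) := by exact_mod_cast ht6
    push_cast
    linarith

end OrthDecomp

theorem mainTheorem3 :
    ∃ (P : OrthDecomp.Program) (C : ℝ),
      ∀ (n : ℕ) (_ : 0 < n)
        (L : Submodule ℤ (EuclideanSpace ℝ (Fin n))) [DiscreteTopology L] [IsZLattice ℝ L]
        (_ : OrthDecomp.IsIntegral L)
        (B : ℝ) (s : ℕ) (v : Fin s → EuclideanSpace ℝ (Fin n))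
        (_ : Function.Injective v)
        (_ : Set.range v = {x | x ∈ L ∧ x ≠ 0 ∧ ‖x‖ ≤ B})
        (_ : Submodule.span ℤ (Set.range v) = L),
        ∃ (t : ℕ) (τ : OrthDecomp.State),
          OrthDecomp.Exec P (OrthDecomp.inputState n s B v) t τ ∧
          OrthDecomp.OutputsDecomposition L τ ∧
          (t : ℝ) ≤ C * ((n : ℝ) ^ 6 * Real.log (n * B) ^ 2 + (s : ℝ) * (n : ℝ) ^ 2) := by
  refine ⟨.decompose, 5000, ?_⟩
  intro n hn L _ _ hL B s v _ hv hspan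
  exact OrthDecomp.Runs.decompose hn hL hv hspan
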